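/- **Proposition.** There are a randomized program $R$ with access to a procedure $A$ for factoring ideals, and a constant $C$, such that the following holds. *Setting.* For a non-square natural number $\delta$, an ideal of $\mathcal O_{\mathbb Q(\sqrt\delta)}$ is presented by two generators $(x_i+y_i\sqrt\delta)/z_i$ ($i=1,2$) with integers $x_i,y_i,z_i$, $z_i\neq 0$. The procedure $A$ may be any randomized procedure which takes an integer $N$, an integer $\delta$ and such a sextuple of integers, and returns two such sextuples; different calls use independent randomness. The program $R$ is one fixed finite program over integer registers: it uses addition, subtraction, multiplication, division with remainder, binary length, sign tests, loops, uniform random choice from $\{0,\dots,v-1\}$, and calls of $A$. Its running time is counted in bit operations (schoolbook cost for arithmetic), and questions to $A$ and its answers are charged by their length. *Running time.* For all $A$, $N$ and $k$, on input $(N,k)$ the program $R$ calls $A$ at most $k$ times and takes time at most $C(k+1)(1+\ell(N)+m)^C$, where $\ell(N)$ is the binary length of $N$ and $m$ is the maximal binary length of an integer occurring in the answers of $A$ during the run. *Success probability.* Let $N=pq$ be a product of two distinct prime numbers and let $0<\omega$. Suppose that $A$ has the following property: if $\delta$ is chosen uniformly at random among the non-squares $0<\delta<N$ such that $p$ and $q$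 split in $\mathbb Q(\sqrt\delta)$ (there is at least one such $\delta$), and then $\mathfrak n$ uniformly at random among the ideals $\mathfrak p\mathfrak q$, where $\mathfrak p$ and $\mathfrak q$ are prime ideals of $\mathcal O_{\mathbb Q(\sqrt\delta)}$ dividing $p$ and $q$, respectively, then on input $N$, $\delta$, $\mathfrak n$ the procedure $A$ returns two generators for each of the two prime factors of $\mathfrak n$ with probability at least $\omega$. Here $\mathfrak n$ is presented by $N,\ a+\sqrt\delta$ with $0\le a<N$ whenever it is generated by two elements of this form, and by an arbitrary fixed pair of generators otherwise. Then for every $k\ge 0$, on input $(N,k)$ the program $R$ outputs the two prime factors $p,q$ of $N$ with probability at least $$1-(1-\omega)^k .$$ -/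

import Mathlib

open scoped NumberField BigOperators

noncomputable section

namespace RabinQuadratic

/-! ### Quadratic fields and their ideals -/

/-- The field `ℚ(√δ)`, as a subfield of the real numbers (here `δ` is a natural number). -/
abbrev QuadField (δ : ℕ) : Type :=
  ↥(IntermediateField.adjoin ℚ {Real.sqrt (δ : ℝ)})

/-- The element `√δ` of `ℚ(√δ)`. -/
def rootElt (δ : ℕ) : QuadField δ :=
  IntermediateField.AdjoinSimple.gen ℚ (Real.sqrt (δ : ℝ))

theorem isIntegral_sqrt (δ : ℕ) : IsIntegral ℚ (Real.sqrt (δ : ℝ)) := by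
  refine IsIntegral.of_pow (n := 2) (by norm_num) ?_
  rw [Real.sq_sqrt (Nat.cast_nonneg δ)]
  exact_mod_cast (isIntegral_algebraMap : IsIntegral ℚ (algebraMap ℚ ℝ (δ : ℚ)))

instance (δ : ℕ) : NumberField (QuadField δ) where
  to_charZero := inferInstance
  to_finiteDimensional := IntermediateField.adjoin.finiteDimensional (isIntegral_sqrt δ)

/-- The finite set of prime ideals of the ring of integers of `ℚ(√δ)` above the rational
number `p` (used for prime numbers `p`). -/
def primesAbove (δ p : ℕ) : Finset (Ideal (𝓞 (QuadField δ))) :=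
  IsDedekindDomain.primesOverFinset (Ideal.span {(p : ℤ)}) (𝓞 (QuadField δ))

/-- The prime number `p` splits in the quadratic field `ℚ(√δ)`: there are exactly two
prime ideals above it. -/
def Splits (δ p : ℕ) : Prop := (primesAbove δ p).card = 2

open Classical in
/-- The non-squares `0 < δ < p q` such that `p` and `q` split in `ℚ(√δ)`. -/
def radicands (p q : ℕ) : Finset ℕ :=
  (Finset.Ioo 0 (p * q)).filter fun δ => ¬ IsSquare δ ∧ Splits δ p ∧ Splits δ q

open Classical in
/-- The ideals `𝔭 𝔮` of the ring of integers of `ℚ(√δ)`, with `𝔭` a prime ideal above `p`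
and `𝔮` a prime ideal above `q`. -/
def products (δ p q : ℕ) : Finset (Ideal (𝓞 (QuadField δ))) :=
  Finset.image₂ (fun P Q => P * Q) (primesAbove δ p) (primesAbove δ q)

/-- Six integers `x₁, y₁, z₁, x₂, y₂, z₂`, coding the two elements `(xᵢ + yᵢ √δ) / zᵢ`
of `ℚ(√δ)`. -/
abbrev IdealCode : Type := Fin 6 → ℤ

/-- The element `(x + y √δ) / z` of `ℚ(√δ)`. -/
def quadElt (δ : ℕ) (x y z : ℤ) : QuadField δ :=
  ((x : QuadField δ) + (y : QuadField δ) * rootElt δ) / (z : QuadField δ)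

/-- The code `c` presents the ideal `I` of the ring of integers of `ℚ(√δ)`: its two
elements (with non-zero denominators) are algebraic integers and generate `I`. -/
def Presents (δ : ℕ) (c : IdealCode) (I : Ideal (𝓞 (QuadField δ))) : Prop :=
  c 2 ≠ 0 ∧ c 5 ≠ 0 ∧ ∃ α β : 𝓞 (QuadField δ),
    (α : QuadField δ) = quadElt δ (c 0) (c 1) (c 2) ∧
    (β : QuadField δ) = quadElt δ (c 3) (c 4) (c 5) ∧
    I = Ideal.span {α, β}

/-- The code of the pair of generators `N`, `a + √δ`. -/
def stdCode (N a : ℕ) : IdealCode := ![(N : ℤ), 0, 1, (a : ℤ), 1, 1]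

/-- A way of handing the ideals `𝔫 = 𝔭 𝔮` to an algorithm: `pres δ 𝔫` is a code that
presents `𝔫`, and it is the code of `N, a + √δ` with `0 ≤ a < N = p q` whenever these two
elements generate `𝔫` (there is at most one such `a`). -/
def IsPresentation (p q : ℕ)
    (pres : (δ : ℕ) → Ideal (𝓞 (QuadField δ)) → IdealCode) : Prop :=
  ∀ δ ∈ radicands p q, ∀ n ∈ products δ p q,
    Presents δ (pres δ n) n ∧
    ∀ a : ℕ, a < p * q → Presents δ (stdCode (p * q) a) n → pres δ n = stdCode (p * q) a

/-! ### Algorithms that factor ideals -/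

/-- A randomized procedure for the ideal factorisation problem.  Its input consists of
`N`, `δ` and an ideal code, its output of two ideal codes.  Each call draws fresh randomness. -/
abbrev IdealFactorer : Type := (Fin 8 → ℤ) → PMF (Fin 12 → ℤ)

/-- The input for `N`, `δ` and the ideal code `c`. -/
def inputVec (N δ : ℕ) (c : IdealCode) : Fin 8 → ℤ :=
  ![(N : ℤ), (δ : ℤ), c 0, c 1, c 2, c 3, c 4, c 5]

/-- The output `r` is the factorisation of `n` into two prime ideals. -/
def IsFactorisation (δ : ℕ) (n : Ideal (𝓞 (QuadField δ))) (r : Fin 12 → ℤ) : Prop :=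
  ∃ P Q : Ideal (𝓞 (QuadField δ)), P.IsPrime ∧ Q.IsPrime ∧ P * Q = n ∧
    Presents δ ![r 0, r 1, r 2, r 3, r 4, r 5] P ∧
    Presents δ ![r 6, r 7, r 8, r 9, r 10, r 11] Q

open scoped BigOperators in
/-- The probability that `A` computes the factorisation of `𝔫`, where first `δ` is chosen
uniformly from `radicands p q`, then `𝔫` uniformly from `products δ p q`, and `𝔫` is
handed to `A` as `pres δ 𝔫`.  (It is `0` if there is no `δ` to choose.) -/
def successProb (p q : ℕ) (pres : (δ : ℕ) → Ideal (𝓞 (QuadField δ)) → IdealCode)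
    (A : IdealFactorer) : ℝ :=
  𝔼 δ ∈ radicands p q, 𝔼 n ∈ products δ p q,
    ((A (inputVec (p * q) δ (pres δ n))).toOuterMeasure
      {r | IsFactorisation δ n r}).toReal

/-! ### Randomized programs with calls to an ideal factoring procedure, and their cost -/

/-- The arithmetic operations of the programs (with `Int` division and remainder,
`x / 0 = 0` and `x % 0 = x`). -/
inductive Op
  | add | sub | mul | div | mod

/-- The value of an arithmetic operation. -/
def Op.eval : Op → ℤ → ℤ → ℤ
  | .add, x, y => x + y
  | .sub, x, y => x - y
  | .mul, x, y => x * y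
  | .div, x, y => x / y
  | .mod, x, y => x % y

/-- Programs over integer registers `0, 1, 2, …`. A program is a finite piece of syntax. -/
inductive Prog
  /-- do nothing -/
  | skip
  /-- `const d c`: write the constant `c` to register `d` -/
  | const (d : ℕ) (c : ℤ)
  /-- `op d o x y`: write `o` of registers `x` and `y` to register `d` -/
  | op (d : ℕ) (o : Op) (x y : ℕ)
  /-- `size d x`: write the binary length of register `x` to register `d` -/
  | size (d x : ℕ)
  /-- `rand d x`: write to register `d` a uniformly random element of `{0, …, v - 1}`,
  where `v` is the content of register `x` (and `0` if `v ≤ 0`) -/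
  | rand (d x : ℕ)
  /-- `query src dst`: call the ideal factoring procedure on registers
  `src, …, src + 7` and write its answer to registers `dst, …, dst + 11` -/
  | query (src dst : ℕ)
  /-- first one program, then another one -/
  | seq (c₁ c₂ : Prog)
  /-- `ifPos x c₁ c₂`: run `c₁` if register `x` is positive, and `c₂` otherwise -/
  | ifPos (x : ℕ) (c₁ c₂ : Prog)
  /-- `loop x c`: run `c` as many times as register `x` says at the start of the loop -/
  | loop (x : ℕ) (c : Prog)

/-- The binary length of an integer (without its sign). -/
def bits (x : ℤ) : ℕ := Nat.size x.natAbs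

/-- A state: the registers, the bit cost so far, the number of calls of the ideal factoring
procedure so far, and the greatest binary length of an integer in its answers so far. -/
structure State where
  reg : ℕ → ℤ
  time : ℕ
  queries : ℕ
  maxAnswer : ℕ

/-- Write `v` to register `d`, at cost `t`. -/
def State.write (s : State) (d : ℕ) (v : ℤ) (t : ℕ) : State :=
  { s with reg := Function.update s.reg d v, time := s.time + t }

/-- Increase the cost by `t`. -/
def State.tick (s : State) (t : ℕ) : State := { s with time := s.time + t }

/-- The uniform distribution on `{0, …, v - 1}`, and `0` if `v ≤ 0`. -/
def uniformBelow (v : ℤ) : PMF ℤ :=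
  if h : 0 < v then PMF.uniformOfFinset (Finset.Ico 0 v) (Finset.nonempty_Ico.mpr h)
  else PMF.pure 0

/-- The input registers of a call. -/
def State.args (s : State) (src : ℕ) : Fin 8 → ℤ := fun i => s.reg (src + i)

/-- The state after a call of the ideal factoring procedure with answer `r`. Reading the
answer and writing the question is paid for by their lengths. -/
def State.receive (s : State) (src dst : ℕ) (r : Fin 12 → ℤ) : State where
  reg := fun j => if h : dst ≤ j ∧ j < dst + 12 then r ⟨j - dst, by omega⟩ else s.reg j
  time := s.time + (1 + ∑ i, bits (s.args src i) + ∑ i, bits (r i))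
  queries := s.queries + 1
  maxAnswer := max s.maxAnswer (Finset.univ.sup fun i => bits (r i))

/-- Repeat a random transition `n` times, with fresh randomness each time. -/
def iterate {σ : Type} (f : σ → PMF σ) : ℕ → σ → PMF σ
  | 0, s => PMF.pure s
  | n + 1, s => (f s).bind (iterate f n)

/-- The distribution of the state after a program has been run, with `A` as the ideal
factoring procedure.  An arithmetic operation costs `(1 + b)²` when its operands have `b` bits
in total, as the schoolbook methods do. -/
def Prog.run (A : IdealFactorer) : Prog → State → PMF State
  | .skip, s => PMF.pure s
  | .const d c, s => PMF.pure (s.write d c (1 + bits c))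
  | .op d o x y, s => PMF.pure
      (s.write d (o.eval (s.reg x) (s.reg y)) ((1 + bits (s.reg x) + bits (s.reg y)) ^ 2))
  | .size d x, s => PMF.pure (s.write d (bits (s.reg x)) ((1 + bits (s.reg x)) ^ 2))
  | .rand d x, s => (uniformBelow (s.reg x)).map
      fun v => s.write d v (1 + bits (s.reg x))
  | .query src dst, s => (A (s.args src)).map fun r => s.receive src dst r
  | .seq c₁ c₂, s => (Prog.run A c₁ s).bind (Prog.run A c₂)
  | .ifPos x c₁ c₂, s =>
      if 0 < s.reg x then Prog.run A c₁ (s.tick 1) else Prog.run A c₂ (s.tick 1)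
  | .loop x c, s =>
      iterate (fun t => Prog.run A c (t.tick 1)) (s.reg x).toNat (s.tick (1 + bits (s.reg x)))

/-- The initial state: `N` in register `0`, `k` in register `1`, and `0` elsewhere. -/
def initState (N k : ℕ) : State where
  reg := fun j => if j = 0 then (N : ℤ) else if j = 1 then (k : ℤ) else 0
  time := 0
  queries := 0
  maxAnswer := 0

/-- The distribution of the final state of the program `R` on input `N`, `k`. -/
def Prog.result (R : Prog) (A : IdealFactorer) (N k : ℕ) : PMF State :=
  R.run A (initState N k)

/-- Registers `0` and `1` hold `p` and `q`, in some order. -/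
def State.Outputs (s : State) (p q : ℕ) : Prop :=
  (s.reg 0 = p ∧ s.reg 1 = q) ∨ (s.reg 0 = q ∧ s.reg 1 = p)

end RabinQuadratic

end

open scoped NumberField BigOperators

noncomputable section

namespace RabinQuadratic

/-! ### Arithmetic of `ℚ(√δ)` -/

/-! This is Rabin's reduction of factoring to square roots modulo N, with prime ideals in the role
of the roots. Let N = pq be odd and let δ be a radicand prime to N. The prime ideals above p are (p,
±b + √δ) with b² ≡ δ modulo p, so by the Chinese remainder theorem the four ideals 𝔭𝔮 are the ideals
(N, a + √δ), where a runs through the four square roots of δ modulo N. Choosing a first and putting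
δ = a² mod N therefore draws a uniform pair (δ, 𝔫) without knowing p and q (`sum_products_eq`,
`sum_unitRadicands`).

A factorisation of 𝔫 reveals a prime number. A prime factor P of 𝔫 contains p or q, say p, and then
the norms of its generators α, β and of α + β are divisible by p. Were all three divisible by q, two
of the elements would lie in the same one of a prime ideal above q and its conjugate; that ideal
would contain α and β, hence both p and q. So one of three norms has a non-trivial divisor in common
with N (`exists_codeNorms`).

To get the bound ω for a trial without any loss, the radicands that are not prime to N must be
accounted for, since they are never used in a successful call. They are divisible by p² or q²
(`sq_dvd_of_splits`), so they are few. On the other side, a trial certainly succeeds if a has a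
divisor in common with N, or if a² mod N is a perfect square b², by the gcd of N with a - b. For p,
q ≥ 7 these certain successes outweigh the lost radicands (`card_sq_multiples_le`,
`successProb_le`); this is why 2, 3, 5 are tested separately. Hence a trial fails with probability
at most 1 - ω (`trial_fail_le`), and fresh randomness gives (1 - ω)^k for k trials
(`iterate_fail_le`).

For the running time, each deterministic part enlarges binary lengths at most linearly and has cubic
cost (`Poly`), a property that survives composition. The loops for gcd and square root have about
log N steps. Each trial starts by clearing its registers, so that lengths do not accumulate over the
trials (`exists_trial_bound`). -/

theorem rootElt_sq (δ : ℕ) : rootElt δ * rootElt δ = (δ : QuadField δ) := by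
  apply Subtype.ext
  simp only [rootElt, MulMemClass.coe_mul, IntermediateField.AdjoinSimple.coe_gen]
  rw [Real.mul_self_sqrt (Nat.cast_nonneg δ)]
  simp

theorem minpoly_sqrt {δ : ℕ} (hδ : ¬ IsSquare δ) :
    minpoly ℚ (Real.sqrt (δ : ℝ)) = Polynomial.X ^ 2 - Polynomial.C (δ : ℚ) := by
  symm
  refine minpoly.eq_of_irreducible_of_monic ?_ ?_ (Polynomial.monic_X_pow_sub_C _ two_ne_zero)
  · rw [X_pow_sub_C_irreducible_iff_of_prime Nat.prime_two]
    intro b hb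
    apply hδ
    rw [← Rat.isSquare_natCast_iff]
    exact ⟨b, by rw [← hb, sq]⟩
  · simp [Real.sq_sqrt (Nat.cast_nonneg δ : (0 : ℝ) ≤ δ)]

theorem finrank_quadField {δ : ℕ} (hδ : ¬ IsSquare δ) : Module.finrank ℚ (QuadField δ) = 2 := by
  rw [IntermediateField.adjoin.finrank (isIntegral_sqrt δ), minpoly_sqrt hδ,
    Polynomial.natDegree_X_pow_sub_C]

/-- `√δ` as an algebraic integer. -/
def rootInt (δ : ℕ) : 𝓞 (QuadField δ) :=
  ⟨rootElt δ, by
    refine IsIntegral.of_pow (n := 2) (by norm_num) ?_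
    rw [sq, rootElt_sq]
    exact isIntegral_algebraMap (R := ℤ) (x := (δ : ℤ))⟩

@[simp] theorem coe_rootInt (δ : ℕ) : ((rootInt δ : 𝓞 (QuadField δ)) : QuadField δ) = rootElt δ :=
  rfl

theorem rootInt_sq (δ : ℕ) : rootInt δ * rootInt δ = (δ : 𝓞 (QuadField δ)) := by
  apply NumberField.RingOfIntegers.ext
  simp [rootElt_sq]

/-- The element -√δ is another root of the minimal polynomial X² - δ, so the power basis of √δ
provides a homomorphism onto it. -/
theorem exists_conjugation {δ : ℕ} (hδ : ¬ IsSquare δ) :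
    ∃ σ : QuadField δ →+* QuadField δ, σ (rootElt δ) = - rootElt δ := by
  let pb := IntermediateField.adjoin.powerBasis (isIntegral_sqrt δ)
  have hgen : pb.gen = rootElt δ := IntermediateField.adjoin.powerBasis_gen _
  have hm := (IntermediateField.minpoly_gen ℚ (Real.sqrt (δ : ℝ))).trans (minpoly_sqrt hδ)
  refine ⟨(pb.lift (- rootElt δ) ?_).toRingHom, ?_⟩
  · refine (congrArg (Polynomial.aeval (- rootElt δ)) hm).trans ?_
    simp [sq, rootElt_sq]
  · have h := pb.lift_gen (- rootElt δ)
      ((congrArg (Polynomial.aeval (- rootElt δ)) hm).trans (by simp [sq, rootElt_sq]))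
    exact (congrArg _ hgen.symm).trans h

/-- The non-trivial automorphism of `ℚ(√δ)`, on elements. -/
def conjK {δ : ℕ} (hδ : ¬ IsSquare δ) : QuadField δ →+* QuadField δ :=
  (exists_conjugation hδ).choose

theorem conjK_rootElt {δ : ℕ} (hδ : ¬ IsSquare δ) : conjK hδ (rootElt δ) = - rootElt δ :=
  (exists_conjugation hδ).choose_spec

/-- The conjugation on the ring of integers of `ℚ(√δ)`. -/
def conjO {δ : ℕ} (hδ : ¬ IsSquare δ) : 𝓞 (QuadField δ) →+* 𝓞 (QuadField δ) :=
  NumberField.RingOfIntegers.mapRingHom (conjK hδ)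

theorem coe_conjO {δ : ℕ} (hδ : ¬ IsSquare δ) (x : 𝓞 (QuadField δ)) :
    ((conjO hδ x : 𝓞 (QuadField δ)) : QuadField δ) = conjK hδ x := rfl

theorem conjO_rootInt {δ : ℕ} (hδ : ¬ IsSquare δ) : conjO hδ (rootInt δ) = - rootInt δ := by
  apply NumberField.RingOfIntegers.ext
  simp [coe_conjO, conjK_rootElt]

theorem conjK_quadElt {δ : ℕ} (hδ : ¬ IsSquare δ) (x y z : ℤ) :
    conjK hδ (quadElt δ x y z) = quadElt δ x (-y) z := by
  simp [quadElt, conjK_rootElt]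

/-- The norm of `(x + y √δ) / z` for integers `x, y, z`, computed with integer division. -/
def quadNorm (δ : ℤ) (x y z : ℤ) : ℤ := (x * x - y * y * δ) / (z * z)

/-! ### Rational integers in rings of integers and their prime ideals -/

theorem intCast_dvd_iff {K : Type*} [Field K] [NumberField K] (a b : ℤ) :
    (a : 𝓞 K) ∣ (b : 𝓞 K) ↔ a ∣ b := by
  refine ⟨?_, fun h => by exact_mod_cast map_dvd (Int.castRingHom (𝓞 K)) h⟩
  rintro ⟨γ, hγ⟩
  rcases eq_or_ne a 0 with rfl | ha
  · simp only [Int.cast_zero, zero_mul, Int.cast_eq_zero] at hγ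
    simp [hγ]
  have hγ' : (b : K) = a * (γ : K) := by
    have := congrArg (algebraMap (𝓞 K) K) hγ
    simpa using this
  have haK : (a : K) ≠ 0 := by exact_mod_cast ha
  -- The quotient b / a is rational and integral, hence in ℤ, which is integrally closed.
  have hint : IsIntegral ℤ ((b : ℚ) / a) := by
    rw [← isIntegral_algebraMap_iff (algebraMap ℚ K).injective]
    have : algebraMap ℚ K ((b : ℚ) / a) = γ := by
      rw [map_div₀, map_intCast, map_intCast, hγ']
      field_simp
    rw [this]
    exact γ.isIntegral_coe
  obtain ⟨m, hm⟩ := IsIntegrallyClosed.isIntegral_iff.mp hint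
  refine ⟨m, ?_⟩
  have haQ : (a : ℚ) ≠ 0 := by exact_mod_cast ha
  rw [eq_div_iff haQ] at hm
  have : (m : ℚ) * a = b := by simpa using hm
  rw [mul_comm]
  exact_mod_cast this.symm

/-- The integers in P form a proper ideal of ℤ that contains the maximal ideal (p). -/
theorem intCast_mem_iff {K : Type*} [Field K] [NumberField K] {P : Ideal (𝓞 K)} (hP : P ≠ ⊤)
    {p : ℕ} (hp : p.Prime) (hpP : (p : 𝓞 K) ∈ P) (m : ℤ) : (m : 𝓞 K) ∈ P ↔ (p : ℤ) ∣ m := by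
  constructor
  · intro hm
    by_contra hdvd
    have hcop : IsCoprime (p : ℤ) m :=
      (Nat.prime_iff_prime_int.mp hp).irreducible.coprime_iff_not_dvd.mpr hdvd
    obtain ⟨u, v, huv⟩ := hcop
    apply hP
    rw [Ideal.eq_top_iff_one]
    have h1 : ((u * p + v * m : ℤ) : 𝓞 K) = 1 := by rw [huv]; simp
    rw [← h1]
    push_cast
    exact P.add_mem (P.mul_mem_left _ hpP) (P.mul_mem_left _ hm)
  · rintro ⟨c, rfl⟩
    push_cast
    exact P.mul_mem_right _ hpP

theorem mem_primesAbove_iff {δ p : ℕ} (hp : p.Prime) (P : Ideal (𝓞 (QuadField δ))) :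
    P ∈ primesAbove δ p ↔ P.IsPrime ∧ (p : 𝓞 (QuadField δ)) ∈ P := by
  have hp' : Prime (p : ℤ) := Nat.prime_iff_prime_int.mp hp
  have hprime : (Ideal.span {(p : ℤ)}).IsPrime :=
    (Ideal.span_singleton_prime hp'.ne_zero).mpr hp'
  have h0 : Ideal.span {(p : ℤ)} ≠ ⊥ := by simpa using hp.ne_zero
  have hmax : (Ideal.span {(p : ℤ)}).IsMaximal := hprime.isMaximal h0
  rw [primesAbove, IsDedekindDomain.mem_primesOverFinset_iff h0]
  refine and_congr_right fun hP => ?_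
  rw [Ideal.liesOver_iff, Ideal.under_def]
  constructor
  · intro h
    have : (p : ℤ) ∈ Ideal.span {(p : ℤ)} := Ideal.mem_span_singleton_self _
    rw [h] at this
    simpa using this
  · intro h
    ext m
    rw [Ideal.mem_span_singleton, Ideal.mem_comap, eq_intCast, intCast_mem_iff hP.ne_top hp h]

theorem absNorm_span_prime {δ : ℕ} (hδ : ¬ IsSquare δ) (n : ℕ) :
    Ideal.absNorm (Ideal.span {(n : 𝓞 (QuadField δ))}) = n ^ 2 := by
  rw [Ideal.absNorm_span_natCast, NumberField.RingOfIntegers.rank, finrank_quadField hδ]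

/-! ### The ideals `(m, a + √δ)` -/

/-- The ideal generated by `m` and `a + √δ`. -/
def linIdeal (δ m : ℕ) (a : ℤ) : Ideal (𝓞 (QuadField δ)) :=
  Ideal.span {(m : 𝓞 (QuadField δ)), (a : 𝓞 (QuadField δ)) + rootInt δ}

theorem natCast_mem_linIdeal (δ m : ℕ) (a : ℤ) : (m : 𝓞 (QuadField δ)) ∈ linIdeal δ m a :=
  Ideal.subset_span (by simp)

theorem add_rootInt_mem_linIdeal (δ m : ℕ) (a : ℤ) :
    (a : 𝓞 (QuadField δ)) + rootInt δ ∈ linIdeal δ m a :=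
  Ideal.subset_span (by simp)

theorem linIdeal_le_iff {δ m : ℕ} {a : ℤ} {I : Ideal (𝓞 (QuadField δ))} :
    linIdeal δ m a ≤ I ↔ (m : 𝓞 (QuadField δ)) ∈ I ∧ (a : 𝓞 (QuadField δ)) + rootInt δ ∈ I := by
  rw [linIdeal, Ideal.span_le]
  simp [Set.insert_subset_iff]

theorem linIdeal_le_of_dvd {δ m n : ℕ} {a b : ℤ} (h : n ∣ m) (hab : (n : ℤ) ∣ a - b) :
    linIdeal δ m a ≤ linIdeal δ n b := by
  rw [linIdeal_le_iff]
  constructor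
  · obtain ⟨c, rfl⟩ := h
    push_cast
    exact Ideal.mul_mem_right _ _ (natCast_mem_linIdeal _ _ _)
  · obtain ⟨c, hc⟩ := hab
    have : (a : 𝓞 (QuadField δ)) + rootInt δ = n * c + (b + rootInt δ) := by
      have : a = n * c + b := by linarith
      rw [this]; push_cast; ring
    rw [this]
    exact Ideal.add_mem _ (Ideal.mul_mem_right _ _ (natCast_mem_linIdeal _ _ _))
      (add_rootInt_mem_linIdeal _ _ _)

theorem linIdeal_congr {δ m : ℕ} {a b : ℤ} (hab : (m : ℤ) ∣ a - b) :
    linIdeal δ m a = linIdeal δ m b :=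
  le_antisymm (linIdeal_le_of_dvd dvd_rfl hab)
    (linIdeal_le_of_dvd dvd_rfl (by rw [← neg_sub]; exact hab.neg_right))

/-- The product is generated by p², p(a + √δ), p(-a + √δ) and δ - a², all multiples of p. Conversely
it contains p² and 2ap, whose greatest common divisor is p. -/
theorem linIdeal_mul_neg {δ p : ℕ} (hp : p.Prime) {a : ℤ} (ha : (p : ℤ) ∣ a * a - δ)
    (h2a : ¬ (p : ℤ) ∣ 2 * a) :
    linIdeal δ p a * linIdeal δ p (-a) = Ideal.span {(p : 𝓞 (QuadField δ))} := by
  apply le_antisymm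
  · rw [linIdeal, linIdeal, Ideal.span_pair_mul_span_pair, Ideal.span_le]
    obtain ⟨c, hc⟩ := ha
    have hc' : (a : 𝓞 (QuadField δ)) * a - δ = p * c := by exact_mod_cast hc
    intro x hx
    simp only [Set.mem_insert_iff, Set.mem_singleton_iff] at hx
    rw [SetLike.mem_coe, Ideal.mem_span_singleton]
    rcases hx with rfl | rfl | rfl | rfl
    · exact dvd_mul_right _ _
    · exact dvd_mul_right _ _
    · exact dvd_mul_left _ _
    · refine ⟨-c, ?_⟩
      push_cast
      linear_combination rootInt_sq δ - hc'
  · rw [Ideal.span_singleton_le_iff_mem]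
    obtain ⟨u, v, huv⟩ : IsCoprime (p : ℤ) (2 * a) :=
      (Nat.prime_iff_prime_int.mp hp).irreducible.coprime_iff_not_dvd.mpr h2a
    have huv' : (u : 𝓞 (QuadField δ)) * p + v * (2 * a) = 1 := by exact_mod_cast huv
    have key : (p : 𝓞 (QuadField δ)) = u * ((p : 𝓞 (QuadField δ)) * p) +
        v * ((a + rootInt δ) * p - p * ((-a : ℤ) + rootInt δ)) := by
      push_cast
      linear_combination - (p : 𝓞 (QuadField δ)) * huv'
    rw [key]
    refine Ideal.add_mem _ (Ideal.mul_mem_left _ _ ?_) (Ideal.mul_mem_left _ _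
      (Ideal.sub_mem _ ?_ ?_))
    · exact Ideal.mul_mem_mul (natCast_mem_linIdeal _ _ _) (natCast_mem_linIdeal _ _ _)
    · exact Ideal.mul_mem_mul (add_rootInt_mem_linIdeal _ _ _) (natCast_mem_linIdeal _ _ _)
    · exact Ideal.mul_mem_mul (natCast_mem_linIdeal _ _ _) (add_rootInt_mem_linIdeal _ _ _)

/-- Otherwise (p, -a + √δ) would equal (p); adding the relation -a + √δ = pγ and its conjugate gives
p ∣ 2a. -/
theorem linIdeal_ne_top {δ p : ℕ} (hδ : ¬ IsSquare δ) (hp : p.Prime) {a : ℤ}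
    (ha : (p : ℤ) ∣ a * a - δ) (h2a : ¬ (p : ℤ) ∣ 2 * a) : linIdeal δ p a ≠ ⊤ := by
  intro htop
  have h := linIdeal_mul_neg hp ha h2a
  rw [htop, Ideal.top_mul] at h
  have hmem := add_rootInt_mem_linIdeal δ p (-a)
  rw [h, Ideal.mem_span_singleton] at hmem
  obtain ⟨γ, hγ⟩ := hmem
  have hσ := congrArg (conjO hδ) hγ
  simp only [map_add, map_mul, map_intCast, map_natCast, conjO_rootInt] at hσ
  apply h2a
  rw [← dvd_neg, ← intCast_dvd_iff (K := QuadField δ)]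
  refine ⟨γ + conjO hδ γ, ?_⟩
  push_cast at hγ hσ ⊢
  linear_combination hγ + hσ

/-- The norms of the two conjugate ideals multiply to p², and neither of them is 1. -/
theorem absNorm_linIdeal {δ p : ℕ} (hδ : ¬ IsSquare δ) (hp : p.Prime) {a : ℤ}
    (ha : (p : ℤ) ∣ a * a - δ) (h2a : ¬ (p : ℤ) ∣ 2 * a) :
    Ideal.absNorm (linIdeal δ p a) = p := by
  have h := congrArg Ideal.absNorm (linIdeal_mul_neg hp ha h2a)
  rw [map_mul, absNorm_span_prime hδ] at h
  refine ((Nat.Prime.mul_eq_prime_sq_iff hp ?_ ?_).mp h).1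
  · rw [Ne, Ideal.absNorm_eq_one_iff]
    exact linIdeal_ne_top hδ hp ha h2a
  · rw [Ne, Ideal.absNorm_eq_one_iff]
    exact linIdeal_ne_top hδ hp (by simpa using ha) (by simpa using h2a)

theorem linIdeal_isPrime {δ p : ℕ} (hδ : ¬ IsSquare δ) (hp : p.Prime) {a : ℤ}
    (ha : (p : ℤ) ∣ a * a - δ) (h2a : ¬ (p : ℤ) ∣ 2 * a) : (linIdeal δ p a).IsPrime :=
  Ideal.isPrime_of_irreducible_absNorm (by rw [absNorm_linIdeal hδ hp ha h2a]; exact hp)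

theorem linIdeal_ne_neg {δ p : ℕ} (hδ : ¬ IsSquare δ) (hp : p.Prime) {a : ℤ}
    (ha : (p : ℤ) ∣ a * a - δ) (h2a : ¬ (p : ℤ) ∣ 2 * a) :
    linIdeal δ p a ≠ linIdeal δ p (-a) := by
  intro h
  have h1 := add_rootInt_mem_linIdeal δ p (-a)
  rw [← h] at h1
  have h2 := Ideal.sub_mem _ (add_rootInt_mem_linIdeal δ p a) h1
  apply h2a
  rw [← intCast_mem_iff (linIdeal_ne_top hδ hp ha h2a) hp (natCast_mem_linIdeal _ _ _)]
  convert h2 using 1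
  push_cast
  ring

/-- A prime number `p` not dividing `2 a`, with `a² ≡ δ` modulo `p`, is the product of the prime
ideals `(p, a + √δ)` and `(p, -a + √δ)`. -/
theorem primesAbove_eq {δ p : ℕ} (hδ : ¬ IsSquare δ) (hp : p.Prime) {a : ℤ}
    (ha : (p : ℤ) ∣ a * a - δ) (h2a : ¬ (p : ℤ) ∣ 2 * a) :
    primesAbove δ p = {linIdeal δ p a, linIdeal δ p (-a)} := by
  have hp0 : (p : 𝓞 (QuadField δ)) ≠ 0 := by exact_mod_cast hp.ne_zero
  have hm : ∀ b : ℤ, (p : ℤ) ∣ b * b - δ → ¬ (p : ℤ) ∣ 2 * b → ∀ P : Ideal (𝓞 (QuadField δ)),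
      P.IsPrime → linIdeal δ p b ≤ P → P = linIdeal δ p b := by
    intro b hb h2b P hP hle
    have h1 := linIdeal_isPrime hδ hp hb h2b
    have h2 : linIdeal δ p b ≠ ⊥ := fun h0 => hp0 (by
      have := natCast_mem_linIdeal δ p b
      rwa [h0, Ideal.mem_bot] at this)
    exact ((h1.isMaximal h2).eq_of_le hP.ne_top hle).symm
  ext P
  rw [mem_primesAbove_iff hp, Finset.mem_insert, Finset.mem_singleton]
  constructor
  · rintro ⟨hP, hpP⟩
    have hle : linIdeal δ p a * linIdeal δ p (-a) ≤ P := by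
      rw [linIdeal_mul_neg hp ha h2a, Ideal.span_singleton_le_iff_mem]
      exact hpP
    rcases (hP.mul_le).mp hle with h | h
    · exact Or.inl (hm a ha h2a P hP h)
    · exact Or.inr (hm (-a) (by simpa using ha) (by simpa using h2a) P hP h)
  · rintro (rfl | rfl)
    · exact ⟨linIdeal_isPrime hδ hp ha h2a, natCast_mem_linIdeal _ _ _⟩
    · exact ⟨linIdeal_isPrime hδ hp (by simpa using ha) (by simpa using h2a),
        natCast_mem_linIdeal _ _ _⟩

theorem splits_of_dvd {δ p : ℕ} (hδ : ¬ IsSquare δ) (hp : p.Prime) {a : ℤ}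
    (ha : (p : ℤ) ∣ a * a - δ) (h2a : ¬ (p : ℤ) ∣ 2 * a) : Splits δ p := by
  rw [Splits, primesAbove_eq hδ hp ha h2a, Finset.card_pair (linIdeal_ne_neg hδ hp ha h2a)]

/-! ### Norms and residue fields at split prime numbers -/

theorem primesAbove_isMaximal {δ p : ℕ} (hp : p.Prime) {P : Ideal (𝓞 (QuadField δ))}
    (hP : P ∈ primesAbove δ p) : P.IsMaximal := by
  obtain ⟨h1, h2⟩ := (mem_primesAbove_iff hp P).mp hP
  refine h1.isMaximal fun h0 => ?_
  rw [h0, Ideal.mem_bot] at h2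
  exact hp.ne_zero (by exact_mod_cast h2)

theorem isCoprime_of_mem_primesAbove {δ p : ℕ} (hp : p.Prime) {P Q : Ideal (𝓞 (QuadField δ))}
    (hP : P ∈ primesAbove δ p) (hQ : Q ∈ primesAbove δ p) (hPQ : P ≠ Q) : IsCoprime P Q := by
  have := primesAbove_isMaximal hp hP
  have := primesAbove_isMaximal hp hQ
  exact Ideal.isCoprime_iff_sup_eq.mpr (Ideal.IsMaximal.coprime_of_ne ‹_› ‹_› hPQ)

theorem mul_le_of_mem_primesAbove {δ p : ℕ} (hp : p.Prime) {P Q : Ideal (𝓞 (QuadField δ))}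
    (hP : P ∈ primesAbove δ p) (hQ : Q ∈ primesAbove δ p) (hPQ : P ≠ Q)
    {x : 𝓞 (QuadField δ)} (h1 : x ∈ P) (h2 : x ∈ Q) : x ∈ P * Q := by
  rw [Ideal.mul_eq_inf_of_isCoprime (isCoprime_of_mem_primesAbove hp hP hQ hPQ)]
  exact ⟨h1, h2⟩

theorem prime_dvd_absNorm {δ p : ℕ} (hδ : ¬ IsSquare δ) (hp : p.Prime)
    {P : Ideal (𝓞 (QuadField δ))} (hP : P ∈ primesAbove δ p) : p ∣ Ideal.absNorm P := by
  obtain ⟨h1, h2⟩ := (mem_primesAbove_iff hp P).mp hP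
  have := absNorm_span_prime hδ p ▸
    Ideal.absNorm_dvd_absNorm_of_le ((Ideal.span_singleton_le_iff_mem P).mpr h2)
  obtain ⟨i, -, hi⟩ := (Nat.dvd_prime_pow hp).mp this
  rw [hi]
  refine dvd_pow_self _ fun h0 => h1.ne_top ?_
  rw [← Ideal.absNorm_eq_one_iff, hi, h0, pow_zero]

/-- Distinct P and Q are coprime, so p lies in PQ and the product of their norms divides p². Both
norms are multiples of p, which leaves no room for another factor. -/
theorem absNorm_of_splits {δ p : ℕ} (hδ : ¬ IsSquare δ) (hp : p.Prime)
    {P Q : Ideal (𝓞 (QuadField δ))} (hP : P ∈ primesAbove δ p) (hQ : Q ∈ primesAbove δ p)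
    (hPQ : P ≠ Q) : Ideal.absNorm P = p := by
  have hle : Ideal.span {(p : 𝓞 (QuadField δ))} ≤ P * Q := by
    rw [Ideal.span_singleton_le_iff_mem]
    exact mul_le_of_mem_primesAbove hp hP hQ hPQ ((mem_primesAbove_iff hp P).mp hP).2
      ((mem_primesAbove_iff hp Q).mp hQ).2
  have h := Ideal.absNorm_dvd_absNorm_of_le hle
  rw [map_mul, absNorm_span_prime hδ] at h
  obtain ⟨c, hc⟩ := prime_dvd_absNorm hδ hp hP
  obtain ⟨d, hd⟩ := prime_dvd_absNorm hδ hp hQ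
  rw [hc, hd, show p * c * (p * d) = p ^ 2 * (c * d) by ring] at h
  have h1 : c * d ∣ 1 := Nat.dvd_of_mul_dvd_mul_left (pow_pos hp.pos 2) (by simpa using h)
  have hc1 : c = 1 := Nat.dvd_one.mp ((dvd_mul_right c d).trans h1)
  rw [hc, hc1, mul_one]

theorem exists_pair_of_splits {δ p : ℕ} (h : Splits δ p) :
    ∃ P Q : Ideal (𝓞 (QuadField δ)), P ∈ primesAbove δ p ∧ Q ∈ primesAbove δ p ∧ P ≠ Q := by
  obtain ⟨P, Q, hne, heq⟩ := Finset.card_eq_two.mp h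
  exact ⟨P, Q, by simp [heq], by simp [heq], hne⟩

/-- The residue field of P has p elements, so the classes of 0, …, p - 1 exhaust it and one of them
is the class of √δ. For this a, the number a² - δ = (a - √δ)(a + √δ) lies in P. -/
theorem exists_sq_of_splits {δ p : ℕ} (hδ : ¬ IsSquare δ) (hp : p.Prime) (h : Splits δ p) :
    ∃ a : ℤ, (p : ℤ) ∣ a * a - δ := by
  obtain ⟨P, Q, hP, hQ, hne⟩ := exists_pair_of_splits h
  have hcard := absNorm_of_splits hδ hp hP hQ hne
  obtain ⟨hPp, hpP⟩ := (mem_primesAbove_iff hp P).mp hP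
  rw [Ideal.absNorm_apply, Submodule.cardQuot_apply] at hcard
  have hfin : Finite (𝓞 (QuadField δ) ⧸ P) := Nat.finite_of_card_ne_zero (by
    rw [hcard]; exact hp.ne_zero)
  have hinj : Function.Injective
      (fun i : Fin p => Ideal.Quotient.mk P ((i : ℕ) : 𝓞 (QuadField δ))) := by
    intro i j hij
    have h1 : ((((i : ℕ) : ℤ) - ((j : ℕ) : ℤ) : ℤ) : 𝓞 (QuadField δ)) ∈ P := by
      have := Ideal.Quotient.eq.mp hij
      simpa using this
    rw [intCast_mem_iff hPp.ne_top hp hpP] at h1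
    have h2 := Int.eq_zero_of_abs_lt_dvd h1 (by rw [abs_lt]; constructor <;> omega)
    exact Fin.ext (by omega)
  have hsurj := (hinj.bijective_of_nat_card_le (by rw [Nat.card_fin, hcard])).2
  obtain ⟨i, hi⟩ := hsurj (Ideal.Quotient.mk P (rootInt δ))
  refine ⟨(i : ℕ), ?_⟩
  rw [← intCast_mem_iff hPp.ne_top hp hpP]
  have h1 := Ideal.Quotient.eq.mp hi
  have h2 := P.mul_mem_right (((i : ℕ) : 𝓞 (QuadField δ)) + rootInt δ) h1
  have h3 : ((((i : ℕ) : ℤ) * ((i : ℕ) : ℤ) - (δ : ℤ) : ℤ) : 𝓞 (QuadField δ)) =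
      (((i : ℕ) : 𝓞 (QuadField δ)) - rootInt δ) * (((i : ℕ) : 𝓞 (QuadField δ)) + rootInt δ) := by
    push_cast
    linear_combination rootInt_sq δ
  rw [h3]
  exact h2

/-- A prime number that divides `δ` exactly once does not split in `ℚ(√δ)`. -/
theorem sq_dvd_of_splits {δ p : ℕ} (hδ : ¬ IsSquare δ) (hp : p.Prime) (h : Splits δ p)
    (hpδ : p ∣ δ) : p ^ 2 ∣ δ := by
  obtain ⟨P, Q, hP, hQ, hne⟩ := exists_pair_of_splits h
  by_contra hsq
  obtain ⟨m, rfl⟩ := hpδ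
  have hm : ¬ (p : ℤ) ∣ m := by
    rw [Int.natCast_dvd_natCast]
    rintro ⟨c, rfl⟩
    exact hsq ⟨c, by ring⟩
  obtain ⟨u, v, huv⟩ : IsCoprime (p : ℤ) (m : ℤ) :=
    (Nat.prime_iff_prime_int.mp hp).irreducible.coprime_iff_not_dvd.mpr hm
  obtain ⟨hPp, hpP⟩ := (mem_primesAbove_iff hp P).mp hP
  obtain ⟨hQp, hpQ⟩ := (mem_primesAbove_iff hp Q).mp hQ
  have hr : ∀ I : Ideal (𝓞 (QuadField (p * m))), I.IsPrime →
      (p : 𝓞 (QuadField (p * m))) ∈ I → rootInt (p * m) ∈ I := by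
    intro I hI hpI
    have : rootInt (p * m) * rootInt (p * m) ∈ I := by
      rw [rootInt_sq]
      push_cast
      exact I.mul_mem_right _ hpI
    exact (hI.mem_or_mem this).elim id id
  have h1 := mul_le_of_mem_primesAbove hp hP hQ hne hpP hpQ
  have h2 := mul_le_of_mem_primesAbove hp hP hQ hne (hr P hPp hpP) (hr Q hQp hpQ)
  -- Both p and √δ lie in PQ. From δ = pm and up + vm = 1 one gets p = up² + v(√δ)², an element of
  -- (PQ)². But (PQ)² has norm p⁴, which does not divide p².
  have hle : Ideal.span {(p : 𝓞 (QuadField (p * m)))} ≤ (P * Q) * (P * Q) := by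
    rw [Ideal.span_singleton_le_iff_mem]
    have huv' : (u : 𝓞 (QuadField (p * m))) * p + v * m = 1 := by exact_mod_cast huv
    have key : (p : 𝓞 (QuadField (p * m))) = u * ((p : 𝓞 (QuadField (p * m))) * p) +
        v * (rootInt (p * m) * rootInt (p * m)) := by
      have := rootInt_sq (p * m)
      push_cast at this
      linear_combination - (p : 𝓞 (QuadField (p * m))) * huv' - (v : 𝓞 (QuadField (p * m))) * this
    rw [key]
    exact Ideal.add_mem _ (Ideal.mul_mem_left _ _ (Ideal.mul_mem_mul h1 h1))
      (Ideal.mul_mem_left _ _ (Ideal.mul_mem_mul h2 h2))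
  have h3 := Ideal.absNorm_dvd_absNorm_of_le hle
  rw [map_mul, map_mul, absNorm_span_prime hδ, absNorm_of_splits hδ hp hP hQ hne,
    absNorm_of_splits hδ hp hQ hP hne.symm] at h3
  have h4 := Nat.le_of_dvd (pow_pos hp.pos 2) h3
  nlinarith [hp.two_le, mul_pos hp.pos hp.pos, mul_le_mul hp.two_le hp.two_le (by norm_num) (by omega)]

/-! ### The ideals `𝔭 𝔮` -/

/-- With up + vq = 1 one has a + √δ = up(a + √δ) + vq(a + √δ), and both summands lie in the product.
-/
theorem linIdeal_mul {δ p q : ℕ} (hpq : Nat.Coprime p q) (a : ℤ) :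
    linIdeal δ p a * linIdeal δ q a = linIdeal δ (p * q) a := by
  apply le_antisymm
  · rw [linIdeal, linIdeal, Ideal.span_pair_mul_span_pair, Ideal.span_le]
    intro x hx
    simp only [Set.mem_insert_iff, Set.mem_singleton_iff] at hx
    rw [SetLike.mem_coe]
    rcases hx with rfl | rfl | rfl | rfl
    · exact_mod_cast natCast_mem_linIdeal δ (p * q) a
    · exact Ideal.mul_mem_left _ _ (add_rootInt_mem_linIdeal _ _ _)
    · exact Ideal.mul_mem_right _ _ (add_rootInt_mem_linIdeal _ _ _)
    · exact Ideal.mul_mem_right _ _ (add_rootInt_mem_linIdeal _ _ _)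
  · rw [linIdeal_le_iff]
    constructor
    · push_cast
      exact Ideal.mul_mem_mul (natCast_mem_linIdeal _ _ _) (natCast_mem_linIdeal _ _ _)
    · obtain ⟨u, v, huv⟩ := Nat.isCoprime_iff_coprime.mpr hpq
      have huv' : (u : 𝓞 (QuadField δ)) * p + v * q = 1 := by exact_mod_cast huv
      have key : (a : 𝓞 (QuadField δ)) + rootInt δ =
          u * ((p : 𝓞 (QuadField δ)) * (a + rootInt δ)) +
          v * ((a + rootInt δ) * (q : 𝓞 (QuadField δ))) := by
        linear_combination - ((a : 𝓞 (QuadField δ)) + rootInt δ) * huv'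
      have hmem := Ideal.add_mem (linIdeal δ p a * linIdeal δ q a)
        (Ideal.mul_mem_left _ (u : 𝓞 (QuadField δ))
          (Ideal.mul_mem_mul (natCast_mem_linIdeal _ _ _) (add_rootInt_mem_linIdeal _ _ _)))
        (Ideal.mul_mem_left _ (v : 𝓞 (QuadField δ))
          (Ideal.mul_mem_mul (add_rootInt_mem_linIdeal _ _ _) (natCast_mem_linIdeal _ _ _)))
      rwa [← key] at hmem

theorem mem_products_iff {δ p q : ℕ} {n : Ideal (𝓞 (QuadField δ))} :
    n ∈ products δ p q ↔ ∃ P ∈ primesAbove δ p, ∃ Q ∈ primesAbove δ q, P * Q = n := by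
  classical
  simp [products, Finset.mem_image₂]

theorem false_of_mem_mem {δ p q : ℕ} (hp : p.Prime) (hq : q.Prime) (hpq : p ≠ q)
    {P : Ideal (𝓞 (QuadField δ))} (hP : P ≠ ⊤) (h1 : (p : 𝓞 (QuadField δ)) ∈ P)
    (h2 : (q : 𝓞 (QuadField δ)) ∈ P) : False := by
  have := (intCast_mem_iff hP hp h1 q).mp (by simpa using h2)
  exact hpq ((Nat.prime_dvd_prime_iff_eq hp hq).mp (by exact_mod_cast this))

theorem card_products {δ p q : ℕ} (hp : p.Prime) (hq : q.Prime) (hpq : p ≠ q)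
    (h1 : Splits δ p) (h2 : Splits δ q) : (products δ p q).card = 4 := by
  classical
  have key : (products δ p q).card = (primesAbove δ p).card * (primesAbove δ q).card := by
    have : products δ p q =
        Finset.image₂ (fun P Q => P * Q) (primesAbove δ p) (primesAbove δ q) := by
      unfold products
      congr
    rw [this, Finset.card_image₂_iff]
    rintro ⟨P, Q⟩ hPQ ⟨P', Q'⟩ hPQ' heq
    simp only [Set.mem_prod, Finset.mem_coe] at hPQ hPQ' heq
    obtain ⟨hP, hQ⟩ := hPQ
    obtain ⟨hP', hQ'⟩ := hPQ'
    have hPm := primesAbove_isMaximal hp hP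
    have hQm := primesAbove_isMaximal hq hQ
    rw [mem_primesAbove_iff hp] at hP hP'
    rw [mem_primesAbove_iff hq] at hQ hQ'
    -- The prime ideal P' contains PQ. It cannot contain Q, for then it would contain p and q; so it
    -- contains the maximal ideal P.
    have e1 : P = P' := by
      rcases (hP'.1.mul_le).mp (heq ▸ Ideal.mul_le_left : P * Q ≤ P') with h | h
      · exact hPm.eq_of_le hP'.1.ne_top h
      · exact (false_of_mem_mem hp hq hpq hP'.1.ne_top hP'.2 (h hQ.2)).elim
    have e2 : Q = Q' := by
      rcases (hQ'.1.mul_le).mp (heq ▸ Ideal.mul_le_right : P * Q ≤ Q') with h | h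
      · exact (false_of_mem_mem hp hq hpq hQ'.1.ne_top (h hP.2) hQ'.2).elim
      · exact hQm.eq_of_le hQ'.1.ne_top h
    rw [e1, e2]
  rw [key, h1, h2]

/-! ### The ideals 𝔭𝔮 as square roots of δ modulo pq -/

theorem not_dvd_two_mul {δ p : ℕ} (hp : p.Prime) (hp2 : p ≠ 2) (hpδ : ¬ p ∣ δ) {a : ℤ}
    (ha : (p : ℤ) ∣ a * a - δ) : ¬ (p : ℤ) ∣ 2 * a := by
  intro h
  rcases (Nat.prime_iff_prime_int.mp hp).dvd_or_dvd h with h | h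
  · exact hp2 ((Nat.prime_dvd_prime_iff_eq hp Nat.prime_two).mp (by exact_mod_cast h))
  · apply hpδ
    rw [← Int.natCast_dvd_natCast]
    have := dvd_sub (h.mul_right a) ha
    simpa using this

theorem splits_of_root {δ p : ℕ} (hδ : ¬ IsSquare δ) (hp : p.Prime) (hp2 : p ≠ 2)
    (hpδ : ¬ p ∣ δ) {a : ℤ} (ha : (p : ℤ) ∣ a * a - δ) : Splits δ p :=
  splits_of_dvd hδ hp ha (not_dvd_two_mul hp hp2 hpδ ha)

theorem linIdeal_mem_primesAbove {δ p : ℕ} (hδ : ¬ IsSquare δ) (hp : p.Prime) (hp2 : p ≠ 2)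
    (hpδ : ¬ p ∣ δ) {a : ℤ} (ha : (p : ℤ) ∣ a * a - δ) : linIdeal δ p a ∈ primesAbove δ p := by
  rw [primesAbove_eq hδ hp ha (not_dvd_two_mul hp hp2 hpδ ha)]
  simp

theorem exists_linIdeal_eq {δ p : ℕ} (hδ : ¬ IsSquare δ) (hp : p.Prime) (hp2 : p ≠ 2)
    (hpδ : ¬ p ∣ δ) (h : Splits δ p) {P : Ideal (𝓞 (QuadField δ))} (hP : P ∈ primesAbove δ p) :
    ∃ a : ℤ, (p : ℤ) ∣ a * a - δ ∧ P = linIdeal δ p a := by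
  obtain ⟨a, ha⟩ := exists_sq_of_splits hδ hp h
  rw [primesAbove_eq hδ hp ha (not_dvd_two_mul hp hp2 hpδ ha), Finset.mem_insert,
    Finset.mem_singleton] at hP
  rcases hP with rfl | rfl
  · exact ⟨a, ha, rfl⟩
  · exact ⟨-a, by simpa using ha, rfl⟩

theorem linIdeal_mem_products {δ p q : ℕ} (hδ : ¬ IsSquare δ) (hp : p.Prime) (hq : q.Prime)
    (hpq : p ≠ q) (hp2 : p ≠ 2) (hq2 : q ≠ 2) (hpδ : ¬ p ∣ δ) (hqδ : ¬ q ∣ δ) {a : ℤ}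
    (ha : (p : ℤ) ∣ a * a - δ) (ha' : (q : ℤ) ∣ a * a - δ) :
    linIdeal δ (p * q) a ∈ products δ p q := by
  rw [mem_products_iff]
  exact ⟨_, linIdeal_mem_primesAbove hδ hp hp2 hpδ ha, _,
    linIdeal_mem_primesAbove hδ hq hq2 hqδ ha', linIdeal_mul ((Nat.coprime_primes hp hq).mpr hpq) a⟩

/-- The difference a - b lies in the ideal, hence in proper ideals above p and above q. So it is
divisible by pq, while its absolute value is smaller. -/
theorem linIdeal_mul_injective {δ p q : ℕ} (hδ : ¬ IsSquare δ) (hp : p.Prime) (hq : q.Prime)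
    (hpq : p ≠ q) (hp2 : p ≠ 2) (hq2 : q ≠ 2) (hpδ : ¬ p ∣ δ) (hqδ : ¬ q ∣ δ) {a b : ℕ}
    (ha : (p : ℤ) ∣ (a : ℤ) * a - δ) (ha' : (q : ℤ) ∣ (a : ℤ) * a - δ)
    (hlt : a < p * q) (hlt' : b < p * q)
    (h : linIdeal δ (p * q) a = linIdeal δ (p * q) b) : a = b := by
  have hmem : (((a : ℤ) - b : ℤ) : 𝓞 (QuadField δ)) ∈ linIdeal δ (p * q) a := by
    have := Ideal.sub_mem _ (add_rootInt_mem_linIdeal δ (p * q) a)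
      (h ▸ add_rootInt_mem_linIdeal δ (p * q) b)
    simpa using this
  have h1 : (p : ℤ) ∣ (a : ℤ) - b := by
    rw [← intCast_mem_iff (linIdeal_ne_top hδ hp ha (not_dvd_two_mul hp hp2 hpδ ha)) hp
      (natCast_mem_linIdeal _ _ _)]
    exact linIdeal_le_of_dvd (dvd_mul_right p q) (by simp) hmem
  have h2 : (q : ℤ) ∣ (a : ℤ) - b := by
    rw [← intCast_mem_iff (linIdeal_ne_top hδ hq ha' (not_dvd_two_mul hq hq2 hqδ ha')) hq
      (natCast_mem_linIdeal _ _ _)]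
    exact linIdeal_le_of_dvd (dvd_mul_left q p) (by simp) hmem
  have h3 : (p : ℤ) * q ∣ (a : ℤ) - b :=
    (Nat.isCoprime_iff_coprime.mpr ((Nat.coprime_primes hp hq).mpr hpq)).mul_dvd h1 h2
  have h4 : (a : ℤ) < p * q := by exact_mod_cast hlt
  have h5 : (b : ℤ) < p * q := by exact_mod_cast hlt'
  have := Int.eq_zero_of_abs_lt_dvd h3 (by rw [abs_lt]; constructor <;> omega)
  omega

theorem exists_root_of_mem_products {δ p q : ℕ} (hδ : ¬ IsSquare δ) (hp : p.Prime) (hq : q.Prime)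
    (hpq : p ≠ q) (hp2 : p ≠ 2) (hq2 : q ≠ 2) (hpδ : ¬ p ∣ δ) (hqδ : ¬ q ∣ δ)
    (h1 : Splits δ p) (h2 : Splits δ q) {n : Ideal (𝓞 (QuadField δ))}
    (hn : n ∈ products δ p q) :
    ∃ a : ℕ, a < p * q ∧ (p : ℤ) ∣ (a : ℤ) * a - δ ∧ (q : ℤ) ∣ (a : ℤ) * a - δ ∧
      n = linIdeal δ (p * q) a := by
  obtain ⟨P, hP, Q, hQ, rfl⟩ := mem_products_iff.mp hn
  obtain ⟨b, hb, rfl⟩ := exists_linIdeal_eq hδ hp hp2 hpδ h1 hP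
  obtain ⟨c, hc, rfl⟩ := exists_linIdeal_eq hδ hq hq2 hqδ h2 hQ
  have hcop := (Nat.coprime_primes hp hq).mpr hpq
  obtain ⟨u, v, huv⟩ := Nat.isCoprime_iff_coprime.mpr hcop
  have hN : (0 : ℤ) < p * q := by exact_mod_cast mul_pos hp.pos hq.pos
  -- By the Chinese remainder theorem: since up + vq = 1, this is congruent to b modulo p and to c
  -- modulo q.
  set d : ℤ := (b * (v * q) + c * (u * p)) % (p * q) with hd
  have hd0 : 0 ≤ d := Int.emod_nonneg _ hN.ne'
  have hdlt : d < p * q := Int.emod_lt_of_pos _ hN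
  have hdN : (p : ℤ) * q ∣ (b * (v * q) + c * (u * p)) - d := Int.dvd_self_sub_emod
  have hdp : (p : ℤ) ∣ d - b := by
    have e : d - b = -((b * (v * q) + c * (u * p)) - d) + p * (c * u - b * u) := by
      linear_combination b * huv
    rw [e]
    exact dvd_add ((dvd_mul_right _ _).trans hdN).neg_right (dvd_mul_right _ _)
  have hdq : (q : ℤ) ∣ d - c := by
    have e : d - c = -((b * (v * q) + c * (u * p)) - d) + q * (b * v - c * v) := by
      linear_combination c * huv
    rw [e]
    exact dvd_add ((dvd_mul_left _ _).trans hdN).neg_right (dvd_mul_right _ _)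
  obtain ⟨a, ha⟩ := Int.eq_ofNat_of_zero_le hd0
  rw [ha] at hdp hdq hdlt
  have hsq : ∀ m e : ℤ, m ∣ (a : ℤ) - e → m ∣ e * e - δ → m ∣ (a : ℤ) * a - δ := by
    intro m e h3 h4
    have : (a : ℤ) * a - δ = (a - e) * (a + e) + (e * e - δ) := by ring
    rw [this]
    exact dvd_add (h3.mul_right _) h4
  refine ⟨a, by exact_mod_cast hdlt, hsq p b hdp hb, hsq q c hdq hc, ?_⟩
  rw [← linIdeal_mul hcop, linIdeal_congr hdp, linIdeal_congr hdq]

theorem presents_stdCode (δ N a : ℕ) : Presents δ (stdCode N a) (linIdeal δ N a) := by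
  refine ⟨by simp [stdCode], by simp [stdCode], (N : 𝓞 (QuadField δ)),
    (a : 𝓞 (QuadField δ)) + rootInt δ, ?_, ?_, ?_⟩
  · simp [stdCode, quadElt]
  · simp [stdCode, quadElt]
  · simp [linIdeal]

/-! ### Norms and the extraction of a prime factor -/

/-- The norm of an algebraic integer is a rational integer, so z² divides x² - δy² and the integer
division in `quadNorm` is exact. -/
theorem mul_conjO_eq {δ : ℕ} (hδ : ¬ IsSquare δ) {α : 𝓞 (QuadField δ)} {x y z : ℤ} (hz : z ≠ 0)
    (h : (α : QuadField δ) = quadElt δ x y z) :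
    α * conjO hδ α = (quadNorm δ x y z : 𝓞 (QuadField δ)) := by
  have hzK : (z : QuadField δ) ≠ 0 := by exact_mod_cast hz
  have key : ((z * z : ℤ) : 𝓞 (QuadField δ)) * (α * conjO hδ α) =
      ((x * x - y * y * δ : ℤ) : 𝓞 (QuadField δ)) := by
    apply NumberField.RingOfIntegers.ext
    have hc : ((conjO hδ α : 𝓞 (QuadField δ)) : QuadField δ) = quadElt δ x (-y) z := by
      rw [coe_conjO, h, conjK_quadElt]
    push_cast [hc, h]
    simp only [map_intCast, quadElt]
    field_simp
    push_cast
    linear_combination -(y : QuadField δ) ^ 2 * rootElt_sq δ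
  obtain ⟨c, hc⟩ := (intCast_dvd_iff (K := QuadField δ) _ _).mp ⟨_, key.symm⟩
  have hzz : z * z ≠ 0 := mul_ne_zero hz hz
  have hq : quadNorm δ x y z = c := by
    rw [quadNorm, hc, Int.mul_ediv_cancel_left _ hzz]
  rw [hc, Int.cast_mul (z * z) c] at key
  rw [hq]
  exact mul_left_cancel₀ (by exact_mod_cast hzz) key

theorem quadElt_add (δ : ℕ) {x y z x' y' z' : ℤ} (hz : z ≠ 0) (hz' : z' ≠ 0) :
    quadElt δ x y z + quadElt δ x' y' z' =
      quadElt δ (x * z' + x' * z) (y * z' + y' * z) (z * z') := by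
  have h1 : (z : QuadField δ) ≠ 0 := by exact_mod_cast hz
  have h2 : (z' : QuadField δ) ≠ 0 := by exact_mod_cast hz'
  simp only [quadElt]
  push_cast
  field_simp
  ring

/-- The norms of the two generators `α, β` of an ideal, and of `α + β`. -/
def codeNorms (δ : ℤ) (r : Fin 12 → ℤ) : Fin 3 → ℤ :=
  ![quadNorm δ (r 0) (r 1) (r 2), quadNorm δ (r 3) (r 4) (r 5),
    quadNorm δ (r 0 * r 5 + r 3 * r 2) (r 1 * r 5 + r 4 * r 2) (r 2 * r 5)]

/-- The norms of α and β alone do not suffice, since α may lie in a prime ideal Q above q and β in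
its conjugate. With α + β as a third element, the pigeonhole principle puts two of the three into
the same ideal, and then both generators. -/
theorem exists_codeNorms_of_presents {δ p q : ℕ} (hδ : ¬ IsSquare δ) (hp : p.Prime) (hq : q.Prime)
    (hpq : p ≠ q) (hQ : (primesAbove δ q).Nonempty) {P : Ideal (𝓞 (QuadField δ))}
    (hP : P ≠ ⊤) (hpP : (p : 𝓞 (QuadField δ)) ∈ P) {r : Fin 12 → ℤ}
    (hr : Presents δ ![r 0, r 1, r 2, r 3, r 4, r 5] P) :
    ∃ i, (p : ℤ) ∣ codeNorms δ r i ∧ ¬ (q : ℤ) ∣ codeNorms δ r i := by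
  obtain ⟨hz, hz', α, β, hα, hβ, hspan⟩ := hr
  simp only [Matrix.cons_val] at hz hz' hα hβ
  have hsum : ((α + β : 𝓞 (QuadField δ)) : QuadField δ) = quadElt δ (r 0 * r 5 + r 3 * r 2)
      (r 1 * r 5 + r 4 * r 2) (r 2 * r 5) := by
    rw [← quadElt_add δ hz hz', ← hα, ← hβ]
    rfl
  have n1 := mul_conjO_eq hδ hz hα
  have n2 := mul_conjO_eq hδ hz' hβ
  have n3 := mul_conjO_eq hδ (mul_ne_zero hz hz') hsum
  have hαP : α ∈ P := hspan ▸ Ideal.subset_span (by simp)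
  have hβP : β ∈ P := hspan ▸ Ideal.subset_span (by simp)
  have hdvd : ∀ γ ∈ P, ∀ m : ℤ, γ * conjO hδ γ = m → (p : ℤ) ∣ m := by
    intro γ hγ m hm
    rw [← intCast_mem_iff hP hp hpP, ← hm]
    exact P.mul_mem_right _ hγ
  obtain ⟨Q, hQ⟩ := hQ
  obtain ⟨hQp, hqQ⟩ := (mem_primesAbove_iff hq Q).mp hQ
  have hmem : ∀ γ : 𝓞 (QuadField δ), ∀ m : ℤ, γ * conjO hδ γ = m → (q : ℤ) ∣ m →
      γ ∈ Q ∨ γ ∈ Q.comap (conjO hδ) := by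
    intro γ m hm h
    rw [← intCast_mem_iff hQp.ne_top hq hqQ, ← hm] at h
    exact hQp.mem_or_mem h
  have hcontra : ∀ I : Ideal (𝓞 (QuadField δ)), I ≠ ⊤ → (q : 𝓞 (QuadField δ)) ∈ I →
      α ∈ I → β ∈ I → False := by
    intro I hI hqI h1 h2
    have hle : P ≤ I := by
      rw [hspan, Ideal.span_le]
      simp [Set.insert_subset_iff, h1, h2]
    exact false_of_mem_mem hp hq hpq hI (hle hpP) hqI
  have c1 := hcontra Q hQp.ne_top hqQ
  have c2 := hcontra (Q.comap (conjO hδ)) (Ideal.comap_ne_top _ hQp.ne_top) (by simpa using hqQ)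
  have d1 := hdvd α hαP _ n1
  have d2 := hdvd β hβP _ n2
  have d3 := hdvd (α + β) (P.add_mem hαP hβP) _ n3
  by_contra hno
  push Not at hno
  have e1 := hmem α _ n1 (hno 0 d1)
  have e2 := hmem β _ n2 (hno 1 d2)
  have e3 := hmem (α + β) _ n3 (hno 2 d3)
  have sub1 : ∀ I : Ideal (𝓞 (QuadField δ)), α + β ∈ I → α ∈ I → β ∈ I := fun I h h' => by
    simpa using I.sub_mem h h'
  have sub2 : ∀ I : Ideal (𝓞 (QuadField δ)), α + β ∈ I → β ∈ I → α ∈ I := fun I h h' => by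
    simpa using I.sub_mem h h'
  rcases e1 with e1 | e1 <;> rcases e2 with e2 | e2 <;> rcases e3 with e3 | e3
  · exact c1 e1 e2
  · exact c1 e1 e2
  · exact c1 e1 (sub1 _ e3 e1)
  · exact c2 (sub2 _ e3 e2) e2
  · exact c1 (sub2 _ e3 e2) e2
  · exact c2 e1 (sub1 _ e3 e1)
  · exact c2 e1 e2
  · exact c2 e1 e2

/-- A factorisation of an ideal that contains `p q` into two prime ideals gives away one of the two
prime numbers. -/
theorem exists_codeNorms {δ p q : ℕ} (hδ : ¬ IsSquare δ) (hp : p.Prime) (hq : q.Prime)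
    (hpq : p ≠ q) (h1 : Splits δ p) (h2 : Splits δ q) {n : Ideal (𝓞 (QuadField δ))}
    (hn : ((p * q : ℕ) : 𝓞 (QuadField δ)) ∈ n) {r : Fin 12 → ℤ} (hr : IsFactorisation δ n r) :
    ∃ i, ((p : ℤ) ∣ codeNorms δ r i ∧ ¬ (q : ℤ) ∣ codeNorms δ r i) ∨
      ((q : ℤ) ∣ codeNorms δ r i ∧ ¬ (p : ℤ) ∣ codeNorms δ r i) := by
  -- The first of the two returned ideals suffices: it is prime and contains pq.
  obtain ⟨P, Q, hP, -, rfl, hpres, -⟩ := hr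
  have hmem : (p : 𝓞 (QuadField δ)) * q ∈ P := by
    have := Ideal.mul_le_left hn
    exact_mod_cast this
  have ne1 : (primesAbove δ p).Nonempty := Finset.card_pos.mp (by rw [h1]; norm_num)
  have ne2 : (primesAbove δ q).Nonempty := Finset.card_pos.mp (by rw [h2]; norm_num)
  rcases hP.mem_or_mem hmem with h | h
  · obtain ⟨i, hi⟩ := exists_codeNorms_of_presents hδ hp hq hpq ne2 hP.ne_top h hpres
    exact ⟨i, Or.inl hi⟩
  · obtain ⟨i, hi⟩ := exists_codeNorms_of_presents hδ hq hp hpq.symm ne1 hP.ne_top h hpres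
    exact ⟨i, Or.inr hi⟩

/-! ### Counting radicands and samples -/

/-- The numbers among which a trial chooses: those at distance more than `√N` from `0` and `N`. -/
def samples (N : ℕ) : Finset ℕ := Finset.Ioo (Nat.sqrt N) (N - Nat.sqrt N)

/-- Put t = (q - 1)/p, rounded down. As p < q, no positive multiple of q² is below pq, and the
multiples of p² are p²j with 1 ≤ j ≤ t. As √(pq) < q, at least q - 1 - 2t samples are multiples of
p. So 6t ≤ q - 1 is enough, and p ≥ 7 gives 7t ≤ q - 1. -/
theorem card_sq_multiples_le {p q : ℕ} (hp : 7 ≤ p) (hpq : p < q) :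
    4 * ((Finset.Ioo 0 (p * q)).filter fun d => p ^ 2 ∣ d ∨ q ^ 2 ∣ d).card ≤
      ((samples (p * q)).filter fun a => p ∣ a ∨ q ∣ a).card := by
  have hp0 : 0 < p := by omega
  set s := Nat.sqrt (p * q) with hs
  have hsq : s < q := by
    rw [hs, Nat.sqrt_lt]
    exact Nat.mul_lt_mul_of_pos_right hpq (by omega)
  have h1 : ((Finset.Ioo 0 (p * q)).filter fun d => p ^ 2 ∣ d ∨ q ^ 2 ∣ d).card ≤ (q - 1) / p := by
    have hsub : ((Finset.Ioo 0 (p * q)).filter fun d => p ^ 2 ∣ d ∨ q ^ 2 ∣ d) ⊆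
        (Finset.Icc 1 ((q - 1) / p)).image fun j => p ^ 2 * j := by
      intro d hd
      simp only [Finset.mem_filter, Finset.mem_Ioo] at hd
      obtain ⟨⟨hd0, hdN⟩, ⟨j, rfl⟩ | hqd⟩ := hd
      · rw [Finset.mem_image]
        refine ⟨j, ?_, rfl⟩
        rw [Finset.mem_Icc, Nat.le_div_iff_mul_le hp0]
        refine ⟨Nat.pos_of_mul_pos_left hd0, ?_⟩
        have : p * (j * p) < p * q := by
          rwa [show p * (j * p) = p ^ 2 * j by ring]
        have := Nat.lt_of_mul_lt_mul_left this
        omega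
      · have := Nat.le_of_dvd hd0 hqd
        have : p * q < q ^ 2 := by rw [sq]; exact Nat.mul_lt_mul_of_pos_right hpq (by omega)
        omega
    refine (Finset.card_le_card hsub).trans (Finset.card_image_le.trans ?_)
    simp
  have h2 : q - 1 - 2 * (s / p) ≤ ((samples (p * q)).filter fun a => p ∣ a ∨ q ∣ a).card := by
    have hsub : (Finset.Ioo (s / p) (q - s / p)).image (fun i => p * i) ⊆
        (samples (p * q)).filter fun a => p ∣ a ∨ q ∣ a := by
      intro a ha
      rw [Finset.mem_image] at ha
      obtain ⟨i, hi, rfl⟩ := ha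
      rw [Finset.mem_Ioo] at hi
      rw [Finset.mem_filter, samples, Finset.mem_Ioo, ← hs]
      have h3 : s < p * (s / p + 1) := Nat.lt_mul_div_succ s hp0
      refine ⟨⟨h3.trans_le (Nat.mul_le_mul_left p (by omega)), ?_⟩, Or.inl (dvd_mul_right _ _)⟩
      have h4 : p * i + p * (s / p + 1) ≤ p * q := by
        rw [← Nat.mul_add]
        exact Nat.mul_le_mul_left p (by omega)
      omega
    have h5 := Finset.card_le_card hsub
    rw [Finset.card_image_of_injective _ (mul_right_injective₀ hp0.ne'), Nat.card_Ioo] at h5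
    omega
  have h3 : s / p ≤ (q - 1) / p := Nat.div_le_div_right (by omega)
  have h4 : 7 * ((q - 1) / p) ≤ q - 1 :=
    (Nat.mul_le_mul_right _ hp).trans (Nat.mul_div_le _ _)
  omega

theorem card_sq_multiples_le_of_ne {p q : ℕ} (hp : 7 ≤ p) (hq : 7 ≤ q) (hpq : p ≠ q) :
    4 * ((Finset.Ioo 0 (p * q)).filter fun d => p ^ 2 ∣ d ∨ q ^ 2 ∣ d).card ≤
      ((samples (p * q)).filter fun a => p ∣ a ∨ q ∣ a).card := by
  rcases lt_or_gt_of_ne hpq with h | h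
  · exact card_sq_multiples_le hp h
  · have := card_sq_multiples_le hq h
    simpa only [mul_comm q p, or_comm] using this

/-- The samples that are prime to `N` and whose square modulo `N` is not a perfect square. -/
def goodSamples (N : ℕ) : Finset ℕ :=
  (samples N).filter fun a => Nat.Coprime a N ∧ ¬ IsSquare (a * a % N)

theorem mul_self_mod_eq_iff {p q δ a : ℕ} (hpq : Nat.Coprime p q) (hδ : δ < p * q) :
    a * a % (p * q) = δ ↔ (p : ℤ) ∣ (a : ℤ) * a - δ ∧ (q : ℤ) ∣ (a : ℤ) * a - δ := by
  have h1 : a * a % (p * q) = δ ↔ a * a ≡ δ [MOD p * q] := by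
    rw [Nat.ModEq, Nat.mod_eq_of_lt hδ]
  rw [h1, ← Nat.modEq_and_modEq_iff_modEq_mul hpq, Nat.ModEq.comm, Nat.modEq_iff_dvd,
    Nat.ModEq.comm (n := q), Nat.modEq_iff_dvd]
  push_cast
  rfl

/-- If a ≤ √N, then a² ≤ N and a² mod N is a² or 0; and N - a has the same square modulo N as a. So
trimming the ends of the interval loses no useful a. -/
theorem mem_samples_of_not_isSquare {N a : ℕ} (ha : a < N) (h : ¬ IsSquare (a * a % N)) :
    a ∈ samples N := by
  have key : ∀ b : ℕ, b ≤ Nat.sqrt N → b * b % N = a * a % N → False := by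
    intro b hb hba
    have h1 : b * b ≤ N := (Nat.mul_le_mul hb hb).trans (Nat.sqrt_le N)
    apply h
    rw [← hba]
    rcases h1.lt_or_eq with h1 | h1
    · rw [Nat.mod_eq_of_lt h1]
      exact ⟨b, rfl⟩
    · rw [h1, Nat.mod_self]
      exact ⟨0, rfl⟩
  rw [samples, Finset.mem_Ioo]
  constructor
  · by_contra hle
    exact key a (by omega) rfl
  · by_contra hle
    refine key (N - a) (by omega) ?_
    have : (N - a) * (N - a) ≡ a * a [MOD N] := by
      rw [Nat.modEq_iff_dvd]
      refine ⟨2 * a - N, ?_⟩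
      push_cast [ha.le]
      ring
    exact this

/-- The probability that `A` factors `(N, a + √δ)`. -/
def linProb (A : IdealFactorer) (N δ a : ℕ) : ℝ :=
  ((A (inputVec N δ (stdCode N a))).toOuterMeasure
    {r | IsFactorisation δ (linIdeal δ N a) r}).toReal

theorem toOuterMeasure_le_one {α : Type*} (μ : PMF α) (s : Set α) : μ.toOuterMeasure s ≤ 1 := by
  rw [PMF.toOuterMeasure_apply, ← μ.tsum_coe]
  exact ENNReal.tsum_le_tsum fun a => Set.indicator_le_self _ _ a

theorem toReal_toOuterMeasure_le_one {α : Type*} (μ : PMF α) (s : Set α) :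
    (μ.toOuterMeasure s).toReal ≤ 1 :=
  ENNReal.toReal_le_of_le_ofReal zero_le_one (by simpa using toOuterMeasure_le_one μ s)

/-! ### Good samples as pairs of a radicand and an ideal -/

theorem mem_radicands_iff {p q δ : ℕ} : δ ∈ radicands p q ↔
    (0 < δ ∧ δ < p * q) ∧ ¬ IsSquare δ ∧ Splits δ p ∧ Splits δ q := by
  simp [radicands]

theorem mem_goodSamples_iff {N a : ℕ} : a ∈ goodSamples N ↔
    a ∈ samples N ∧ Nat.Coprime a N ∧ ¬ IsSquare (a * a % N) := by
  simp [goodSamples]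

theorem lt_of_mem_samples {N a : ℕ} (h : a ∈ samples N) : a < N := by
  rw [samples, Finset.mem_Ioo] at h
  omega

theorem not_dvd_mul_self_mod {p q a : ℕ} (hp : p.Prime) (h : Nat.Coprime a (p * q)) :
    ¬ p ∣ a * a % (p * q) := by
  rw [Nat.dvd_mod_iff (dvd_mul_right p q)]
  intro hd
  have h1 : p ∣ a := (hp.dvd_mul.mp hd).elim id id
  exact hp.one_lt.ne' (Nat.dvd_one.mp (h ▸ Nat.dvd_gcd h1 (dvd_mul_right p q)))

theorem mem_radicands_of_good {p q a : ℕ} (hp : p.Prime) (hq : q.Prime) (hpq : p ≠ q)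
    (hp2 : p ≠ 2) (hq2 : q ≠ 2) (ha : a ∈ goodSamples (p * q)) :
    a * a % (p * q) ∈ radicands p q ∧ ¬ p ∣ a * a % (p * q) ∧ ¬ q ∣ a * a % (p * q) := by
  obtain ⟨hs, hcop, hsq⟩ := mem_goodSamples_iff.mp ha
  have hN : 0 < p * q := mul_pos hp.pos hq.pos
  have hlt : a * a % (p * q) < p * q := Nat.mod_lt _ hN
  have h1 := not_dvd_mul_self_mod hp hcop
  have h2 : ¬ q ∣ a * a % (p * q) := by
    rw [mul_comm p q] at hcop ⊢
    exact not_dvd_mul_self_mod hq hcop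
  obtain ⟨d1, d2⟩ := (mul_self_mod_eq_iff ((Nat.coprime_primes hp hq).mpr hpq) hlt).mp rfl
  refine ⟨mem_radicands_iff.mpr ⟨⟨Nat.pos_of_ne_zero fun h0 => h1 (h0 ▸ dvd_zero p), hlt⟩, hsq,
    splits_of_root hsq hp hp2 h1 d1, splits_of_root hsq hq hq2 h2 d2⟩, h1, h2⟩

/-- The map a ↦ (pq, a + √δ) is a bijection from the square roots of δ modulo pq to the ideals 𝔭𝔮.
Each root is a good sample because δ is a non-square prime to pq. -/
theorem sum_products_eq {p q δ : ℕ} (hp : p.Prime) (hq : q.Prime) (hpq : p ≠ q)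
    (hp2 : p ≠ 2) (hq2 : q ≠ 2) (hδ : δ ∈ radicands p q) (hpδ : ¬ p ∣ δ) (hqδ : ¬ q ∣ δ)
    (f : Ideal (𝓞 (QuadField δ)) → ℝ) :
    ∑ n ∈ products δ p q, f n =
      ∑ a ∈ (goodSamples (p * q)).filter (fun a => a * a % (p * q) = δ),
        f (linIdeal δ (p * q) a) := by
  obtain ⟨⟨hδ0, hδN⟩, hsq, h1, h2⟩ := mem_radicands_iff.mp hδ
  have hcop := (Nat.coprime_primes hp hq).mpr hpq
  symm
  refine Finset.sum_bij (fun a _ => linIdeal δ (p * q) a) ?_ ?_ ?_ (fun _ _ => rfl)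
  · intro a ha
    obtain ⟨d1, d2⟩ := (mul_self_mod_eq_iff hcop hδN).mp (Finset.mem_filter.mp ha).2
    exact linIdeal_mem_products hsq hp hq hpq hp2 hq2 hpδ hqδ d1 d2
  · intro a ha b hb hab
    rw [Finset.mem_filter, mem_goodSamples_iff] at ha hb
    obtain ⟨d1, d2⟩ := (mul_self_mod_eq_iff hcop hδN).mp ha.2
    exact linIdeal_mul_injective hsq hp hq hpq hp2 hq2 hpδ hqδ d1 d2
      (lt_of_mem_samples ha.1.1) (lt_of_mem_samples hb.1.1) hab
  · intro n hn
    obtain ⟨a, ha, d1, d2, rfl⟩ :=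
      exists_root_of_mem_products hsq hp hq hpq hp2 hq2 hpδ hqδ h1 h2 hn
    have hmod := (mul_self_mod_eq_iff hcop hδN).mpr ⟨d1, d2⟩
    refine ⟨a, ?_, rfl⟩
    rw [Finset.mem_filter, mem_goodSamples_iff]
    have hsq' : ¬ IsSquare (a * a % (p * q)) := hmod.symm ▸ hsq
    refine ⟨⟨mem_samples_of_not_isSquare ha hsq', ?_, hsq'⟩, hmod⟩
    have hnd : ∀ r : ℕ, (r : ℤ) ∣ (a : ℤ) * a - δ → ¬ r ∣ δ → ¬ r ∣ a := by
      intro r hr hrδ hra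
      apply hrδ
      rw [← Int.natCast_dvd_natCast] at hra ⊢
      have := dvd_sub (hra.mul_right (a : ℤ)) hr
      simpa using this
    exact Nat.Coprime.mul_right
      ((Nat.Prime.coprime_iff_not_dvd hp).mpr (hnd p d1 hpδ)).symm
      ((Nat.Prime.coprime_iff_not_dvd hq).mpr (hnd q d2 hqδ)).symm

open Classical in
/-- The radicands that are prime to `p q`. -/
def unitRadicands (p q : ℕ) : Finset ℕ := (radicands p q).filter fun δ => ¬ p ∣ δ ∧ ¬ q ∣ δ

theorem mem_unitRadicands_iff {p q δ : ℕ} :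
    δ ∈ unitRadicands p q ↔ δ ∈ radicands p q ∧ ¬ p ∣ δ ∧ ¬ q ∣ δ := by
  simp [unitRadicands]

/-- Good samples are grouped by δ = a² mod pq. Every pair of a radicand prime to pq and an ideal
arises from exactly one of them, so a uniform good sample yields a uniform pair. -/
theorem sum_unitRadicands {p q : ℕ} (hp : p.Prime) (hq : q.Prime) (hpq : p ≠ q)
    (hp2 : p ≠ 2) (hq2 : q ≠ 2) (f : (δ : ℕ) → Ideal (𝓞 (QuadField δ)) → ℝ) :
    ∑ δ ∈ unitRadicands p q, ∑ n ∈ products δ p q, f δ n =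
      ∑ a ∈ goodSamples (p * q), f (a * a % (p * q)) (linIdeal _ (p * q) a) := by
  rw [← Finset.sum_fiberwise_of_maps_to (s := goodSamples (p * q)) (t := unitRadicands p q)
    (g := fun a => a * a % (p * q))
    (fun a ha => mem_unitRadicands_iff.mpr (mem_radicands_of_good hp hq hpq hp2 hq2 ha))]
  refine Finset.sum_congr rfl fun δ hδ => ?_
  obtain ⟨h1, h2, h3⟩ := mem_unitRadicands_iff.mp hδ
  rw [sum_products_eq hp hq hpq hp2 hq2 h1 h2 h3]
  refine Finset.sum_congr rfl fun a ha => ?_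
  obtain ⟨-, rfl⟩ := Finset.mem_filter.mp ha
  rfl

theorem card_goodSamples {p q : ℕ} (hp : p.Prime) (hq : q.Prime) (hpq : p ≠ q)
    (hp2 : p ≠ 2) (hq2 : q ≠ 2) :
    ((goodSamples (p * q)).card : ℝ) = 4 * (unitRadicands p q).card := by
  have h := sum_unitRadicands hp hq hpq hp2 hq2 (fun _ _ => 1)
  simp only [Finset.sum_const, nsmul_eq_mul, mul_one] at h
  rw [← h, Finset.sum_congr rfl (g := fun _ => (4 : ℝ)), Finset.sum_const, nsmul_eq_mul, mul_comm]
  intro δ hδ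
  obtain ⟨-, -, h1, h2⟩ := mem_radicands_iff.mp (mem_unitRadicands_iff.mp hδ).1
  rw [card_products hp hq hpq h1 h2]
  norm_num

/-- For these ideals the presentation is forced, so the question that the program writes is the one
on which the success of `A` is measured. -/
theorem pres_linIdeal {p q : ℕ} (hp : p.Prime) (hq : q.Prime) (hpq : p ≠ q)
    (hp2 : p ≠ 2) (hq2 : q ≠ 2) {pres : (δ : ℕ) → Ideal (𝓞 (QuadField δ)) → IdealCode}
    (hpres : IsPresentation p q pres) {a : ℕ} (ha : a ∈ goodSamples (p * q)) :
    pres (a * a % (p * q)) (linIdeal _ (p * q) a) = stdCode (p * q) a := by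
  obtain ⟨h1, h2, h3⟩ := mem_radicands_of_good hp hq hpq hp2 hq2 ha
  have hsq := (mem_goodSamples_iff.mp ha).2.2
  obtain ⟨d1, d2⟩ := (mul_self_mod_eq_iff ((Nat.coprime_primes hp hq).mpr hpq)
    (Nat.mod_lt _ (mul_pos hp.pos hq.pos))).mp (rfl : a * a % (p * q) = _)
  exact (hpres _ h1 _ (linIdeal_mem_products hsq hp hq hpq hp2 hq2 h2 h3 d1 d2)).2 a
    (lt_of_mem_samples (mem_goodSamples_iff.mp ha).1) (presents_stdCode _ _ _)

/-- A radicand divisible by p or q is divisible by the square of that prime. Samples divisible by p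
or q are at least four times as many as such radicands, and none of them is good. -/
theorem card_nonunit_radicands_le {p q : ℕ} (hp : p.Prime) (hq : q.Prime) (hpq : p ≠ q)
    (hp7 : 7 ≤ p) (hq7 : 7 ≤ q) :
    4 * (radicands p q \ unitRadicands p q).card + (goodSamples (p * q)).card ≤
      (samples (p * q)).card := by
  have h1 : (radicands p q \ unitRadicands p q).card ≤
      ((Finset.Ioo 0 (p * q)).filter fun d => p ^ 2 ∣ d ∨ q ^ 2 ∣ d).card := by
    refine Finset.card_le_card fun δ hδ => ?_
    rw [Finset.mem_sdiff, mem_unitRadicands_iff] at hδ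
    obtain ⟨hr, hn⟩ := hδ
    obtain ⟨hI, hsq, h1, h2⟩ := mem_radicands_iff.mp hr
    rw [Finset.mem_filter, Finset.mem_Ioo]
    refine ⟨hI, ?_⟩
    by_cases hpδ : p ∣ δ
    · exact Or.inl (sq_dvd_of_splits hsq hp h1 hpδ)
    · exact Or.inr (sq_dvd_of_splits hsq hq h2 (by tauto))
  have h2 := card_sq_multiples_le_of_ne hp7 hq7 hpq
  have hdisj : Disjoint ((samples (p * q)).filter fun a => p ∣ a ∨ q ∣ a) (goodSamples (p * q)) := by
    rw [Finset.disjoint_left]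
    intro a ha hg
    obtain ⟨-, hcop, -⟩ := mem_goodSamples_iff.mp hg
    rw [Nat.coprime_mul_iff_right] at hcop
    rcases (Finset.mem_filter.mp ha).2 with h | h
    · exact (Nat.Prime.coprime_iff_not_dvd hp).mp hcop.1.symm h
    · exact (Nat.Prime.coprime_iff_not_dvd hq).mp hcop.2.symm h
  have h3 := Finset.card_le_card (Finset.union_subset
    (Finset.filter_subset (fun a => p ∣ a ∨ q ∣ a) (samples (p * q)))
    (fun a ha => (mem_goodSamples_iff.mp ha).1 : goodSamples (p * q) ⊆ samples (p * q)))
  rw [Finset.card_union_of_disjoint hdisj] at h3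
  omega

/-- The success probability of `A` is at most that of a trial which succeeds on all samples that
are not good, and on a good sample `a` with the probability that `A` factors `(N, a + √δ)`. -/
theorem successProb_le {p q : ℕ} (hp : p.Prime) (hq : q.Prime) (hpq : p ≠ q)
    (hp7 : 7 ≤ p) (hq7 : 7 ≤ q) {pres : (δ : ℕ) → Ideal (𝓞 (QuadField δ)) → IdealCode}
    (hpres : IsPresentation p q pres) (A : IdealFactorer) {ω : ℝ} (hω : 0 < ω)
    (h : ω ≤ successProb p q pres A) :
    ω * (samples (p * q)).card + ∑ a ∈ goodSamples (p * q), (1 - linProb A (p * q) (a * a % (p * q)) a)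
      ≤ (samples (p * q)).card := by
  have hp2 : p ≠ 2 := by omega
  have hq2 : q ≠ 2 := by omega
  set f : (δ : ℕ) → Ideal (𝓞 (QuadField δ)) → ℝ := fun δ n =>
    ((A (inputVec (p * q) δ (pres δ n))).toOuterMeasure {r | IsFactorisation δ n r}).toReal with hf
  have hf1 : ∀ δ n, f δ n ≤ 1 := fun δ n => toReal_toOuterMeasure_le_one _ _
  have hE : successProb p q pres A = (∑ δ ∈ radicands p q, 𝔼 n ∈ products δ p q, f δ n) /
      (radicands p q).card := by
    rw [successProb, Finset.expect_eq_sum_div_card]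
  have hsub : unitRadicands p q ⊆ radicands p q := Finset.filter_subset _ _
  have hsum : ∑ a ∈ goodSamples (p * q), f (a * a % (p * q)) (linIdeal _ (p * q) a) =
      ∑ a ∈ goodSamples (p * q), linProb A (p * q) (a * a % (p * q)) a := by
    refine Finset.sum_congr rfl fun a ha => ?_
    simp only [hf, linProb]
    rw [pres_linIdeal hp hq hpq hp2 hq2 hpres ha]
  have hU : ∑ δ ∈ unitRadicands p q, 𝔼 n ∈ products δ p q, f δ n =
      (∑ a ∈ goodSamples (p * q), linProb A (p * q) (a * a % (p * q)) a) / 4 := by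
    rw [← hsum, ← sum_unitRadicands hp hq hpq hp2 hq2, Finset.sum_div]
    refine Finset.sum_congr rfl fun δ hδ => ?_
    obtain ⟨-, -, h1, h2⟩ := mem_radicands_iff.mp (hsub hδ)
    rw [Finset.expect_eq_sum_div_card, card_products hp hq hpq h1 h2]
    norm_num
  -- For the remaining radicands the presentation is arbitrary, so only the trivial bound 1 is
  -- available.
  have hR : ∑ δ ∈ radicands p q \ unitRadicands p q, 𝔼 n ∈ products δ p q, f δ n ≤
      (radicands p q \ unitRadicands p q).card := by
    rw [← nsmul_one, ← Finset.sum_const]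
    refine Finset.sum_le_sum fun δ hδ => ?_
    obtain ⟨-, -, h1, h2⟩ := mem_radicands_iff.mp (Finset.sdiff_subset hδ)
    refine Finset.expect_le (Finset.card_pos.mp ?_) fun n _ => hf1 δ n
    rw [card_products hp hq hpq h1 h2]
    norm_num
  have hcard : ((radicands p q).card : ℝ) =
      (radicands p q \ unitRadicands p q).card + (unitRadicands p q).card := by
    exact_mod_cast (Finset.card_sdiff_add_card_eq_card hsub).symm
  have hle := card_nonunit_radicands_le hp hq hpq hp7 hq7
  have hle' : (4 : ℝ) * (radicands p q \ unitRadicands p q).card + (goodSamples (p * q)).card ≤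
      (samples (p * q)).card := by exact_mod_cast hle
  have hG := card_goodSamples hp hq hpq hp2 hq2
  -- An expectation over the empty set is 0, so 0 < ω yields a radicand.
  have hpos : (0 : ℝ) < (radicands p q).card := by
    rw [Nat.cast_pos, Finset.card_pos, Finset.nonempty_iff_ne_empty]
    intro h0
    rw [hE, h0] at h
    simp at h
    linarith
  rw [hE, le_div_iff₀ hpos, ← Finset.sum_sdiff hsub, hU] at h
  have hω1 : ω ≤ 1 := by
    have hL : ∑ a ∈ goodSamples (p * q), linProb A (p * q) (a * a % (p * q)) a ≤
        (goodSamples (p * q)).card := by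
      rw [← nsmul_one, ← Finset.sum_const]
      exact Finset.sum_le_sum fun a _ => toReal_toOuterMeasure_le_one _ _
    by_contra hlt
    have : 0 < (ω - 1) * (radicands p q).card := mul_pos (by linarith) hpos
    linarith
  -- Let S, G, R, U be the numbers of samples, good samples, radicands and unit radicands, and L the
  -- sum of the `linProb`. From ωR ≤ (R - U) + L/4 and G = 4U follows G - L ≤ (1 - ω)(4(R - U) + G)
  -- ≤ (1 - ω)S.
  rw [Finset.sum_sub_distrib, Finset.sum_const, nsmul_one]
  have := mul_le_mul_of_nonneg_left hle' (sub_nonneg.mpr hω1)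
  rw [hcard] at h
  rw [hG] at this ⊢
  nlinarith

/-! ### Deterministic programs -/

/-- The program makes no random choice and no call. -/
def Prog.Det : Prog → Prop
  | .rand _ _ => False
  | .query _ _ => False
  | .seq c₁ c₂ => c₁.Det ∧ c₂.Det
  | .ifPos _ c₁ c₂ => c₁.Det ∧ c₂.Det
  | .loop _ c => c.Det
  | _ => True

/-- The effect of a deterministic program on the registers. -/
def Prog.ev : Prog → (ℕ → ℤ) → ℕ → ℤ
  | .skip, r => r
  | .const d c, r => Function.update r d c
  | .op d o x y, r => Function.update r d (o.eval (r x) (r y))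
  | .size d x, r => Function.update r d (bits (r x))
  | .rand _ _, r => r
  | .query _ _, r => r
  | .seq c₁ c₂, r => c₂.ev (c₁.ev r)
  | .ifPos x c₁ c₂, r => if 0 < r x then c₁.ev r else c₂.ev r
  | .loop x c, r => c.ev^[(r x).toNat] r

/-- The cost of a deterministic program. -/
def Prog.cost : Prog → (ℕ → ℤ) → ℕ
  | .skip, _ => 0
  | .const _ c, _ => 1 + bits c
  | .op _ _ x y, r => (1 + bits (r x) + bits (r y)) ^ 2
  | .size _ x, r => (1 + bits (r x)) ^ 2
  | .rand _ _, _ => 0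
  | .query _ _, _ => 0
  | .seq c₁ c₂, r => c₁.cost r + c₂.cost (c₁.ev r)
  | .ifPos x c₁ c₂, r => 1 + if 0 < r x then c₁.cost r else c₂.cost r
  | .loop x c, r =>
      1 + bits (r x) + ∑ i ∈ Finset.range (r x).toNat, (1 + c.cost (c.ev^[i] r))

theorem iterate_pure {σ : Type} (g : σ → σ) (n : ℕ) (s : σ) :
    iterate (fun t => PMF.pure (g t)) n s = PMF.pure (g^[n] s) := by
  induction n generalizing s with
  | zero => rfl
  | succ n ih => rw [iterate, PMF.pure_bind, ih, Function.iterate_succ_apply]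

/-- The effect of a deterministic program on states. -/
def Prog.step (c : Prog) (s : State) : State :=
  { s with reg := c.ev s.reg, time := s.time + c.cost s.reg }

theorem iterate_step (c : Prog) (n : ℕ) (s : State) :
    (fun t : State => c.step (t.tick 1))^[n] s =
      { s with
        reg := c.ev^[n] s.reg
        time := s.time + ∑ i ∈ Finset.range n, (1 + c.cost (c.ev^[i] s.reg)) } := by
  induction n with
  | zero => simp
  | succ n ih =>
    rw [Function.iterate_succ_apply', ih, Finset.sum_range_succ, Function.iterate_succ_apply']
    simp only [Prog.step, State.tick]
    congr 1
    ring

/-- Everything but the random choice and the call can thus be treated as a plain function on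
registers with a cost. -/
theorem run_det (A : IdealFactorer) {c : Prog} (hc : c.Det) (s : State) :
    c.run A s = PMF.pure (c.step s) := by
  induction c generalizing s with
  | skip => rfl
  | const d c => rfl
  | op d o x y => rfl
  | size d x => rfl
  | rand d x => exact hc.elim
  | query a b => exact hc.elim
  | seq c₁ c₂ h₁ h₂ =>
    rw [Prog.run, h₁ hc.1, PMF.pure_bind, h₂ hc.2]
    simp only [Prog.step, Prog.ev, Prog.cost, add_assoc]
  | ifPos x c₁ c₂ h₁ h₂ =>
    rw [Prog.run, h₁ hc.1, h₂ hc.2]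
    by_cases h : 0 < s.reg x
    · simp only [h, if_true, Prog.step, Prog.ev, Prog.cost, State.tick, add_assoc]
    · simp only [h, if_false, Prog.step, Prog.ev, Prog.cost, State.tick, add_assoc]
  | loop x c h =>
    rw [Prog.run]
    have : (fun t : State => c.run A (t.tick 1)) = fun t => PMF.pure (c.step (t.tick 1)) :=
      funext fun t => h hc _
    rw [this, iterate_pure, iterate_step]
    simp only [Prog.step, Prog.ev, Prog.cost, State.tick, add_assoc]

/-- The registers to which a deterministic program may write. -/
def Prog.writes : Prog → List ℕ
  | .const d _ => [d]
  | .op d _ _ _ => [d]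
  | .size d _ => [d]
  | .seq c₁ c₂ => c₁.writes ++ c₂.writes
  | .ifPos _ c₁ c₂ => c₁.writes ++ c₂.writes
  | .loop _ c => c.writes
  | _ => []

theorem ev_of_notMem_writes (c : Prog) {j : ℕ} (hj : j ∉ c.writes) (r : ℕ → ℤ) :
    c.ev r j = r j := by
  induction c generalizing r with
  | skip | rand d x | query a b => rfl
  | const d c | op d o x y | size d x =>
    simp only [Prog.writes, List.mem_singleton] at hj
    simp [Prog.ev, hj]
  | seq c₁ c₂ h₁ h₂ =>
    simp only [Prog.writes, List.mem_append, not_or] at hj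
    rw [Prog.ev, h₂ hj.2, h₁ hj.1]
  | ifPos x c₁ c₂ h₁ h₂ =>
    simp only [Prog.writes, List.mem_append, not_or] at hj
    rw [Prog.ev]
    split_ifs
    · exact h₁ hj.1 r
    · exact h₂ hj.2 r
  | loop x c h =>
    rw [Prog.ev]
    generalize (r x).toNat = n
    induction n generalizing r with
    | zero => rfl
    | succ n ih => rw [Function.iterate_succ_apply, ih, h hj]

/-- A list of programs, run one after the other. -/
def Prog.block (l : List Prog) : Prog := l.foldr Prog.seq Prog.skip

@[simp] theorem ev_block_nil (r : ℕ → ℤ) : (Prog.block []).ev r = r := rfl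

@[simp] theorem ev_block_cons (c : Prog) (l : List Prog) (r : ℕ → ℤ) :
    (Prog.block (c :: l)).ev r = (Prog.block l).ev (c.ev r) := rfl

theorem det_block {l : List Prog} (h : ∀ c ∈ l, c.Det) : (Prog.block l).Det := by
  induction l with
  | nil => trivial
  | cons c l ih =>
    exact ⟨h c (by simp), ih fun d hd => h d (by simp [hd])⟩

/-! ### Binary lengths -/

theorem bits_le_iff {x : ℤ} {n : ℕ} : bits x ≤ n ↔ x.natAbs < 2 ^ n := Nat.size_le

theorem natAbs_lt (x : ℤ) : x.natAbs < 2 ^ bits x := Nat.lt_size_self _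

theorem bits_mono {x y : ℤ} (h : x.natAbs ≤ y.natAbs) : bits x ≤ bits y := Nat.size_le_size h

theorem bits_add_le {x y : ℤ} {B : ℕ} (hx : bits x ≤ B) (hy : bits y ≤ B) :
    bits (x + y) ≤ B + 1 := by
  rw [bits_le_iff] at *
  have := Int.natAbs_add_le x y
  rw [pow_succ]
  omega

theorem bits_sub_le {x y : ℤ} {B : ℕ} (hx : bits x ≤ B) (hy : bits y ≤ B) :
    bits (x - y) ≤ B + 1 := by
  rw [bits_le_iff] at *
  have := Int.natAbs_sub_le x y
  rw [pow_succ]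
  omega

theorem bits_mul_le (x y : ℤ) : bits (x * y) ≤ bits x + bits y := by
  rw [bits_le_iff, Int.natAbs_mul, pow_add]
  exact Nat.mul_lt_mul'' (natAbs_lt x) (natAbs_lt y)

theorem bits_div_le (x y : ℤ) : bits (x / y) ≤ bits x :=
  bits_mono (Int.natAbs_ediv_le_natAbs x y)

theorem bits_mod_le {x y : ℤ} {B : ℕ} (hx : bits x ≤ B) (hy : bits y ≤ B) :
    bits (x % y) ≤ B := by
  rcases eq_or_ne y 0 with rfl | h
  · simpa using hx
  · refine (bits_mono ?_).trans hy
    have h1 := Int.emod_nonneg x h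
    have h2 := Int.emod_lt_abs x h
    rw [Int.abs_eq_natAbs] at h2
    omega

theorem bits_natCast (n : ℕ) : bits (n : ℤ) = Nat.size n := rfl

theorem size_le_self (n : ℕ) : Nat.size n ≤ n := Nat.size_le.mpr n.lt_two_pow_self

theorem bits_bits_le (x : ℤ) : bits (bits x : ℤ) ≤ bits x := size_le_self _

theorem bits_op_le (o : Op) {x y : ℤ} {B : ℕ} (hx : bits x ≤ B) (hy : bits y ≤ B) :
    bits (o.eval x y) ≤ 2 * B + 1 := by
  cases o with
  | add => exact (bits_add_le hx hy).trans (by omega)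
  | sub => exact (bits_sub_le hx hy).trans (by omega)
  | mul => exact (bits_mul_le x y).trans (by omega)
  | div => exact (bits_div_le x y).trans (by omega)
  | mod => exact (bits_mod_le hx hy).trans (by omega)

/-! ### Polynomial bounds -/

/-- All registers have binary length at most `B`. -/
def Bounded (B : ℕ) (r : ℕ → ℤ) : Prop := ∀ j, bits (r j) ≤ B

theorem Bounded.mono {B B' : ℕ} {r : ℕ → ℤ} (h : Bounded B r) (hB : B ≤ B') : Bounded B' r :=
  fun j => (h j).trans hB

theorem Bounded.update {B : ℕ} {r : ℕ → ℤ} (h : Bounded B r) (d : ℕ) {v : ℤ} (hv : bits v ≤ B) :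
    Bounded B (Function.update r d v) := by
  intro j
  rcases eq_or_ne j d with rfl | hj
  · simpa using hv
  · simpa [hj] using h j

/-- The program enlarges binary lengths at most linearly, at a cost of degree `e`. -/
def Prog.Poly (e : ℕ) (c : Prog) : Prop :=
  ∃ K : ℕ, ∀ B r, Bounded B r → Bounded (K * (B + 1)) (c.ev r) ∧ c.cost r ≤ K * (B + 1) ^ e

theorem poly_skip (e : ℕ) : Prog.skip.Poly e := by
  refine ⟨1, fun B r h => ⟨h.mono (by omega), ?_⟩⟩
  simp [Prog.cost]

theorem poly_const (e d : ℕ) (v : ℤ) : (Prog.const d v).Poly e := by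
  refine ⟨1 + bits v, fun B r h => ⟨?_, ?_⟩⟩
  · refine (h.mono (B' := (1 + bits v) * (B + 1)) ?_).update d ?_ <;> nlinarith
  · exact Nat.le_mul_of_pos_right _ (by positivity)

theorem poly_op {e : ℕ} (he : 2 ≤ e) (d : ℕ) (o : Op) (x y : ℕ) : (Prog.op d o x y).Poly e := by
  refine ⟨4, fun B r h => ⟨?_, ?_⟩⟩
  · exact (h.mono (by omega)).update d ((bits_op_le o (h x) (h y)).trans (by omega))
  · have h1 : (Prog.op d o x y).cost r ≤ (2 * (B + 1)) ^ 2 :=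
      Nat.pow_le_pow_left (by have := h x; have := h y; omega) 2
    have h2 : (B + 1) ^ 2 ≤ (B + 1) ^ e := Nat.pow_le_pow_right (by omega) he
    rw [mul_pow] at h1
    omega

/-- Because lengths grow only linearly, the cost of the second program at the enlarged length still
has degree e. Growth of higher degree would raise the degree with each composition. -/
theorem poly_seq {e : ℕ} {c₁ c₂ : Prog} (h₁ : c₁.Poly e) (h₂ : c₂.Poly e) :
    (Prog.seq c₁ c₂).Poly e := by
  obtain ⟨K₁, h₁⟩ := h₁
  obtain ⟨K₂, h₂⟩ := h₂
  refine ⟨K₁ + K₂ * ((K₁ + 1) ^ e + (K₁ + 1)), fun B r h => ?_⟩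
  obtain ⟨b₁, t₁⟩ := h₁ B r h
  obtain ⟨b₂, t₂⟩ := h₂ _ _ b₁
  have h3 : K₁ * (B + 1) + 1 ≤ (K₁ + 1) * (B + 1) := by nlinarith
  constructor
  · refine b₂.mono ?_
    calc K₂ * (K₁ * (B + 1) + 1) ≤ K₂ * ((K₁ + 1) * (B + 1)) := Nat.mul_le_mul_left _ h3
      _ = K₂ * (K₁ + 1) * (B + 1) := by ring
      _ ≤ _ := Nat.mul_le_mul_right _
          ((Nat.mul_le_mul_left _ (Nat.le_add_left _ _)).trans (Nat.le_add_left _ _))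
  · calc _ ≤ K₁ * (B + 1) ^ e + K₂ * (K₁ * (B + 1) + 1) ^ e := Nat.add_le_add t₁ t₂
      _ ≤ K₁ * (B + 1) ^ e + K₂ * ((K₁ + 1) * (B + 1)) ^ e :=
          Nat.add_le_add_left (Nat.mul_le_mul_left _ (Nat.pow_le_pow_left h3 e)) _
      _ = (K₁ + K₂ * (K₁ + 1) ^ e) * (B + 1) ^ e := by rw [mul_pow]; ring
      _ ≤ _ := Nat.mul_le_mul_right _
          (Nat.add_le_add_left (Nat.mul_le_mul_left _ (Nat.le_add_right _ _)) _)

theorem poly_ifPos {e : ℕ} (x : ℕ) {c₁ c₂ : Prog} (h₁ : c₁.Poly e) (h₂ : c₂.Poly e) :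
    (Prog.ifPos x c₁ c₂).Poly e := by
  obtain ⟨K₁, h₁⟩ := h₁
  obtain ⟨K₂, h₂⟩ := h₂
  refine ⟨1 + K₁ + K₂, fun B r h => ?_⟩
  obtain ⟨b₁, t₁⟩ := h₁ B r h
  obtain ⟨b₂, t₂⟩ := h₂ B r h
  have h3 : 1 ≤ (B + 1) ^ e := Nat.one_le_pow _ _ (by omega)
  rw [Prog.ev, Prog.cost]
  split_ifs
  · exact ⟨b₁.mono (Nat.mul_le_mul_right _ (by omega)), by nlinarith⟩
  · exact ⟨b₂.mono (Nat.mul_le_mul_right _ (by omega)), by nlinarith⟩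

theorem poly_block {e : ℕ} {l : List Prog} (h : ∀ c ∈ l, c.Poly e) : (Prog.block l).Poly e := by
  induction l with
  | nil => exact poly_skip e
  | cons c l ih => exact poly_seq (h c (by simp)) (ih fun d hd => h d (by simp [hd]))

/-- Run `c` as many times as twice the binary length of register `x`, with counter `t`. -/
def sizeLoop (t x : ℕ) (c : Prog) : Prog :=
  Prog.block [Prog.size t x, Prog.op t Op.add t t, Prog.loop t c]

theorem ev_sizeLoop (t x : ℕ) (c : Prog) (r : ℕ → ℤ) :
    (sizeLoop t x c).ev r =
      c.ev^[2 * bits (r x)] (Function.update r t (2 * bits (r x) : ℕ)) := by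
  simp only [sizeLoop, ev_block_cons, ev_block_nil, Prog.ev, Op.eval, Function.update_self,
    Function.update_idem]
  have : (bits (r x) : ℤ) + (bits (r x) : ℤ) = (2 * bits (r x) : ℕ) := by push_cast; ring
  rw [this, Int.toNat_natCast]

/-- After `i` repetitions of the program, binary lengths have grown by at most a constant times
`i`. -/
def Prog.Slow (c : Prog) : Prop :=
  ∃ (K : ℕ) (J : ℕ → ℕ → (ℕ → ℤ) → Prop), (∀ B r, Bounded B r → J B 0 r) ∧
    (∀ B i r, J B i r → J B (i + 1) (c.ev r)) ∧ ∀ B i r, J B i r → Bounded (K * (B + i + 1)) r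

/-- A linear bound for each step could compound exponentially over the loop. `Slow` instead bounds
all intermediate lengths by a multiple of B + n with n ≤ 2B, and n steps of quadratic cost have
cubic cost in total. -/
theorem poly_sizeLoop (t x : ℕ) {c : Prog} (hp : c.Poly 2) (hc : c.Slow) :
    (sizeLoop t x c).Poly 3 := by
  obtain ⟨K, J, h0, h1, h2⟩ := hc
  obtain ⟨K', hp⟩ := hp
  refine ⟨4 * K + 2 * (K' * (4 * K + 1) ^ 2) + 100, fun B r h => ?_⟩
  set n := 2 * bits (r x) with hn
  have hnB : n ≤ 2 * B := by have := h x; omega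
  set r' := Function.update r t (n : ℤ) with hr'
  have hb : Bounded (2 * B + 1) r' := by
    refine (h.mono (by omega)).update t ?_
    have : (n : ℤ) = (bits (r x) : ℤ) + (bits (r x) : ℤ) := by rw [hn]; push_cast; ring
    rw [this]
    have h3 := (bits_bits_le (r x)).trans (h x)
    exact (bits_add_le h3 h3).trans (by omega)
  have hJ : ∀ i, J (2 * B + 1) i (c.ev^[i] r') := by
    intro i
    induction i with
    | zero => exact h0 _ _ hb
    | succ i ih =>
      rw [Function.iterate_succ_apply']
      exact h1 _ _ _ ih
  have hB : ∀ i ≤ n, Bounded (4 * K * (B + 1)) (c.ev^[i] r') := by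
    intro i hi
    refine (h2 _ _ _ (hJ i)).mono ?_
    calc K * (2 * B + 1 + i + 1) ≤ K * (4 * (B + 1)) := Nat.mul_le_mul_left _ (by omega)
      _ = _ := by ring
  have hcost : (sizeLoop t x c).cost r = (1 + bits (r x)) ^ 2 +
      ((1 + bits (bits (r x) : ℤ) + bits (bits (r x) : ℤ)) ^ 2 +
      ((1 + bits (n : ℤ) + ∑ i ∈ Finset.range n, (1 + c.cost (c.ev^[i] r'))) + 0)) := by
    have h3 : (bits (r x) : ℤ) + (bits (r x) : ℤ) = (n : ℕ) := by rw [hn]; push_cast; ring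
    simp only [sizeLoop, Prog.block, List.foldr, Prog.cost, Prog.ev, Op.eval, Function.update_self,
      Function.update_idem, h3, Int.toNat_natCast, hr']
  constructor
  · rw [ev_sizeLoop]
    exact (hB n le_rfl).mono (Nat.mul_le_mul_right _ (by omega))
  · have hs : ∑ i ∈ Finset.range n, (1 + c.cost (c.ev^[i] r')) ≤
        n * (1 + K' * ((4 * K + 1) * (B + 1)) ^ 2) := by
      rw [← smul_eq_mul, ← Finset.card_range n, ← Finset.sum_const, Finset.card_range]
      refine Finset.sum_le_sum fun i hi => Nat.add_le_add_left ?_ 1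
      rw [Finset.mem_range] at hi
      exact (hp _ _ (hB i hi.le)).2.trans
        (Nat.mul_le_mul_left _ (Nat.pow_le_pow_left (by nlinarith) 2))
    have hs' : n * (1 + K' * ((4 * K + 1) * (B + 1)) ^ 2) ≤
        (2 * (B + 1)) * (1 + K' * ((4 * K + 1) * (B + 1)) ^ 2) :=
      Nat.mul_le_mul_right _ (by omega)
    have a1 : (1 + bits (r x)) ^ 2 ≤ (B + 1) ^ 2 :=
      Nat.pow_le_pow_left (by have := h x; omega) 2
    have a2 : (1 + bits (bits (r x) : ℤ) + bits (bits (r x) : ℤ)) ^ 2 ≤ (2 * (B + 1)) ^ 2 :=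
      Nat.pow_le_pow_left (by have := (bits_bits_le (r x)).trans (h x); omega) 2
    have a3 : bits (n : ℤ) ≤ 2 * B := (size_le_self n).trans hnB
    have p1 : (B + 1) ^ 2 ≤ (B + 1) ^ 3 := Nat.pow_le_pow_right (by omega) (by omega)
    have p2 : B + 1 ≤ (B + 1) ^ 3 := Nat.le_self_pow (by norm_num) _
    rw [mul_pow] at a2
    rw [hcost]
    have e1 : (2 * (B + 1)) * (1 + K' * ((4 * K + 1) * (B + 1)) ^ 2) =
        2 * (B + 1) + 2 * (K' * (4 * K + 1) ^ 2) * (B + 1) ^ 3 := by ring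
    rw [e1] at hs'
    have e2 : 100 * (B + 1) ^ 3 ≤ (4 * K + 100) * (B + 1) ^ 3 := Nat.mul_le_mul_right _ (by omega)
    have e3 : (4 * K + 2 * (K' * (4 * K + 1) ^ 2) + 100) * (B + 1) ^ 3 =
        2 * (K' * (4 * K + 1) ^ 2) * (B + 1) ^ 3 + (4 * K + 100) * (B + 1) ^ 3 := by ring
    rw [e3]
    generalize 2 * (K' * (4 * K + 1) ^ 2) * (B + 1) ^ 3 = w at *
    omega

/-! ### The Euclidean algorithm as a program

Register `0` holds `N`, register `2` the factor found so far, and register `3` the constant `1`,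
which serves to copy a register by a division. -/

/-- One step of the Euclidean algorithm on the registers `4` and `5`. -/
def gcdBody : Prog :=
  .ifPos 5 (.block [.op 6 .mod 4 5, .op 4 .div 5 3, .op 5 .div 6 3]) .skip

/-- Write the greatest common divisor of `N` and register `v` to register `2` if it is a non-trivial
divisor of `N`. -/
def gcdTest (v : ℕ) : Prog :=
  .block [.op 4 .div 0 3, .op 5 .mod v 0, sizeLoop 7 0 gcdBody, .op 8 .sub 4 3, .op 9 .sub 0 4,
    .ifPos 8 (.ifPos 9 (.op 2 .div 4 3) .skip) .skip]

theorem ev_gcdBody {r : ℕ → ℤ} (h3 : r 3 = 1) :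
    gcdBody.ev r 4 = (if 0 < r 5 then r 5 else r 4) ∧
    gcdBody.ev r 5 = (if 0 < r 5 then r 4 % r 5 else r 5) := by
  rw [gcdBody, Prog.ev]
  split_ifs with h
  · simp [Prog.ev, Op.eval, h3]
  · exact ⟨rfl, rfl⟩

theorem ev_gcdBody_of_ne {r : ℕ → ℤ} {j : ℕ} (h4 : j ≠ 4) (h5 : j ≠ 5) (h6 : j ≠ 6) :
    gcdBody.ev r j = r j :=
  ev_of_notMem_writes _ (by simp [gcdBody, Prog.block, Prog.writes, h4, h5, h6]) r

/-- For x ≥ y > 0 one has x ≥ y + (x mod y) > 2(x mod y), so the product of the two entries at least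
halves in each step. Once the second entry is 0, further steps change nothing. -/
theorem iterate_gcdBody {r : ℕ → ℤ} (h3 : r 3 = 1) (h5 : 0 ≤ r 5) (h54 : r 5 ≤ r 4) (n : ℕ) :
    gcdBody.ev^[n] r 3 = 1 ∧ 0 ≤ gcdBody.ev^[n] r 5 ∧ gcdBody.ev^[n] r 5 ≤ gcdBody.ev^[n] r 4 ∧
    Int.gcd (gcdBody.ev^[n] r 4) (gcdBody.ev^[n] r 5) = Int.gcd (r 4) (r 5) ∧
    gcdBody.ev^[n] r 4 * gcdBody.ev^[n] r 5 * 2 ^ n ≤ r 4 * r 5 := by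
  induction n with
  | zero => simp [h3, h5, h54]
  | succ n ih =>
    rw [Function.iterate_succ_apply']
    generalize gcdBody.ev^[n] r = r' at ih
    obtain ⟨i3, i5, i54, ig, ib⟩ := ih
    obtain ⟨e4, e5⟩ := ev_gcdBody i3
    rw [e4, e5, ev_gcdBody_of_ne (by norm_num) (by norm_num) (by norm_num)]
    refine ⟨i3, ?_⟩
    split_ifs with h
    · have m0 := Int.emod_nonneg (r' 4) h.ne'
      have m1 := Int.emod_lt_of_pos (r' 4) h
      have m2 : r' 5 + r' 4 % r' 5 ≤ r' 4 := by
        have hdm := Int.emod_add_mul_ediv (r' 4) (r' 5)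
        have hq : 1 ≤ r' 4 / r' 5 := (Int.le_ediv_iff_mul_le h).mpr (by linarith)
        nlinarith
      refine ⟨m0, m1.le, ?_, ?_⟩
      · rw [← ig, Int.gcd_comm (r' 5), Int.gcd_emod]
      · refine le_trans ?_ ib
        have : r' 5 * (2 * (r' 4 % r' 5)) ≤ r' 5 * r' 4 :=
          mul_le_mul_of_nonneg_left (by linarith) h.le
        have h2 : (0 : ℤ) < 2 ^ n := by positivity
        calc r' 5 * (r' 4 % r' 5) * 2 ^ (n + 1) = r' 5 * (2 * (r' 4 % r' 5)) * 2 ^ n := by ring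
          _ ≤ r' 5 * r' 4 * 2 ^ n := mul_le_mul_of_nonneg_right this h2.le
          _ = _ := by ring
    · have h0 : r' 5 = 0 := by omega
      rw [h0] at ib i54 ig ⊢
      exact ⟨le_rfl, i54, ig, by simpa using ib⟩

theorem iterate_gcdBody_eq {r : ℕ → ℤ} (h3 : r 3 = 1) (h5 : 0 ≤ r 5) (h54 : r 5 ≤ r 4) {n : ℕ}
    (hn : r 4 * r 5 < 2 ^ n) : gcdBody.ev^[n] r 4 = Int.gcd (r 4) (r 5) := by
  obtain ⟨-, i5, i54, ig, ib⟩ := iterate_gcdBody h3 h5 h54 n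
  generalize gcdBody.ev^[n] r = r' at *
  have h2 : (0 : ℤ) < 2 ^ n := by positivity
  have h0 : r' 5 = 0 := by
    by_contra hne
    have : 1 ≤ r' 4 * r' 5 := by nlinarith [lt_of_le_of_ne i5 (Ne.symm hne)]
    nlinarith
  rw [h0, Int.gcd_zero_right] at ig
  rw [h0] at i54
  omega

/-- The case v = 4 must be excluded, as register 4 is overwritten before v is read. -/
theorem ev_gcdTest {v : ℕ} (hv : v ≠ 4) {r : ℕ → ℤ} (h3 : r 3 = 1) {N : ℕ} (hN : 0 < N)
    (h0 : r 0 = N) :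
    (gcdTest v).ev r 2 = if 1 < Int.gcd (r v) N ∧ Int.gcd (r v) N < N then
      (Int.gcd (r v) N : ℤ) else r 2 := by
  have hN' : (0 : ℤ) < N := by exact_mod_cast hN
  set r₁ : ℕ → ℤ := Function.update (Function.update (Function.update r 4 N) 5 (r v % N)) 7
    (2 * bits (N : ℤ) : ℕ) with hr₁
  have s3 : r₁ 3 = 1 := by simp [hr₁, h3]
  have s4 : r₁ 4 = N := by simp [hr₁]
  have s5 : r₁ 5 = r v % N := by simp [hr₁]
  have k0 : 0 ≤ r v % N := Int.emod_nonneg _ hN'.ne'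
  have k1 : r v % N < N := Int.emod_lt_of_pos _ hN'
  have hb : (N : ℤ) < 2 ^ bits (N : ℤ) := by
    have := natAbs_lt (N : ℤ)
    rw [Int.natAbs_natCast] at this
    exact_mod_cast this
  -- Both entries are at most N < 2^`bits N`, so twice the binary length of N is a sufficient number
  -- of steps.
  have hgcd := iterate_gcdBody_eq s3 (by rw [s5]; exact k0) (by rw [s4, s5]; exact k1.le)
    (n := 2 * bits (N : ℤ)) (by
      rw [s4, s5, two_mul, pow_add]
      nlinarith)
  have hframe : ∀ j, j ≠ 4 → j ≠ 5 → j ≠ 6 → gcdBody.ev^[2 * bits (N : ℤ)] r₁ j = r₁ j := by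
    intro j j4 j5 j6
    generalize 2 * bits (N : ℤ) = n
    induction n with
    | zero => rfl
    | succ n ih => rw [Function.iterate_succ_apply', ev_gcdBody_of_ne j4 j5 j6, ih]
  have f0 := hframe 0 (by norm_num) (by norm_num) (by norm_num)
  have f2 := hframe 2 (by norm_num) (by norm_num) (by norm_num)
  have f3 := hframe 3 (by norm_num) (by norm_num) (by norm_num)
  have t0 : r₁ 0 = N := by simp [hr₁, h0]
  have t2 : r₁ 2 = r 2 := by simp [hr₁]
  rw [s4, s5] at hgcd
  have hg : (Int.gcd N (r v % N)) = Int.gcd (r v) N := by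
    rw [Int.gcd_comm, Int.gcd_emod]
  rw [hg] at hgcd
  rw [t0] at f0
  rw [t2] at f2
  rw [s3] at f3
  rw [gcdTest]
  simp only [ev_block_cons, ev_block_nil, ev_sizeLoop]
  have e1 : (Prog.op 5 Op.mod v 0).ev ((Prog.op 4 Op.div 0 3).ev r) =
      Function.update (Function.update r 4 (N : ℤ)) 5 (r v % N) := by
    simp [Prog.ev, Op.eval, h3, h0, hv]
  have e2 : Function.update (Function.update r 4 (N : ℤ)) 5 (r v % N) 0 = N := by simp [h0]
  rw [e1, e2, ← hr₁]
  generalize gcdBody.ev^[2 * bits (N : ℤ)] r₁ = r₂ at *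
  have d1 : 1 < r₂ 4 ↔ 1 < Int.gcd (r v) N := by rw [hgcd]; exact_mod_cast Iff.rfl
  have d2 : r₂ 4 < N ↔ Int.gcd (r v) N < N := by rw [hgcd]; exact_mod_cast Iff.rfl
  rw [← hgcd, ← f2]
  simp only [← d1, ← d2]
  by_cases c1 : 1 < r₂ 4
  · by_cases c2 : r₂ 4 < N
    · simp [Prog.ev, Op.eval, f0, f3, c1, c2]
    · simp [Prog.ev, Op.eval, f0, f3, c1, c2]
  · simp [Prog.ev, Op.eval, f3, c1]

theorem ev_gcdTest_of_notMem {v j : ℕ} (hj : j ∉ [4, 5, 7, 6, 8, 9, 2]) (r : ℕ → ℤ) :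
    (gcdTest v).ev r j = r j :=
  ev_of_notMem_writes _ (by
    simp only [List.mem_cons, List.not_mem_nil, or_false, not_or] at hj
    simp [gcdTest, gcdBody, sizeLoop, Prog.block, Prog.writes, hj]) r

/-- Remainders and copies are never longer than the registers they come from, so the bound does not
grow at all. -/
theorem slow_gcdBody : gcdBody.Slow := by
  refine ⟨1, fun B _ r => Bounded B r, fun _ _ h => h, fun B i r h => ?_,
    fun B i r h => h.mono (by omega)⟩
  rw [gcdBody, Prog.ev]
  split_ifs
  · simp only [ev_block_cons, ev_block_nil, Prog.ev, Op.eval]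
    have b1 := h.update 6 (bits_mod_le (h 4) (h 5))
    have b2 := b1.update 4 ((bits_div_le (Function.update r 6 (r 4 % r 5) 5)
      (Function.update r 6 (r 4 % r 5) 3)).trans (b1 5))
    exact b2.update 5 ((bits_div_le _ _).trans (b2 6))
  · exact h

theorem poly_gcdBody : gcdBody.Poly 2 :=
  poly_ifPos _ (poly_block (by simp [poly_op])) (poly_skip 2)

theorem poly_gcdTest (v : ℕ) : (gcdTest v).Poly 3 := by
  refine poly_block fun c hc => ?_
  simp only [List.mem_cons, List.not_mem_nil, or_false] at hc
  rcases hc with rfl | rfl | rfl | rfl | rfl | rfl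
  · exact poly_op (by norm_num) _ _ _ _
  · exact poly_op (by norm_num) _ _ _ _
  · exact poly_sizeLoop _ _ poly_gcdBody slow_gcdBody
  · exact poly_op (by norm_num) _ _ _ _
  · exact poly_op (by norm_num) _ _ _ _
  · exact poly_ifPos _ (poly_ifPos _ (poly_op (by norm_num) _ _ _ _) (poly_skip 3)) (poly_skip 3)

theorem det_gcdTest (v : ℕ) : (gcdTest v).Det := by
  simp [gcdTest, gcdBody, sizeLoop, Prog.block, Prog.Det]

/-! ### Integer square roots as a program -/

/-- One bisection step for the square root of register `n`, between the registers `10` and `11`;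
register `22` holds the constant `2`. -/
def sqrtBody (n : ℕ) : Prog :=
  .block [.op 12 .add 10 11, .op 12 .div 12 22, .op 13 .mul 12 12, .op 13 .sub 13 n,
    .ifPos 13 (.op 11 .div 12 3) (.op 10 .div 12 3)]

/-- Write the integer square root of register `n`, which is at most `N`, to register `10`. -/
def sqrtProg (n : ℕ) : Prog :=
  .block [.const 10 0, .op 11 .add n 3, sizeLoop 14 0 (sqrtBody n)]

theorem ev_sqrtBody {n : ℕ} (hn : n ∉ [10, 11, 12, 13]) {r : ℕ → ℤ} (h3 : r 3 = 1)
    (h22 : r 22 = 2) :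
    (sqrtBody n).ev r 10 = (if r n < ((r 10 + r 11) / 2) * ((r 10 + r 11) / 2) then r 10
      else (r 10 + r 11) / 2) ∧
    (sqrtBody n).ev r 11 = (if r n < ((r 10 + r 11) / 2) * ((r 10 + r 11) / 2) then
      (r 10 + r 11) / 2 else r 11) := by
  simp only [List.mem_cons, List.not_mem_nil, or_false, not_or] at hn
  obtain ⟨-, -, n2, n3⟩ := hn
  simp only [sqrtBody, ev_block_cons, ev_block_nil, Prog.ev, Op.eval, Function.update_apply, h22,
    n2, n3]
  norm_num
  split_ifs <;> simp [h3]

theorem ev_sqrtBody_of_notMem {n j : ℕ} (hj : j ∉ [10, 11, 12, 13]) (r : ℕ → ℤ) :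
    (sqrtBody n).ev r j = r j :=
  ev_of_notMem_writes _ (by
    simp only [List.mem_cons, List.not_mem_nil, or_false, not_or] at hj
    simp [sqrtBody, Prog.block, Prog.writes, hj]) r

/-- Bisection between x² ≤ n < y²: the gap y - x halves, rounded up, in each step. At gap 1 the
midpoint rounds down to x and further steps change nothing. -/
theorem iterate_sqrtBody {n : ℕ} (hn : n ∉ [10, 11, 12, 13]) {r : ℕ → ℤ} (h3 : r 3 = 1)
    (h22 : r 22 = 2) (h10 : 0 ≤ r 10) (hlt : r 10 < r 11) (hlo : r 10 * r 10 ≤ r n)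
    (hhi : r n < r 11 * r 11) {T : ℕ} (hT : r 11 - r 10 ≤ 2 ^ T) (i : ℕ) {r' : ℕ → ℤ}
    (hr' : r' = (sqrtBody n).ev^[i] r) :
    r' 3 = 1 ∧ r' 22 = 2 ∧ r' n = r n ∧ 0 ≤ r' 10 ∧ r' 10 < r' 11 ∧ r' 10 * r' 10 ≤ r n ∧
      r n < r' 11 * r' 11 ∧ r' 11 - r' 10 ≤ 2 ^ (T - i) := by
  induction i generalizing r' with
  | zero => subst hr'; exact ⟨h3, h22, rfl, h10, hlt, hlo, hhi, hT⟩
  | succ i ih =>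
    rw [Function.iterate_succ_apply'] at hr'
    obtain ⟨i3, i22, in', i10, ilt, ilo, ihi, iT⟩ := ih rfl
    generalize (sqrtBody n).ev^[i] r = r₁ at *
    obtain ⟨e10, e11⟩ := ev_sqrtBody hn i3 i22
    subst hr'
    rw [e10, e11, ev_sqrtBody_of_notMem (by simp), ev_sqrtBody_of_notMem (by simp),
      ev_sqrtBody_of_notMem hn, in']
    refine ⟨i3, i22, rfl, ?_⟩
    -- For i ≥ T the truncated exponents are 0 and the gap is already 1.
    have hhalf : (r₁ 11 - r₁ 10 + 1) / 2 ≤ 2 ^ (T - (i + 1)) := by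
      rcases Nat.lt_or_ge i T with h | h
      · have : T - i = (T - (i + 1)) + 1 := by omega
        rw [this, pow_succ] at iT
        omega
      · have h1 : T - i = 0 := by omega
        have h2 : T - (i + 1) = 0 := by omega
        rw [h1] at iT
        rw [h2]
        omega
    set m := (r₁ 10 + r₁ 11) / 2 with hm
    split_ifs with h
    · have : r₁ 10 < m := by
        by_contra hle
        have : 0 ≤ m := by omega
        nlinarith
      exact ⟨i10, this, ilo, h, by omega⟩
    · exact ⟨by omega, by omega, by linarith, ihi, by omega⟩

theorem ev_sqrtProg {n : ℕ} (hn : n ∉ [10, 11, 12, 13, 14]) {r : ℕ → ℤ} (h3 : r 3 = 1)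
    (h22 : r 22 = 2) {N m : ℕ} (h0 : r 0 = N) (hm : r n = m) (hmN : m ≤ N) :
    (sqrtProg n).ev r 10 = Nat.sqrt m := by
  simp only [List.mem_cons, List.not_mem_nil, or_false, not_or] at hn
  obtain ⟨n0, n1, n2, n3, n4⟩ := hn
  simp only [sqrtProg, ev_block_cons, ev_block_nil, ev_sizeLoop]
  have e0 : (Prog.op 11 Op.add n 3).ev ((Prog.const 10 0).ev r) 0 = N := by
    simp [Prog.ev, h0]
  rw [e0]
  set T := 2 * bits (N : ℤ) with hT
  set r₁ := Function.update ((Prog.op 11 Op.add n 3).ev ((Prog.const 10 0).ev r)) 14 (T : ℤ)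
    with hr₁
  have s10 : r₁ 10 = 0 := by simp [hr₁, Prog.ev]
  have s11 : r₁ 11 = m + 1 := by simp [hr₁, Prog.ev, Op.eval, h3, hm, n0]
  have sn : r₁ n = m := by simp [hr₁, Prog.ev, hm, n0, n1, n4]
  have hbits : (N : ℤ) < 2 ^ bits (N : ℤ) := by
    have := natAbs_lt (N : ℤ)
    rw [Int.natAbs_natCast] at this
    exact_mod_cast this
  have hpow : (2 : ℤ) ^ bits (N : ℤ) ≤ 2 ^ T :=
    pow_le_pow_right₀ (by norm_num) (by omega)
  have hmN' : (m : ℤ) ≤ N := by exact_mod_cast hmN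
  obtain ⟨-, -, -, i10, ilt, ilo, ihi, iT⟩ := iterate_sqrtBody (n := n) (r := r₁) (T := T)
    (by simp [n0, n1, n2, n3]) (by simp [hr₁, Prog.ev, h3]) (by simp [hr₁, Prog.ev, h22])
    (by rw [s10]) (by rw [s10, s11]; omega) (by rw [s10, sn]; simp)
    (by rw [s11, sn]; nlinarith) (by rw [s10, s11]; linarith) T rfl
  generalize (sqrtBody n).ev^[T] r₁ = r₂ at *
  rw [Nat.sub_self, pow_zero] at iT
  rw [sn] at ilo ihi
  have h11 : r₂ 11 = r₂ 10 + 1 := by omega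
  obtain ⟨a, ha⟩ := Int.eq_ofNat_of_zero_le i10
  rw [h11] at ihi
  rw [ha] at ilo ihi ⊢
  have h1 : a * a ≤ m := by exact_mod_cast ilo
  have h2 : m < (a + 1) * (a + 1) := by exact_mod_cast ihi
  have h3' : a = Nat.sqrt m := Nat.eq_sqrt.mpr ⟨h1, h2⟩
  rw [← h3']

theorem ev_sqrtProg_of_notMem {n j : ℕ} (hj : j ∉ [10, 11, 12, 13, 14]) (r : ℕ → ℤ) :
    (sqrtProg n).ev r j = r j :=
  ev_of_notMem_writes _ (by
    simp only [List.mem_cons, List.not_mem_nil, or_false, not_or] at hj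
    simp [sqrtProg, sqrtBody, sizeLoop, Prog.block, Prog.writes, hj]) r

/-- The two ends of the interval gain at most one bit in each step, and the scratch registers are
recomputed from them, so lengths do not compound. The bound 2(B + i) + 3 leaves room for the square
of the midpoint. -/
theorem slow_sqrtBody (n : ℕ) : (sqrtBody n).Slow := by
  refine ⟨100, fun B i r => Bounded (2 * (B + i) + 3) r ∧ bits (r 10) ≤ B + i ∧ bits (r 11) ≤ B + i,
    fun B r h => ⟨h.mono (by omega), h 10, h 11⟩, ?_, ?_⟩
  · rintro B i r ⟨h, h10, h11⟩
    have w1 := bits_add_le h10 h11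
    have w2 : bits ((r 10 + r 11) / r 22) ≤ B + i + 1 := (bits_div_le _ _).trans w1
    set m := (r 10 + r 11) / r 22 with hm
    have w3 : bits (m * m) ≤ 2 * (B + i) + 3 := (bits_mul_le m m).trans (by omega)
    have e : (sqrtBody n).ev r = (Prog.block
        [.op 13 .sub 13 n, .ifPos 13 (.op 11 .div 12 3) (.op 10 .div 12 3)]).ev
        (Function.update (Function.update r 12 m) 13 (m * m)) := by
      simp [sqrtBody, Prog.ev, Op.eval, hm]
    rw [e]
    have b1 : Bounded (2 * (B + i) + 3) (Function.update (Function.update r 12 m) 13 (m * m)) :=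
      (h.update 12 (w2.trans (by omega))).update 13 w3
    set r₁ := Function.update (Function.update r 12 m) 13 (m * m) with hr₁
    have c12 : r₁ 12 = m := by simp [hr₁]
    have c10 : r₁ 10 = r 10 := by simp [hr₁]
    have c11 : r₁ 11 = r 11 := by simp [hr₁]
    have b2 : Bounded (2 * (B + i) + 4) (Function.update r₁ 13 (r₁ 13 - r₁ n)) :=
      (b1.mono (by omega)).update 13 (bits_sub_le (b1 13) (b1 n))
    simp only [ev_block_cons, ev_block_nil, Prog.ev, Op.eval]
    set r₂ := Function.update r₁ 13 (r₁ 13 - r₁ n) with hr₂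
    have d12 : r₂ 12 = m := by simp [hr₂, c12]
    have d10 : r₂ 10 = r 10 := by simp [hr₂, c10]
    have d11 : r₂ 11 = r 11 := by simp [hr₂, c11]
    have w4 : bits (m / r₂ 3) ≤ B + i + 1 := (bits_div_le _ _).trans w2
    rw [d12]
    split_ifs
    · exact ⟨(b2.update 11 (w4.trans (by omega))).mono (by omega), by simp [d10]; omega,
        by simpa [add_assoc] using w4⟩
    · exact ⟨(b2.update 10 (w4.trans (by omega))).mono (by omega), by simpa [add_assoc] using w4,
        by simp [d11]; omega⟩
  · rintro B i r ⟨h, -, -⟩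
    exact h.mono (by omega)

theorem poly_sqrtBody (n : ℕ) : (sqrtBody n).Poly 2 :=
  poly_block (by simp [poly_op, poly_ifPos])

theorem poly_sqrtProg (n : ℕ) : (sqrtProg n).Poly 3 := by
  refine poly_block fun c hc => ?_
  simp only [List.mem_cons, List.not_mem_nil, or_false] at hc
  rcases hc with rfl | rfl | rfl
  · exact poly_const _ _ _
  · exact poly_op (by norm_num) _ _ _ _
  · exact poly_sizeLoop _ _ (poly_sqrtBody n) (slow_sqrtBody n)

theorem det_sqrtProg (n : ℕ) : (sqrtProg n).Det := by
  simp [sqrtProg, sqrtBody, sizeLoop, Prog.block, Prog.Det]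

/-! ### The program -/

/-- Write `0` to all registers below `60` except `0` and `2`. -/
def clearRegs : Prog := .block ((1 :: List.range' 3 57).map fun d => .const d 0)

/-- Load the constants, test the divisors `2, 3, 5`, and write the number of samples to
register `17`. -/
def setup : Prog :=
  .block [.const 3 1, .const 22 2, .const 23 3, .const 24 5, gcdTest 22, gcdTest 23, gcdTest 24,
    sqrtProg 0, .op 16 .div 10 3, .op 17 .sub 0 16, .op 17 .sub 17 16, .op 17 .sub 17 3]

/-- Compute the sample `a` and `δ = a² mod N`, test `a` and `a - √δ`, and write the question. -/
def prepare : Prog :=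
  .block [.op 18 .add 18 16, .op 18 .add 18 3, .op 19 .mul 18 18, .op 19 .mod 19 0,
    sqrtProg 19, .op 20 .div 10 3, .op 21 .sub 18 20, gcdTest 18, gcdTest 21,
    .op 26 .div 0 3, .op 27 .div 19 3, .op 28 .div 0 3, .const 29 0, .const 30 1,
    .op 31 .div 18 3, .const 32 1, .const 33 1]

/-- Write the norm of `(x + y √δ) / z`, for the registers `x, y, z` and with `δ` in register `19`,
to register `d`. -/
def normProg (x y z d : ℕ) : Prog :=
  .block [.op 50 .mul x x, .op 51 .mul y y, .op 51 .mul 51 19, .op 50 .sub 50 51,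
    .op 51 .mul z z, .op d .div 50 51]

/-- Test the norms of the two generators in the answer, and of their sum. -/
def finish : Prog :=
  .block [normProg 34 35 36 46, normProg 37 38 39 47,
    .op 52 .mul 34 39, .op 53 .mul 37 36, .op 52 .add 52 53,
    .op 54 .mul 35 39, .op 55 .mul 38 36, .op 54 .add 54 55, .op 56 .mul 36 39,
    normProg 52 54 56 48, gcdTest 46, gcdTest 47, gcdTest 48]

/-- One trial. -/
def trial : Prog :=
  .seq (.seq clearRegs setup) (.seq (.rand 18 17) (.seq prepare (.seq (.query 26 34) finish)))

/-- Write the factor that was found and its cofactor to the registers `0` and `1`. -/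
def output : Prog :=
  .ifPos 2 (.block [.const 3 1, .op 1 .div 0 2, .op 0 .div 2 3]) .skip

/-- The whole program: `k` trials. -/
def mainProg : Prog := .seq (.ifPos 0 (.loop 1 trial) .skip) output

/-! ### What the parts of the program compute -/

theorem ev_block_const_zero (l : List ℕ) (r : ℕ → ℤ) (j : ℕ) :
    (Prog.block (l.map fun d => Prog.const d 0)).ev r j = if j ∈ l then 0 else r j := by
  induction l generalizing r with
  | nil => simp
  | cons d l ih =>
    rw [List.map_cons, ev_block_cons, ih]
    by_cases h1 : j ∈ l
    · simp [h1]
    · by_cases h2 : j = d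
      · simp [h2, Prog.ev]
      · simp [h1, h2, Prog.ev]

theorem cost_block_const_zero (l : List ℕ) (r : ℕ → ℤ) :
    (Prog.block (l.map fun d => Prog.const d 0)).cost r = l.length := by
  induction l generalizing r with
  | nil => rfl
  | cons d l ih =>
    have h := ih ((Prog.const d 0).ev r)
    rw [List.map_cons, Prog.block, List.foldr_cons, Prog.cost, ← Prog.block, h]
    simp [Prog.cost, bits]
    ring

/-- The property `Φ` holds for the non-trivial divisors of `N`. -/
def HoldsForDivisors (N : ℕ) (Φ : ℤ → Prop) : Prop :=
  ∀ g : ℕ, 1 < g → g < N → g ∣ N → Φ g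

/-- Applied with two properties: being a prime factor, which makes success permanent, and lying
between 0 and N, which keeps register 2 short. -/
theorem gcdTest_preserves {N : ℕ} {Φ : ℤ → Prop} (hΦ : HoldsForDivisors N Φ) (hN : 0 < N) {v : ℕ}
    (hv : v ≠ 4) {r : ℕ → ℤ} (h0 : r 0 = N) (h3 : r 3 = 1) (h : Φ (r 2)) :
    Φ ((gcdTest v).ev r 2) := by
  rw [ev_gcdTest hv h3 hN h0]
  split_ifs with hg
  · exact hΦ _ hg.1 hg.2 (by exact_mod_cast Int.gcd_dvd_right (r v) (N : ℤ))
  · exact h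

/-- Exactly one of `p, q` divides `v`. -/
def Hit (p q : ℕ) (v : ℤ) : Prop :=
  ((p : ℤ) ∣ v ∧ ¬ (q : ℤ) ∣ v) ∨ ((q : ℤ) ∣ v ∧ ¬ (p : ℤ) ∣ v)

/-- The factor `v` of `p q` has been found. -/
def IsFactor (p q : ℕ) (v : ℤ) : Prop := v = p ∨ v = q

theorem holdsForDivisors_isFactor {p q : ℕ} (hp : p.Prime) (hq : q.Prime) :
    HoldsForDivisors (p * q) (IsFactor p q) := by
  intro g h1 h2 h3
  obtain ⟨a, b, ha, hb, rfl⟩ := (Nat.dvd_mul).mp h3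
  rcases (Nat.dvd_prime hp).mp ha with rfl | rfl <;> rcases (Nat.dvd_prime hq).mp hb with rfl | rfl
  · omega
  · exact Or.inr (by simp)
  · exact Or.inl (by simp)
  · omega

theorem gcd_of_hit {p q : ℕ} (hp : p.Prime) (hq : q.Prime) {v : ℤ} (hv : Hit p q v) :
    1 < Int.gcd v (p * q : ℕ) ∧ Int.gcd v (p * q : ℕ) < p * q := by
  have key : ∀ p q : ℕ, p.Prime → q.Prime → (p : ℤ) ∣ v → ¬ (q : ℤ) ∣ v →
      1 < Int.gcd v (p * q : ℕ) ∧ Int.gcd v (p * q : ℕ) < p * q := by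
    intro p q hp hq h1 h2
    have hpos : 0 < p * q := mul_pos hp.pos hq.pos
    have hdvd : p ∣ Int.gcd v (p * q : ℕ) := Int.dvd_gcd h1 (by exact_mod_cast dvd_mul_right p q)
    have hdN : Int.gcd v (p * q : ℕ) ∣ p * q := by
      exact_mod_cast Int.gcd_dvd_right v ((p * q : ℕ) : ℤ)
    refine ⟨hp.one_lt.trans_le (Nat.le_of_dvd (Nat.pos_of_dvd_of_pos hdN hpos) hdvd),
      lt_of_le_of_ne (Nat.le_of_dvd hpos hdN) fun heq => h2 ?_⟩
    have := Int.gcd_dvd_left v ((p * q : ℕ) : ℤ)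
    rw [heq] at this
    exact (by exact_mod_cast dvd_mul_left (q : ℤ) p : (q : ℤ) ∣ ((p * q : ℕ) : ℤ)).trans this
  rcases hv with h | h
  · exact key p q hp hq h.1 h.2
  · have := key q p hq hp h.1 h.2
    rwa [mul_comm q p] at this

theorem gcdTest_of_hit {p q : ℕ} (hp : p.Prime) (hq : q.Prime) {v : ℕ} (hv : v ≠ 4) {r : ℕ → ℤ}
    (h0 : r 0 = (p * q : ℕ)) (h3 : r 3 = 1) (h : Hit p q (r v)) :
    IsFactor p q ((gcdTest v).ev r 2) := by
  have hg := gcd_of_hit hp hq h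
  rw [ev_gcdTest hv h3 (mul_pos hp.pos hq.pos) h0, if_pos hg]
  exact holdsForDivisors_isFactor hp hq _ hg.1 hg.2
    (by exact_mod_cast Int.gcd_dvd_right (r v) ((p * q : ℕ) : ℤ))

section setup

variable {N : ℕ} {r : ℕ → ℤ}

/-- The first part of `setup`. -/
def setupTests : Prog :=
  .block [.const 3 1, .const 22 2, .const 23 3, .const 24 5, gcdTest 22, gcdTest 23, gcdTest 24]

theorem setup_eq (r : ℕ → ℤ) : setup.ev r = (Prog.block [.op 16 .div 10 3, .op 17 .sub 0 16,
    .op 17 .sub 17 16, .op 17 .sub 17 3]).ev ((sqrtProg 0).ev (setupTests.ev r)) := rfl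

theorem setup_regs (hr : r 0 = N) :
    setup.ev r 0 = N ∧ setup.ev r 3 = 1 ∧ setup.ev r 22 = 2 ∧ setup.ev r 16 = Nat.sqrt N ∧
      setup.ev r 17 = N - Nat.sqrt N - Nat.sqrt N - 1 ∧ setup.ev r 2 = setupTests.ev r 2 := by
  rw [setup_eq]
  have h0 : setupTests.ev r 0 = N := by
    simp [setupTests, ev_gcdTest_of_notMem, Prog.ev, hr]
  have h3 : setupTests.ev r 3 = 1 := by
    simp [setupTests, ev_gcdTest_of_notMem, Prog.ev]
  have h22 : setupTests.ev r 22 = 2 := by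
    simp [setupTests, ev_gcdTest_of_notMem, Prog.ev]
  generalize setupTests.ev r = r₁ at *
  have h10 := ev_sqrtProg (n := 0) (by simp) h3 h22 h0 h0 le_rfl
  have f : ∀ j, j ∉ [10, 11, 12, 13, 14] → (sqrtProg 0).ev r₁ j = r₁ j :=
    fun j hj => ev_sqrtProg_of_notMem hj r₁
  have f0 := f 0 (by simp)
  have f2 := f 2 (by simp)
  have f3 := f 3 (by simp)
  have f22 := f 22 (by simp)
  generalize (sqrtProg 0).ev r₁ = r₂ at *
  rw [h0] at f0
  rw [h3] at f3
  rw [h22] at f22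
  simp [Prog.ev, Op.eval, h10, f0, f3, f22, f2]

theorem setup_preserves {Φ : ℤ → Prop} (hΦ : HoldsForDivisors N Φ) (hN : 0 < N) (hr : r 0 = N)
    (h : Φ (r 2)) : Φ (setup.ev r 2) := by
  rw [(setup_regs hr).2.2.2.2.2]
  simp only [setupTests, ev_block_cons, ev_block_nil]
  refine gcdTest_preserves hΦ hN (by norm_num) ?_ ?_ (gcdTest_preserves hΦ hN (by norm_num) ?_ ?_
    (gcdTest_preserves hΦ hN (by norm_num) ?_ ?_ ?_))
  all_goals simp [ev_gcdTest_of_notMem, Prog.ev, hr, h]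

theorem setup_finds {p q : ℕ} (hp : p.Prime) (hq : q.Prime) (hr : r 0 = (p * q : ℕ))
    (h : Hit p q 2 ∨ Hit p q 3 ∨ Hit p q 5) : IsFactor p q (setup.ev r 2) := by
  rw [(setup_regs hr).2.2.2.2.2]
  simp only [setupTests, ev_block_cons, ev_block_nil]
  have hΦ := holdsForDivisors_isFactor hp hq
  have hN : 0 < p * q := mul_pos hp.pos hq.pos
  rcases h with h | h | h
  · refine gcdTest_preserves hΦ hN (by norm_num) ?_ ?_ (gcdTest_preserves hΦ hN (by norm_num) ?_ ?_
      (gcdTest_of_hit hp hq (by norm_num) ?_ ?_ ?_))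
    all_goals simp [ev_gcdTest_of_notMem, Prog.ev, hr, h]
  · refine gcdTest_preserves hΦ hN (by norm_num) ?_ ?_
      (gcdTest_of_hit hp hq (by norm_num) ?_ ?_ ?_)
    all_goals simp [ev_gcdTest_of_notMem, Prog.ev, hr, h]
  · refine gcdTest_of_hit hp hq (by norm_num) ?_ ?_ ?_
    all_goals simp [ev_gcdTest_of_notMem, Prog.ev, hr, h]

end setup

section prepare

/-- The registers before a call are prepared for the sample `a`. -/
structure Prepared (N a : ℕ) (r : ℕ → ℤ) : Prop where
  reg_zero : r 0 = N
  reg_three : r 3 = 1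
  reg_radicand : r 19 = (a * a % N : ℕ)
  args : (fun i : Fin 8 => r (26 + i)) = inputVec N (a * a % N) (stdCode N a)

/-- The registers after a sample has been drawn. -/
structure Drawn (N a : ℕ) (r : ℕ → ℤ) : Prop where
  reg_zero : r 0 = N
  reg_three : r 3 = 1
  reg_two : r 22 = 2
  sample : r 18 + r 16 + 1 = a

/-- The first part of `prepare`. -/
def prepareRoot : Prog :=
  .block [.op 18 .add 18 16, .op 18 .add 18 3, .op 19 .mul 18 18, .op 19 .mod 19 0,
    sqrtProg 19, .op 20 .div 10 3, .op 21 .sub 18 20]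

/-- The last part of `prepare`. -/
def prepareArgs : Prog :=
  .block [.op 26 .div 0 3, .op 27 .div 19 3, .op 28 .div 0 3, .const 29 0, .const 30 1,
    .op 31 .div 18 3, .const 32 1, .const 33 1]

theorem prepare_eq (r : ℕ → ℤ) : prepare.ev r =
    prepareArgs.ev ((gcdTest 21).ev ((gcdTest 18).ev (prepareRoot.ev r))) := rfl

variable {N a : ℕ} {r : ℕ → ℤ}

theorem prepareRoot_regs (hN : 0 < N) (hr : Drawn N a r) :
    prepareRoot.ev r 0 = N ∧ prepareRoot.ev r 3 = 1 ∧ prepareRoot.ev r 2 = r 2 ∧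
      prepareRoot.ev r 18 = a ∧ prepareRoot.ev r 19 = (a * a % N : ℕ) ∧
      prepareRoot.ev r 21 = a - Nat.sqrt (a * a % N) := by
  obtain ⟨h0, h3, h22, ha⟩ := hr
  set r₁ := (Prog.block [.op 18 .add 18 16, .op 18 .add 18 3, .op 19 .mul 18 18,
    .op 19 .mod 19 0]).ev r with hr₁
  have e : prepareRoot.ev r =
      (Prog.block [.op 20 .div 10 3, .op 21 .sub 18 20]).ev ((sqrtProg 19).ev r₁) := rfl
  have s0 : r₁ 0 = N := by simp [hr₁, Prog.ev, h0]
  have s2 : r₁ 2 = r 2 := by simp [hr₁, Prog.ev]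
  have s3 : r₁ 3 = 1 := by simp [hr₁, Prog.ev, h3]
  have s22 : r₁ 22 = 2 := by simp [hr₁, Prog.ev, h22]
  have s18 : r₁ 18 = a := by simp [hr₁, Prog.ev, Op.eval, h3, ha]
  have s19 : r₁ 19 = (a * a % N : ℕ) := by simp [hr₁, Prog.ev, Op.eval, h3, ha, h0]
  have h10 := ev_sqrtProg (n := 19) (by simp) s3 s22 s0 s19 (Nat.mod_lt _ hN).le
  have f : ∀ j, j ∉ [10, 11, 12, 13, 14] → (sqrtProg 19).ev r₁ j = r₁ j :=
    fun j hj => ev_sqrtProg_of_notMem hj r₁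
  have f0 := (f 0 (by simp)).trans s0
  have f2 := (f 2 (by simp)).trans s2
  have f3 := (f 3 (by simp)).trans s3
  have f18 := (f 18 (by simp)).trans s18
  have f19 := (f 19 (by simp)).trans s19
  rw [e]
  generalize (sqrtProg 19).ev r₁ = r₂ at *
  simp [Prog.ev, Op.eval, h10, f0, f3, f2, f18, f19]

theorem prepared_prepare (hN : 0 < N) (hr : Drawn N a r) : Prepared N a (prepare.ev r) := by
  obtain ⟨s0, s3, -, s18, s19, -⟩ := prepareRoot_regs hN hr
  rw [prepare_eq]
  generalize prepareRoot.ev r = r₁ at *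
  have f : ∀ j, j ∉ [4, 5, 7, 6, 8, 9, 2] → (gcdTest 21).ev ((gcdTest 18).ev r₁) j = r₁ j :=
    fun j hj => (ev_gcdTest_of_notMem hj _).trans (ev_gcdTest_of_notMem hj _)
  have f0 := (f 0 (by simp)).trans s0
  have f3 := (f 3 (by simp)).trans s3
  have f18 := (f 18 (by simp)).trans s18
  have f19 := (f 19 (by simp)).trans s19
  generalize (gcdTest 21).ev ((gcdTest 18).ev r₁) = r₂ at *
  refine ⟨?_, ?_, ?_, ?_⟩
  · simp [prepareArgs, Prog.ev, f0]
  · simp [prepareArgs, Prog.ev, f3]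
  · simp [prepareArgs, Prog.ev, f19]
  · funext i
    fin_cases i <;> simp [prepareArgs, Prog.ev, Op.eval, f0, f3, f18, f19, inputVec, stdCode]

theorem prepare_reg_two (r : ℕ → ℤ) :
    prepare.ev r 2 = (gcdTest 21).ev ((gcdTest 18).ev (prepareRoot.ev r)) 2 := by
  rw [prepare_eq]
  simp [prepareArgs, Prog.ev]

theorem prepare_preserves {Φ : ℤ → Prop} (hΦ : HoldsForDivisors N Φ) (hN : 0 < N)
    (hr : Drawn N a r) (h : Φ (r 2)) : Φ (prepare.ev r 2) := by
  obtain ⟨s0, s3, s2, -⟩ := prepareRoot_regs hN hr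
  rw [prepare_reg_two]
  refine gcdTest_preserves hΦ hN (by norm_num) ?_ ?_ (gcdTest_preserves hΦ hN (by norm_num) ?_ ?_ ?_)
  all_goals simp [ev_gcdTest_of_notMem, s0, s3, s2, h]

theorem prepare_finds {p q : ℕ} (hp : p.Prime) (hq : q.Prime) (hr : Drawn (p * q) a r)
    (h : Hit p q a ∨ Hit p q (a - Nat.sqrt (a * a % (p * q)))) :
    IsFactor p q (prepare.ev r 2) := by
  have hN : 0 < p * q := mul_pos hp.pos hq.pos
  obtain ⟨s0, s3, -, s18, -, s21⟩ := prepareRoot_regs hN hr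
  rw [prepare_reg_two]
  generalize prepareRoot.ev r = r₁ at *
  rcases h with h | h
  · refine gcdTest_preserves (holdsForDivisors_isFactor hp hq) hN (by norm_num) ?_ ?_
      (gcdTest_of_hit hp hq (by norm_num) s0 s3 (by rw [s18]; exact h))
    · rw [ev_gcdTest_of_notMem (by simp), s0]
    · rw [ev_gcdTest_of_notMem (by simp), s3]
  · refine gcdTest_of_hit hp hq (by norm_num) ?_ ?_ ?_
    · rw [ev_gcdTest_of_notMem (by simp), s0]
    · rw [ev_gcdTest_of_notMem (by simp), s3]
    · rw [ev_gcdTest_of_notMem (by simp), s21]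
      exact h

end prepare

section finish

/-- The part of `finish` that computes the norms. -/
def finishNorms : Prog :=
  .block [normProg 34 35 36 46, normProg 37 38 39 47,
    .op 52 .mul 34 39, .op 53 .mul 37 36, .op 52 .add 52 53,
    .op 54 .mul 35 39, .op 55 .mul 38 36, .op 54 .add 54 55, .op 56 .mul 36 39,
    normProg 52 54 56 48]

theorem finish_eq (r : ℕ → ℤ) : finish.ev r =
    (gcdTest 48).ev ((gcdTest 47).ev ((gcdTest 46).ev (finishNorms.ev r))) := rfl

theorem ev_normProg {x y z d : ℕ} (hx : 51 < x ∨ x < 50) (hy : 51 < y ∨ y < 50)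
    (hz : 51 < z ∨ z < 50) {r : ℕ → ℤ} {j : ℕ} (h50 : j ≠ 50) (h51 : j ≠ 51) :
    (normProg x y z d).ev r j =
      if j = d then quadNorm (r 19) (r x) (r y) (r z) else r j := by
  have n1 : x ≠ 50 := by omega
  have n2 : x ≠ 51 := by omega
  have n3 : y ≠ 50 := by omega
  have n4 : y ≠ 51 := by omega
  have n5 : z ≠ 50 := by omega
  have n6 : z ≠ 51 := by omega
  simp [normProg, Prog.ev, Op.eval, Function.update_apply, quadNorm, n3, n5, n6, h50, h51]

theorem finishNorms_regs {r : ℕ → ℤ} {ans : Fin 12 → ℤ}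
    (hans : ∀ i : Fin 12, r (34 + i) = ans i) :
    finishNorms.ev r 0 = r 0 ∧ finishNorms.ev r 3 = r 3 ∧ finishNorms.ev r 2 = r 2 ∧
    finishNorms.ev r 46 = codeNorms (r 19) ans 0 ∧ finishNorms.ev r 47 = codeNorms (r 19) ans 1 ∧
    finishNorms.ev r 48 = codeNorms (r 19) ans 2 := by
  have a0 : r 34 = ans 0 := hans 0
  have a1 : r 35 = ans 1 := hans 1
  have a2 : r 36 = ans 2 := hans 2
  have a3 : r 37 = ans 3 := hans 3
  have a4 : r 38 = ans 4 := hans 4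
  have a5 : r 39 = ans 5 := hans 5
  refine ⟨?_, ?_, ?_, ?_, ?_, ?_⟩ <;>
    simp [finishNorms, ev_normProg, Prog.ev, Op.eval, codeNorms, a0, a1, a2, a3, a4, a5]

variable {N : ℕ} {r : ℕ → ℤ}

theorem finish_preserves {Φ : ℤ → Prop} (hΦ : HoldsForDivisors N Φ) (hN : 0 < N)
    (h0 : r 0 = N) (h3 : r 3 = 1) (h : Φ (r 2)) : Φ (finish.ev r 2) := by
  obtain ⟨s0, s3, s2, -⟩ := finishNorms_regs (r := r) (fun _ => rfl)
  rw [h0] at s0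
  rw [h3] at s3
  rw [finish_eq]
  refine gcdTest_preserves hΦ hN (by norm_num) ?_ ?_ (gcdTest_preserves hΦ hN (by norm_num) ?_ ?_
    (gcdTest_preserves hΦ hN (by norm_num) ?_ ?_ ?_))
  all_goals simp [ev_gcdTest_of_notMem, s0, s3, s2, h]

theorem finish_finds {p q : ℕ} (hp : p.Prime) (hq : q.Prime) (h0 : r 0 = (p * q : ℕ))
    (h3 : r 3 = 1) {ans : Fin 12 → ℤ} (hans : ∀ i : Fin 12, r (34 + i) = ans i)
    (h : ∃ i, Hit p q (codeNorms (r 19) ans i)) : IsFactor p q (finish.ev r 2) := by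
  obtain ⟨s0, s3, -, s46, s47, s48⟩ := finishNorms_regs hans
  rw [h0] at s0
  rw [h3] at s3
  rw [finish_eq]
  have hN : 0 < p * q := mul_pos hp.pos hq.pos
  have hΦ := holdsForDivisors_isFactor hp hq
  generalize finishNorms.ev r = r₁ at *
  have f : ∀ (v j : ℕ) (r : ℕ → ℤ), j ∉ [4, 5, 7, 6, 8, 9, 2] → (gcdTest v).ev r j = r j :=
    fun v j r hj => ev_gcdTest_of_notMem hj r
  obtain ⟨i, hi⟩ := h
  fin_cases i
  · refine gcdTest_preserves hΦ hN (by norm_num) ?_ ?_ (gcdTest_preserves hΦ hN (by norm_num) ?_ ?_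
      (gcdTest_of_hit hp hq (by norm_num) s0 s3 (by rw [s46]; exact hi)))
    all_goals simp only [f _ 0 _ (by simp), f _ 3 _ (by simp), s0, s3]
  · refine gcdTest_preserves hΦ hN (by norm_num) ?_ ?_
      (gcdTest_of_hit hp hq (by norm_num) ?_ ?_ (by rw [f _ 47 _ (by simp), s47]; exact hi))
    all_goals simp only [f _ 0 _ (by simp), f _ 3 _ (by simp), s0, s3]
  · refine gcdTest_of_hit hp hq (by norm_num) ?_ ?_
      (by rw [f _ 48 _ (by simp), f _ 48 _ (by simp), s48]; exact hi)
    all_goals simp only [f _ 0 _ (by simp), f _ 3 _ (by simp), s0, s3]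

end finish

/-! ### Determinism, cost and written registers of the parts -/

theorem det_block_const (l : List ℕ) : (Prog.block (l.map fun d => Prog.const d 0)).Det :=
  det_block (by simp [Prog.Det])

theorem det_clearRegs : clearRegs.Det := det_block_const _

theorem det_setup : setup.Det := by
  refine det_block ?_
  simp [det_gcdTest, det_sqrtProg, Prog.Det]

theorem det_prepare : prepare.Det := by
  refine det_block ?_
  simp [det_gcdTest, det_sqrtProg, Prog.Det]

theorem det_normProg (x y z d : ℕ) : (normProg x y z d).Det := by
  refine det_block ?_
  simp [Prog.Det]

theorem det_finish : finish.Det := by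
  refine det_block ?_
  simp [det_gcdTest, det_normProg, Prog.Det]

theorem det_output : output.Det := by simp [output, Prog.block, Prog.Det]

theorem poly_setup : setup.Poly 3 := by
  refine poly_block ?_
  simp [poly_gcdTest, poly_sqrtProg, poly_const, poly_op]

theorem poly_prepare : prepare.Poly 3 := by
  refine poly_block ?_
  simp [poly_gcdTest, poly_sqrtProg, poly_const, poly_op]

theorem poly_normProg (x y z d : ℕ) : (normProg x y z d).Poly 3 := by
  refine poly_block ?_
  simp [poly_op]

theorem poly_finish : finish.Poly 3 := by
  refine poly_block ?_
  simp [poly_gcdTest, poly_normProg, poly_op]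

/-- This keeps N in register 0 and zeros from register 60 on, as `Inv` demands. -/
theorem writes_lt : (∀ j ∈ setup.writes, j ≠ 0 ∧ j < 60) ∧ (∀ j ∈ prepare.writes, j ≠ 0 ∧ j < 60) ∧
    ∀ j ∈ finish.writes, j ≠ 0 ∧ j < 60 := by
  refine ⟨?_, ?_, ?_⟩ <;> decide

theorem cost_clearRegs (r : ℕ → ℤ) : clearRegs.cost r = 58 := by
  rw [clearRegs, cost_block_const_zero]
  rfl

theorem ev_clearRegs (r : ℕ → ℤ) (j : ℕ) :
    clearRegs.ev r j = if j = 0 ∨ j = 2 ∨ 60 ≤ j then r j else 0 := by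
  rw [clearRegs, ev_block_const_zero]
  simp only [List.mem_cons, List.mem_range'_1]
  split_ifs <;> first | rfl | omega

attribute [irreducible] clearRegs setup prepare finish

/-! ### Invariants and running time of a trial -/

/-- The state at the start of a trial. -/
structure Inv (N : ℕ) (s : State) : Prop where
  reg_zero : s.reg 0 = N
  nonneg : 0 ≤ s.reg 2
  le : s.reg 2 ≤ N
  unused : ∀ j, 60 ≤ j → s.reg j = 0

/-- The state after `setup`. -/
def afterSetup (s : State) : State := (Prog.seq clearRegs setup).step s

/-- The state after `prepare`, for the random number `u`. -/
def afterPrepare (s : State) (u : ℤ) : State :=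
  prepare.step ((afterSetup s).write 18 u (1 + bits ((afterSetup s).reg 17)))

/-- The state at the end of a trial, for the random number `u` and the answer `ans`. -/
def afterTrial (s : State) (u : ℤ) (ans : Fin 12 → ℤ) : State :=
  finish.step ((afterPrepare s u).receive 26 34 ans)

theorem afterSetup_reg (s : State) : (afterSetup s).reg = setup.ev (clearRegs.ev s.reg) := rfl

theorem afterPrepare_reg (s : State) (u : ℤ) :
    (afterPrepare s u).reg = prepare.ev (Function.update (afterSetup s).reg 18 u) := rfl

theorem afterTrial_reg (s : State) (u : ℤ) (ans : Fin 12 → ℤ) :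
    (afterTrial s u ans).reg = finish.ev ((afterPrepare s u).receive 26 34 ans).reg := rfl

/-- The only randomness of a trial is in the number drawn and in the answer; the final state is a
function of the two. -/
theorem run_trial (A : IdealFactorer) (s : State) :
    trial.run A s = (uniformBelow ((afterSetup s).reg 17)).bind fun u =>
      (A ((afterPrepare s u).args 26)).map fun ans => afterTrial s u ans := by
  have hd : (Prog.seq clearRegs setup).Det := ⟨det_clearRegs, det_setup⟩
  rw [trial, Prog.run, run_det A hd, PMF.pure_bind, Prog.run, Prog.run, PMF.bind_map]
  congr 1
  funext u
  rw [Function.comp_apply, Prog.run, run_det A det_prepare, PMF.pure_bind, Prog.run, Prog.run,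
    PMF.bind_map, ← PMF.bind_pure_comp]
  congr 1
  funext ans
  rw [Function.comp_apply, run_det A det_finish]
  rfl

theorem mem_support_trial {A : IdealFactorer} {s t : State} (ht : t ∈ (trial.run A s).support) :
    ∃ u ∈ (uniformBelow ((afterSetup s).reg 17)).support, ∃ ans, t = afterTrial s u ans := by
  rw [run_trial, PMF.mem_support_bind_iff] at ht
  obtain ⟨u, hu, ht⟩ := ht
  rw [PMF.mem_support_map_iff] at ht
  obtain ⟨ans, -, rfl⟩ := ht
  exact ⟨u, hu, ans, rfl⟩

theorem mem_support_uniformBelow {v u : ℤ} (hu : u ∈ (uniformBelow v).support) :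
    0 ≤ u ∧ u.natAbs ≤ v.natAbs := by
  rw [uniformBelow] at hu
  split_ifs at hu with h
  · rw [PMF.mem_support_uniformOfFinset_iff, Finset.mem_Ico] at hu
    omega
  · rw [PMF.mem_support_pure_iff] at hu
    subst hu
    simp

/-- Clearing removes what is left of earlier answers and of k, so every trial starts with registers
no longer than N. Hence the total time is linear in the number of trials. -/
theorem bounded_clearRegs {N : ℕ} {s : State} (hs : Inv N s) :
    Bounded (Nat.size N) (clearRegs.ev s.reg) := by
  intro j
  rw [ev_clearRegs]
  split_ifs with h
  · rcases h with rfl | rfl | h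
    · rw [hs.reg_zero]
      exact le_rfl
    · refine Nat.size_le_size ?_
      have := hs.nonneg
      have := hs.le
      omega
    · simp [hs.unused j h, bits]
  · simp [bits]

/-- The sample that belongs to the random number `u`. -/
def sampleOf (N : ℕ) (u : ℤ) : ℕ := u.toNat + Nat.sqrt N + 1

theorem clearRegs_reg_zero {N : ℕ} {s : State} (hs : Inv N s) : clearRegs.ev s.reg 0 = N := by
  rw [ev_clearRegs, if_pos (by simp), hs.reg_zero]

theorem clearRegs_reg_two (s : State) : clearRegs.ev s.reg 2 = s.reg 2 := by
  rw [ev_clearRegs, if_pos (by simp)]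

theorem drawn {N : ℕ} {s : State} (hs : Inv N s) {u : ℤ} (hu : 0 ≤ u) :
    Drawn N (sampleOf N u) (Function.update (afterSetup s).reg 18 u) := by
  obtain ⟨h0, h3, h22, h16, -⟩ := setup_regs (clearRegs_reg_zero hs)
  rw [← afterSetup_reg] at h0 h3 h22 h16
  refine ⟨by simp [h0], by simp [h3], by simp [h22], ?_⟩
  simp [h16, sampleOf, hu]

theorem prepared {N : ℕ} (hN : 0 < N) {s : State} (hs : Inv N s) {u : ℤ} (hu : 0 ≤ u) :
    Prepared N (sampleOf N u) (afterPrepare s u).reg := by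
  rw [afterPrepare_reg]
  exact prepared_prepare hN (drawn hs hu)

theorem receive_reg_of_lt (s : State) (ans : Fin 12 → ℤ) {j : ℕ} (hj : j < 34) :
    (s.receive 26 34 ans).reg j = s.reg j := by
  simp [State.receive, Nat.not_le.mpr hj]

theorem receive_reg_answer (s : State) (ans : Fin 12 → ℤ) (i : Fin 12) :
    (s.receive 26 34 ans).reg (34 + i) = ans i := by
  have h : 34 ≤ 34 + (i : ℕ) ∧ 34 + (i : ℕ) < 34 + 12 := by omega
  simp only [State.receive, dif_pos h]
  congr 1
  exact Fin.ext (by simp)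

theorem trial_preserves {N : ℕ} (hN : 0 < N) {Φ : ℤ → Prop} (hΦ : HoldsForDivisors N Φ)
    {s : State} (hs : Inv N s) (h : Φ (s.reg 2)) {u : ℤ} (hu : 0 ≤ u) (ans : Fin 12 → ℤ) :
    Φ ((afterTrial s u ans).reg 2) := by
  have hp := prepared hN hs hu
  have h1 : Φ ((afterSetup s).reg 2) :=
    afterSetup_reg s ▸ setup_preserves hΦ hN (clearRegs_reg_zero hs) (by rwa [clearRegs_reg_two])
  have h2 : Φ ((afterPrepare s u).reg 2) := by
    rw [afterPrepare_reg]
    refine prepare_preserves hΦ hN (drawn hs hu) ?_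
    rwa [Function.update_of_ne (by norm_num)]
  rw [afterTrial_reg]
  refine finish_preserves hΦ hN ?_ ?_ ?_
  · rw [receive_reg_of_lt _ _ (by norm_num), hp.reg_zero]
  · rw [receive_reg_of_lt _ _ (by norm_num), hp.reg_three]
  · rwa [receive_reg_of_lt _ _ (by norm_num)]

theorem inv_afterTrial {N : ℕ} (hN : 0 < N) {s : State} (hs : Inv N s) {u : ℤ} (hu : 0 ≤ u)
    (ans : Fin 12 → ℤ) : Inv N (afterTrial s u ans) := by
  have hΦ : HoldsForDivisors N fun v => 0 ≤ v ∧ v ≤ N := by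
    intro g _ h2 _
    constructor <;> omega
  obtain ⟨h1, h2⟩ := trial_preserves hN hΦ hs ⟨hs.nonneg, hs.le⟩ hu ans
  refine ⟨?_, h1, h2, fun j hj => ?_⟩
  · have e : finish.ev ((afterPrepare s u).receive 26 34 ans).reg 0 =
        ((afterPrepare s u).receive 26 34 ans).reg 0 :=
      ev_of_notMem_writes _ (fun h => (writes_lt.2.2 0 h).1 rfl) _
    rw [afterTrial_reg, e, receive_reg_of_lt _ _ (by norm_num), (prepared hN hs hu).reg_zero]
  · have e1 : finish.ev ((afterPrepare s u).receive 26 34 ans).reg j =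
        ((afterPrepare s u).receive 26 34 ans).reg j :=
      ev_of_notMem_writes _ (fun h => by have := (writes_lt.2.2 j h).2; omega) _
    have e2 : ((afterPrepare s u).receive 26 34 ans).reg j = (afterPrepare s u).reg j := by
      have : ¬ (34 ≤ j ∧ j < 34 + 12) := by omega
      simp only [State.receive, dif_neg this]
    have e3 : prepare.ev (Function.update (afterSetup s).reg 18 u) j =
        Function.update (afterSetup s).reg 18 u j :=
      ev_of_notMem_writes _ (fun h => by have := (writes_lt.2.1 j h).2; omega) _
    have e4 : setup.ev (clearRegs.ev s.reg) j = clearRegs.ev s.reg j :=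
      ev_of_notMem_writes _ (fun h => by have := (writes_lt.1 j h).2; omega) _
    rw [afterTrial_reg, e1, e2, afterPrepare_reg, e3, Function.update_of_ne (by omega),
      afterSetup_reg, e4, ev_clearRegs, if_pos (by omega),
      hs.unused j hj]

/-- A trial makes one call, and its cost is polynomial in the length of `N` and of the answer. -/
theorem exists_trial_bound : ∃ K : ℕ, ∀ (A : IdealFactorer) (N : ℕ), 0 < N → ∀ s t : State,
    Inv N s → t ∈ (trial.run A s).support →
      Inv N t ∧ t.queries = s.queries + 1 ∧ s.maxAnswer ≤ t.maxAnswer ∧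
      t.time ≤ s.time + K * (1 + Nat.size N + t.maxAnswer) ^ 3 := by
  obtain ⟨K₁, h₁⟩ := poly_setup
  obtain ⟨K₂, h₂⟩ := poly_prepare
  obtain ⟨K₃, h₃⟩ := poly_finish
  -- With W = 1 + ℓ(N) + m, the register lengths plus 1 are at most c₁W before `prepare` and c₂W
  -- before `finish`.
  set c₁ := K₁ + 1 with hc₁
  set c₂ := K₂ * c₁ + 1 with hc₂
  -- In this order: clearing 58 registers, `setup`, the random choice, `prepare`, the call with
  -- eight numbers in the question and twelve in the answer, and `finish`.
  refine ⟨58 + K₁ + c₁ + K₂ * c₁ ^ 3 + (13 + 8 * c₂) + K₃ * c₂ ^ 3, ?_⟩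
  intro A N hN s t hs ht
  obtain ⟨u, hu, ans, rfl⟩ := mem_support_trial ht
  obtain ⟨hu0, huabs⟩ := mem_support_uniformBelow hu
  set m := (afterTrial s u ans).maxAnswer with hm
  have hm' : m = max s.maxAnswer (Finset.univ.sup fun i => bits (ans i)) := rfl
  refine ⟨inv_afterTrial hN hs hu0 ans, rfl, hm' ▸ le_max_left _ _, ?_⟩
  have hans : ∀ i, bits (ans i) ≤ m := fun i =>
    (Finset.le_sup (f := fun i => bits (ans i)) (Finset.mem_univ i)).trans (hm' ▸ le_max_right _ _)
  set n := Nat.size N with hn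
  set W := 1 + n + m with hW
  obtain ⟨b₁, t₁⟩ := h₁ n _ (bounded_clearRegs hs)
  rw [← afterSetup_reg] at b₁
  have b₁' : Bounded (K₁ * (n + 1)) (Function.update (afterSetup s).reg 18 u) :=
    b₁.update 18 ((bits_mono huabs).trans (b₁ 17))
  obtain ⟨b₂, t₂⟩ := h₂ _ _ b₁'
  have b₂' : Bounded (K₂ * (K₁ * (n + 1) + 1)) (afterPrepare s u).reg := b₂
  have b₃ : Bounded (K₂ * (K₁ * (n + 1) + 1) + m) ((afterPrepare s u).receive 26 34 ans).reg := by
    intro j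
    simp only [State.receive]
    split_ifs
    · exact (hans _).trans (Nat.le_add_left _ _)
    · exact (b₂' j).trans (Nat.le_add_right _ _)
  have t₃ := (h₃ _ _ b₃).2
  have htime : (afterTrial s u ans).time = s.time + (clearRegs.cost s.reg +
      setup.cost (clearRegs.ev s.reg)) + (1 + bits ((afterSetup s).reg 17)) +
      prepare.cost (Function.update (afterSetup s).reg 18 u) +
      (1 + ∑ i, bits ((afterPrepare s u).args 26 i) + ∑ i, bits (ans i)) +
      finish.cost ((afterPrepare s u).receive 26 34 ans).reg := rfl
  have w₁ : K₁ * (n + 1) + 1 ≤ c₁ * W := by rw [hc₁]; nlinarith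
  have w₂ : K₂ * (K₁ * (n + 1) + 1) + m + 1 ≤ c₂ * W := by
    have := Nat.mul_le_mul_left K₂ w₁
    rw [hc₂, add_mul, one_mul, mul_assoc]
    omega
  have hW1 : 1 ≤ W := by omega
  have hWp : W ≤ W ^ 3 := Nat.le_self_pow (by norm_num) _
  have s₁ : setup.cost (clearRegs.ev s.reg) ≤ K₁ * W ^ 3 :=
    t₁.trans (Nat.mul_le_mul_left _ (Nat.pow_le_pow_left (by omega) 3))
  have s₂ : 1 + bits ((afterSetup s).reg 17) ≤ c₁ * W ^ 3 := by
    have := b₁ 17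
    exact (by omega : _ ≤ c₁ * W).trans (Nat.mul_le_mul_left _ hWp)
  have s₃ : prepare.cost (Function.update (afterSetup s).reg 18 u) ≤ K₂ * c₁ ^ 3 * W ^ 3 := by
    refine t₂.trans ?_
    rw [mul_assoc, ← mul_pow]
    exact Nat.mul_le_mul_left _ (Nat.pow_le_pow_left w₁ 3)
  have s₄ : 1 + ∑ i, bits ((afterPrepare s u).args 26 i) + ∑ i, bits (ans i) ≤
      (13 + 8 * c₂) * W ^ 3 := by
    have e1 : ∑ i, bits ((afterPrepare s u).args 26 i) ≤ 8 * (c₂ * W) := by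
      have : ∑ i, bits ((afterPrepare s u).args 26 i) ≤ ∑ _i : Fin 8, c₂ * W :=
        Finset.sum_le_sum fun i _ => (b₂' _).trans (by omega)
      simpa using this
    have e2 : ∑ i, bits (ans i) ≤ 12 * W := by
      have : ∑ i, bits (ans i) ≤ ∑ _i : Fin 12, W :=
        Finset.sum_le_sum fun i _ => (hans _).trans (by omega)
      simpa using this
    calc _ ≤ (13 + 8 * c₂) * W := by nlinarith
      _ ≤ _ := Nat.mul_le_mul_left _ hWp
  have s₅ : finish.cost ((afterPrepare s u).receive 26 34 ans).reg ≤ K₃ * c₂ ^ 3 * W ^ 3 := by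
    refine t₃.trans ?_
    rw [mul_assoc, ← mul_pow]
    exact Nat.mul_le_mul_left _ (Nat.pow_le_pow_left w₂ 3)
  have s₀ : 58 ≤ 58 * W ^ 3 := by omega
  rw [htime, cost_clearRegs]
  simp only [add_mul] at s₄ ⊢
  omega

theorem inv_tick {N : ℕ} {s : State} (hs : Inv N s) (n : ℕ) : Inv N (s.tick n) :=
  ⟨hs.reg_zero, hs.nonneg, hs.le, hs.unused⟩

theorem iterate_trial_bound {K : ℕ} {A : IdealFactorer} {N : ℕ}
    (hK : ∀ s t : State, Inv N s → t ∈ (trial.run A s).support →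
      Inv N t ∧ t.queries = s.queries + 1 ∧ s.maxAnswer ≤ t.maxAnswer ∧
      t.time ≤ s.time + K * (1 + Nat.size N + t.maxAnswer) ^ 3) (n : ℕ) {s t : State}
    (hs : Inv N s) (ht : t ∈ (iterate (fun s => trial.run A (s.tick 1)) n s).support) :
    Inv N t ∧ t.queries = s.queries + n ∧ s.maxAnswer ≤ t.maxAnswer ∧
      t.time ≤ s.time + n * (1 + K * (1 + Nat.size N + t.maxAnswer) ^ 3) := by
  induction n generalizing s with
  | zero =>
    rw [iterate, PMF.mem_support_pure_iff] at ht
    subst ht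
    simpa using hs
  | succ n ih =>
    rw [iterate, PMF.mem_support_bind_iff] at ht
    obtain ⟨s', hs', ht⟩ := ht
    obtain ⟨i, q, m, w⟩ := hK _ _ (inv_tick hs 1) hs'
    obtain ⟨i', q', m', w'⟩ := ih i ht
    refine ⟨i', ?_, m.trans m', ?_⟩
    · rw [q', q]
      simp only [State.tick]
      ring
    · have h1 : K * (1 + Nat.size N + s'.maxAnswer) ^ 3 ≤ K * (1 + Nat.size N + t.maxAnswer) ^ 3 :=
        Nat.mul_le_mul_left _ (Nat.pow_le_pow_left (by omega) 3)
      simp only [State.tick] at w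
      rw [add_mul, one_mul]
      omega

theorem inv_initState (N k : ℕ) : Inv N (initState N k) := by
  refine ⟨rfl, le_rfl, by simp [initState], fun j hj => ?_⟩
  have h0 : j ≠ 0 := by omega
  have h1 : j ≠ 1 := by omega
  simp [initState, h0, h1]

theorem run_mainProg (A : IdealFactorer) {N k : ℕ} (hN : 0 < N) :
    mainProg.result A N k = (iterate (fun s => trial.run A (s.tick 1)) k
      ((initState N k).tick 1 |>.tick (1 + Nat.size k))).map output.step := by
  have h0 : (initState N k).reg 0 = N := rfl
  have h1 : ((initState N k).tick 1).reg 1 = k := rfl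
  have hpos : 0 < (initState N k).reg 0 := by rw [h0]; exact_mod_cast hN
  rw [Prog.result, mainProg, Prog.run, Prog.run, if_pos hpos, Prog.run, h1, Int.toNat_natCast,
    bits_natCast, ← PMF.bind_pure_comp]
  congr 1
  funext s
  exact run_det A det_output s

theorem exists_time_bound : ∃ C : ℕ, ∀ (A : IdealFactorer) (N k : ℕ),
    ∀ s ∈ (mainProg.result A N k).support, s.queries ≤ k ∧
      s.time ≤ C * (k + 1) * (1 + Nat.size N + s.maxAnswer) ^ C := by
  obtain ⟨K, hK⟩ := exists_trial_bound
  refine ⟨K + 1000, fun A N k s hs => ?_⟩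
  have hpow : ∀ W : ℕ, 1 ≤ W → W ^ 3 ≤ W ^ (K + 1000) := fun W hW =>
    Nat.pow_le_pow_right hW (by omega)
  rcases Nat.eq_zero_or_pos N with rfl | hN
  -- The analysis of a trial needs N > 0. For N = 0 the program makes no trial, and its cost 2 comes
  -- from the two sign tests.
  · have e : mainProg.result A 0 k = PMF.pure (output.step ((initState 0 k).tick 1)) := by
      have h0 : ¬ 0 < (initState 0 k).reg 0 := by simp [initState]
      rw [Prog.result, mainProg, Prog.run, Prog.run, if_neg h0, Prog.run, PMF.pure_bind,
        run_det A det_output]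
    rw [e, PMF.mem_support_pure_iff] at hs
    subst hs
    have h2 : ((initState 0 k).tick 1).reg 2 = 0 := rfl
    have ht : (output.step ((initState 0 k).tick 1)).time = 2 := by
      simp only [Prog.step, output, Prog.cost, h2]
      rfl
    refine ⟨Nat.zero_le _, ?_⟩
    rw [ht]
    have h1 := Nat.one_le_pow (K + 1000)
      (1 + Nat.size 0 + (output.step ((initState 0 k).tick 1)).maxAnswer) (by omega)
    calc 2 ≤ (K + 1000) * (k + 1) * 1 := by nlinarith
      _ ≤ _ := Nat.mul_le_mul_left _ h1
  · rw [run_mainProg A hN, PMF.mem_support_map_iff] at hs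
    obtain ⟨t, ht, rfl⟩ := hs
    obtain ⟨i, q, -, w⟩ := iterate_trial_bound (hK A N hN) k
      (inv_tick (inv_tick (inv_initState N k) 1) _) ht
    constructor
    · change t.queries ≤ k
      rw [q]
      simp [initState, State.tick]
    · change t.time + output.cost t.reg ≤ _ * (1 + Nat.size N + t.maxAnswer) ^ _
      set W := 1 + Nat.size N + t.maxAnswer with hW
      have hcost : output.cost t.reg ≤ 100 * W ^ 3 := by
        have b0 : bits (t.reg 0) ≤ W := by rw [i.reg_zero, bits_natCast]; omega
        have b2 : bits (t.reg 2) ≤ W := by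
          have h1 := i.nonneg
          have h2 := i.le
          have : bits (t.reg 2) ≤ bits (N : ℤ) := bits_mono (by omega)
          rw [bits_natCast] at this
          omega
        have hW1 : 1 ≤ W := by omega
        have p2 : W ^ 2 ≤ W ^ 3 := Nat.pow_le_pow_right hW1 (by norm_num)
        have p1 : 1 ≤ W ^ 3 := Nat.one_le_pow _ _ hW1
        rw [output, Prog.cost]
        split_ifs
        · have e : (Prog.block [.const 3 1, .op 1 .div 0 2, .op 0 .div 2 3]).cost t.reg =
              2 + (1 + bits (t.reg 0) + bits (t.reg 2)) ^ 2 + (1 + bits (t.reg 2) + 1) ^ 2 := by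
            simp [Prog.block, Prog.cost, Prog.ev, bits]
            ring
          have e1 : (1 + bits (t.reg 0) + bits (t.reg 2)) ^ 2 ≤ (3 * W) ^ 2 :=
            Nat.pow_le_pow_left (by omega) 2
          have e2 : (1 + bits (t.reg 2) + 1) ^ 2 ≤ (3 * W) ^ 2 :=
            Nat.pow_le_pow_left (by omega) 2
          rw [e]
          rw [mul_pow] at e1 e2
          omega
        · simp only [Prog.cost]
          omega
      have hstart : ((initState N k).tick 1 |>.tick (1 + Nat.size k)).time = 2 + Nat.size k := by
        simp [initState, State.tick]
        ring
      have hk := size_le_self k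
      have hW1 : 1 ≤ W ^ 3 := Nat.one_le_pow _ _ (by omega)
      rw [hstart] at w
      have h1 : k * (1 + K * W ^ 3) ≤ k * ((K + 1) * W ^ 3) := Nat.mul_le_mul_left _ (by
        rw [add_mul]; omega)
      have h2 : k ≤ k * W ^ 3 := Nat.le_mul_of_pos_right _ hW1
      calc t.time + output.cost t.reg ≤
            (2 + k) + k * ((K + 1) * W ^ 3) + 100 * W ^ 3 := by omega
        _ ≤ (K + 1000) * (k + 1) * W ^ 3 := by
            have e1 : (K + 1000) * (k + 1) * W ^ 3 = k * ((K + 1) * W ^ 3) + 999 * (k * W ^ 3) +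
              K * W ^ 3 + 1000 * W ^ 3 := by ring
            rw [e1]
            omega
        _ ≤ _ := Nat.mul_le_mul_left _ (hpow W (by omega))

/-! ### Success probability -/

theorem toOuterMeasure_compl {α : Type*} (μ : PMF α) (s : Set α) :
    μ.toOuterMeasure s + μ.toOuterMeasure sᶜ = 1 := by
  rw [PMF.toOuterMeasure_apply, PMF.toOuterMeasure_apply, ← ENNReal.tsum_add, ← μ.tsum_coe]
  exact tsum_congr fun a => congrFun (Set.indicator_self_add_compl s μ) a

theorem toOuterMeasure_eq_zero {α : Type*} {μ : PMF α} {s : Set α}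
    (h : ∀ a ∈ μ.support, a ∉ s) : μ.toOuterMeasure s = 0 :=
  (PMF.toOuterMeasure_apply_eq_zero_iff μ s).mpr (Set.disjoint_left.mpr h)

/-- If every trial from a state with property `I` fails with probability at most `c`, and success is
permanent, then `n` trials fail with probability at most `c ^ n`. -/
theorem iterate_fail_le {σ : Type} {f : σ → PMF σ} {I : σ → Prop} {bad : Set σ} {c : ENNReal}
    (hI : ∀ s, I s → ∀ t ∈ (f s).support, I t)
    (hmono : ∀ s, I s → s ∉ bad → ∀ t ∈ (f s).support, t ∉ bad)
    (hc : ∀ s, I s → (f s).toOuterMeasure bad ≤ c) (n : ℕ) {s : σ} (hs : I s) :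
    (iterate f n s).toOuterMeasure bad ≤ c ^ n ∧
      (s ∉ bad → (iterate f n s).toOuterMeasure bad = 0) := by
  induction n generalizing s with
  | zero =>
    refine ⟨by simpa using toOuterMeasure_le_one _ _, fun h => ?_⟩
    rw [iterate, PMF.toOuterMeasure_pure_apply, if_neg h]
  | succ n ih =>
    rw [iterate, PMF.toOuterMeasure_bind_apply]
    constructor
    -- By the state after the first trial: a successful one contributes 0, a failed one at most c ^
    -- n times its probability.
    · calc ∑' t, f s t * (iterate f n t).toOuterMeasure bad
          ≤ ∑' t, bad.indicator (f s) t * c ^ n := by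
            refine ENNReal.tsum_le_tsum fun t => ?_
            by_cases ht : t ∈ (f s).support
            · by_cases hb : t ∈ bad
              · rw [Set.indicator_of_mem hb]
                exact mul_le_mul_right (ih (hI s hs t ht)).1 _
              · rw [(ih (hI s hs t ht)).2 hb, mul_zero]
                exact zero_le
            · rw [(PMF.apply_eq_zero_iff _ _).mpr ht, zero_mul]
              exact zero_le
        _ = (f s).toOuterMeasure bad * c ^ n := by
            rw [ENNReal.tsum_mul_right, PMF.toOuterMeasure_apply]
        _ ≤ c * c ^ n := mul_le_mul_left (hc s hs) _
        _ = c ^ (n + 1) := (pow_succ' c n).symm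
    · intro hb
      refine ENNReal.tsum_eq_zero.mpr fun t => ?_
      by_cases ht : t ∈ (f s).support
      · rw [(ih (hI s hs t ht)).2 (hmono s hs hb t ht), mul_zero]
      · rw [(PMF.apply_eq_zero_iff _ _).mpr ht, zero_mul]

/-! ### Cases in which a trial certainly succeeds -/

theorem hit_of_not_coprime {p q a : ℕ} (hp : p.Prime) (hq : q.Prime) (hpq : p ≠ q) (ha : 0 < a)
    (haN : a < p * q) (h : ¬ Nat.Coprime a (p * q)) : Hit p q a := by
  simp only [Hit, Int.natCast_dvd_natCast]
  have hboth : ¬ (p ∣ a ∧ q ∣ a) := fun h2 => by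
    have := Nat.le_of_dvd ha
      (((Nat.coprime_primes hp hq).mpr hpq).mul_dvd_of_dvd_of_dvd h2.1 h2.2)
    omega
  have hone : p ∣ a ∨ q ∣ a := by
    by_contra hno
    push Not at hno
    exact h (Nat.Coprime.mul_right ((Nat.Prime.coprime_iff_not_dvd hp).mpr hno.1).symm
      ((Nat.Prime.coprime_iff_not_dvd hq).mpr hno.2).symm)
  tauto

/-- For b² = a² mod pq the trimmed interval places a - b and a + b strictly between 0 and pq. So
neither is divisible by both primes, while each prime divides one of them. -/
theorem hit_of_isSquare {p q a : ℕ} (hp : p.Prime) (hq : q.Prime) (hpq : p ≠ q)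
    (ha : a ∈ samples (p * q)) (h : IsSquare (a * a % (p * q))) :
    Hit p q (a - Nat.sqrt (a * a % (p * q))) := by
  rw [samples, Finset.mem_Ioo] at ha
  have hN : 0 < p * q := mul_pos hp.pos hq.pos
  set b := Nat.sqrt (a * a % (p * q)) with hb
  have hbb : b * b = a * a % (p * q) := by
    obtain ⟨c, hc⟩ := h
    rw [hb, hc, Nat.sqrt_eq]
  have hbs : b ≤ Nat.sqrt (p * q) := Nat.sqrt_le_sqrt (Nat.mod_lt _ hN).le
  have hdvd : ((p * q : ℕ) : ℤ) ∣ ((a : ℤ) - b) * (a + b) := by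
    have : ((p * q : ℕ) : ℤ) ∣ ((a * a : ℕ) : ℤ) - ((a * a % (p * q) : ℕ) : ℤ) := by
      push_cast
      exact Int.dvd_self_sub_emod
    rw [← hbb] at this
    convert this using 1
    push_cast
    ring
  have hcop : IsCoprime (p : ℤ) (q : ℤ) :=
    Nat.isCoprime_iff_coprime.mpr ((Nat.coprime_primes hp hq).mpr hpq)
  have hsmall : ∀ x : ℤ, 0 < x → x < (p * q : ℕ) → ¬ ((p : ℤ) ∣ x ∧ (q : ℤ) ∣ x) := by
    intro x hx hxN hx2
    have := Int.le_of_dvd hx (hcop.mul_dvd hx2.1 hx2.2)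
    push_cast at hxN
    omega
  have h1 := hsmall (a - b) (by omega) (by omega)
  have h2 := hsmall (a + b) (by omega) (by omega)
  push_cast at hdvd
  have h3 := (Nat.prime_iff_prime_int.mp hp).dvd_or_dvd ((dvd_mul_right _ _).trans hdvd)
  have h4 := (Nat.prime_iff_prime_int.mp hq).dvd_or_dvd ((dvd_mul_left _ _).trans hdvd)
  rw [Hit]
  tauto

/-- The states in which no factor has been found. -/
def failed (p q : ℕ) : Set State := {s | ¬ IsFactor p q (s.reg 2)}

theorem finish_hit {p q : ℕ} (hp : p.Prime) (hq : q.Prime) {s : State} (hs : Inv (p * q) s) {u : ℤ}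
    (hu : 0 ≤ u) {ans : Fin 12 → ℤ}
    (h : ∃ i, Hit p q (codeNorms
      ((sampleOf (p * q) u * sampleOf (p * q) u % (p * q) : ℕ) : ℤ) ans i)) :
    afterTrial s u ans ∉ failed p q := by
  have hpr := prepared (mul_pos hp.pos hq.pos) hs hu
  have h19 := hpr.reg_radicand
  rw [failed, Set.mem_ofPred_eq, not_not, afterTrial_reg]
  refine finish_finds hp hq ?_ ?_ (receive_reg_answer _ ans) ?_
  · rw [receive_reg_of_lt _ _ (by norm_num), hpr.reg_zero]
  · rw [receive_reg_of_lt _ _ (by norm_num), hpr.reg_three]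
  · rwa [receive_reg_of_lt _ _ (by norm_num), h19]

theorem prepare_hit {p q : ℕ} (hp : p.Prime) (hq : q.Prime) {s : State} (hs : Inv (p * q) s) {u : ℤ}
    (hu : 0 ≤ u) (ans : Fin 12 → ℤ)
    (h : IsFactor p q ((afterPrepare s u).reg 2)) : afterTrial s u ans ∉ failed p q := by
  have hpr := prepared (mul_pos hp.pos hq.pos) hs hu
  rw [failed, Set.mem_ofPred_eq, not_not, afterTrial_reg]
  refine finish_preserves (holdsForDivisors_isFactor hp hq) (mul_pos hp.pos hq.pos) ?_ ?_ ?_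
  · rw [receive_reg_of_lt _ _ (by norm_num), hpr.reg_zero]
  · rw [receive_reg_of_lt _ _ (by norm_num), hpr.reg_three]
  · rwa [receive_reg_of_lt _ _ (by norm_num)]

theorem setup_hit {p q : ℕ} (hp : p.Prime) (hq : q.Prime) {s : State} (hs : Inv (p * q) s) {u : ℤ}
    (hu : 0 ≤ u) (ans : Fin 12 → ℤ) (h : Hit p q 2 ∨ Hit p q 3 ∨ Hit p q 5) :
    afterTrial s u ans ∉ failed p q := by
  refine prepare_hit hp hq hs hu ans ?_
  rw [afterPrepare_reg]
  refine prepare_preserves (holdsForDivisors_isFactor hp hq) (mul_pos hp.pos hq.pos)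
    (drawn hs hu) ?_
  rw [Function.update_of_ne (by norm_num), afterSetup_reg]
  exact setup_finds hp hq (clearRegs_reg_zero hs) h

theorem hit_small {p q : ℕ} (hp : p.Prime) (hq : q.Prime) (hpq : p ≠ q) (h : p < 7 ∨ q < 7) :
    Hit p q 2 ∨ Hit p q 3 ∨ Hit p q 5 := by
  have key : ∀ a b : ℕ, a.Prime → b.Prime → a ≠ b → (a : ℤ) ∣ a ∧ ¬ (b : ℤ) ∣ a := by
    intro a b ha hb hab
    exact ⟨dvd_rfl, fun h => hab ((Nat.prime_dvd_prime_iff_eq hb ha).mp (by exact_mod_cast h)).symm⟩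
  have hs : ∀ a : ℕ, a.Prime → a < 7 → a = 2 ∨ a = 3 ∨ a = 5 := by
    intro a ha h7
    interval_cases a <;> revert ha <;> norm_num
  rcases h with h | h
  · have := key p q hp hq hpq
    rcases hs p hp h with rfl | rfl | rfl
    · exact Or.inl (Or.inl this)
    · exact Or.inr (Or.inl (Or.inl this))
    · exact Or.inr (Or.inr (Or.inl this))
  · have := key q p hq hp hpq.symm
    rcases hs q hq h with rfl | rfl | rfl
    · exact Or.inl (Or.inr this)
    · exact Or.inr (Or.inl (Or.inr this))
    · exact Or.inr (Or.inr (Or.inr this))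

/-- A sample that is not good gives a factor already before the call, by the gcd with a or with a -
b. For a good sample, failure implies that the answer is not a factorisation. -/
theorem sample_fail_le {p q : ℕ} (hp : p.Prime) (hq : q.Prime) (hpq : p ≠ q) (hp2 : p ≠ 2)
    (hq2 : q ≠ 2) (A : IdealFactorer) {s : State} (hs : Inv (p * q) s) {u : ℤ} (hu : 0 ≤ u)
    (ha : sampleOf (p * q) u ∈ samples (p * q)) :
    ((A ((afterPrepare s u).args 26)).map fun ans => afterTrial s u ans).toOuterMeasure
        (failed p q) ≤
      if sampleOf (p * q) u ∈ goodSamples (p * q) then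
        ENNReal.ofReal (1 - linProb A (p * q)
          (sampleOf (p * q) u * sampleOf (p * q) u % (p * q)) (sampleOf (p * q) u))
      else 0 := by
  have hN : 0 < p * q := mul_pos hp.pos hq.pos
  have hd := drawn hs hu
  have hf := fun ans => finish_hit (ans := ans) hp hq hs hu
  have hargs : (afterPrepare s u).args 26 = inputVec (p * q)
      (sampleOf (p * q) u * sampleOf (p * q) u % (p * q))
      (stdCode (p * q) (sampleOf (p * q) u)) := (prepared hN hs hu).args
  rw [PMF.toOuterMeasure_map_apply, hargs]
  have ha0 : 0 < sampleOf (p * q) u := by rw [sampleOf]; omega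
  set a := sampleOf (p * q) u
  split_ifs with hg
  · obtain ⟨hr, -, -⟩ := mem_radicands_of_good hp hq hpq hp2 hq2 hg
    obtain ⟨-, hsq, h1, h2⟩ := mem_radicands_iff.mp hr
    set μ := A (inputVec (p * q) (a * a % (p * q)) (stdCode (p * q) a)) with hμ
    set S := {r | IsFactorisation (a * a % (p * q)) (linIdeal _ (p * q) a) r} with hS
    have hsub : (fun ans => afterTrial s u ans) ⁻¹' failed p q ⊆ Sᶜ := by
      intro ans hans hfac
      exact hf ans (exists_codeNorms hsq hp hq hpq h1 h2 (natCast_mem_linIdeal _ _ _) hfac) hans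
    refine (MeasureTheory.measure_mono hsub).trans ?_
    have hadd := toOuterMeasure_compl μ S
    have hne : μ.toOuterMeasure S ≠ ⊤ := ne_top_of_le_ne_top ENNReal.one_ne_top
      (toOuterMeasure_le_one μ S)
    have : μ.toOuterMeasure Sᶜ = 1 - μ.toOuterMeasure S :=
      ENNReal.eq_sub_of_add_eq hne (by rw [add_comm]; exact hadd)
    rw [this, linProb, ENNReal.ofReal_sub _ ENNReal.toReal_nonneg, ENNReal.ofReal_one,
      ENNReal.ofReal_toReal hne]
  · rw [nonpos_iff_eq_zero]
    refine toOuterMeasure_eq_zero fun ans _ => ?_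
    refine prepare_hit hp hq hs hu ans ?_
    rw [afterPrepare_reg]
    refine prepare_finds hp hq hd ?_
    by_cases hcop : Nat.Coprime a (p * q)
    · refine Or.inr (hit_of_isSquare hp hq hpq ha ?_)
      by_contra hsq
      exact hg (mem_goodSamples_iff.mpr ⟨ha, hcop, hsq⟩)
    · exact Or.inl (hit_of_not_coprime hp hq hpq ha0 (lt_of_mem_samples ha) hcop)

theorem linProb_le_one (A : IdealFactorer) (N δ a : ℕ) : linProb A N δ a ≤ 1 :=
  toReal_toOuterMeasure_le_one _ _

/-- A trial fails with probability at most `1 - ω`. -/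
theorem trial_fail_le {p q : ℕ} (hp : p.Prime) (hq : q.Prime) (hpq : p ≠ q)
    {pres : (δ : ℕ) → Ideal (𝓞 (QuadField δ)) → IdealCode} (hpres : IsPresentation p q pres)
    (A : IdealFactorer) {ω : ℝ} (hω : 0 < ω) (h : ω ≤ successProb p q pres A) {s : State}
    (hs : Inv (p * q) s) :
    (trial.run A s).toOuterMeasure (failed p q) ≤ ENNReal.ofReal (1 - ω) := by
  have hN : 0 < p * q := mul_pos hp.pos hq.pos
  -- A prime factor below 7 is found by the gcds with 2, 3, 5; the counting argument needs both
  -- primes to be at least 7.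
  by_cases hsm : p < 7 ∨ q < 7
  · rw [toOuterMeasure_eq_zero]
    · exact zero_le
    · intro t ht
      obtain ⟨u, hu, ans, rfl⟩ := mem_support_trial ht
      exact setup_hit hp hq hs (mem_support_uniformBelow hu).1 ans (hit_small hp hq hpq hsm)
  push Not at hsm
  obtain ⟨hp7, hq7⟩ := hsm
  have hmain := successProb_le hp hq hpq hp7 hq7 hpres A hω h
  set n := Nat.sqrt (p * q) with hn
  have hn7 : 7 ≤ n := by
    rw [hn, Nat.le_sqrt]
    exact Nat.mul_le_mul hp7 hq7
  have hnn : n * n ≤ p * q := Nat.sqrt_le _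
  -- The number pq - 2n - 1 of samples is positive, so natural and integer subtraction agree and the
  -- random choice is not the default 0.
  have hbig : 2 * n + 2 ≤ p * q := by nlinarith
  have h17 : (afterSetup s).reg 17 = (p * q : ℕ) - n - n - 1 := by
    rw [afterSetup_reg]
    exact (setup_regs (clearRegs_reg_zero hs)).2.2.2.2.1
  have hM : 0 < (afterSetup s).reg 17 := by rw [h17]; omega
  have hcard : ((samples (p * q)).card : ℤ) = (afterSetup s).reg 17 := by
    rw [samples, Nat.card_Ioo, h17, ← hn]
    omega
  set g : ℕ → ENNReal := fun a => if a ∈ goodSamples (p * q) then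
    ENNReal.ofReal (1 - linProb A (p * q) (a * a % (p * q)) a) else 0 with hg
  set M := (afterSetup s).reg 17 with hMdef
  have hcardIco : (Finset.Ico 0 M).card = (samples (p * q)).card := by
    rw [Int.card_Ico]
    omega
  have hpos : 0 < (samples (p * q)).card := by omega
  rw [run_trial, PMF.toOuterMeasure_bind_apply, ← hMdef]
  have hU : ∀ u, uniformBelow M u =
      if u ∈ Finset.Ico 0 M then ((samples (p * q)).card : ENNReal)⁻¹ else 0 := by
    intro u
    rw [uniformBelow, dif_pos hM, PMF.uniformOfFinset_apply, hcardIco]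
    split_ifs <;> rfl
  rw [tsum_eq_sum (s := Finset.Ico 0 M) (fun u hu => by rw [hU, if_neg hu, zero_mul])]
  have hsample : ∀ u ∈ Finset.Ico 0 M, sampleOf (p * q) u ∈ samples (p * q) := by
    intro u hu
    rw [Finset.mem_Ico] at hu
    rw [samples, Finset.mem_Ioo, sampleOf, ← hn]
    omega
  calc ∑ u ∈ Finset.Ico 0 M, uniformBelow M u *
        ((A ((afterPrepare s u).args 26)).map fun ans => afterTrial s u ans).toOuterMeasure
          (failed p q)
      ≤ ∑ u ∈ Finset.Ico 0 M, ((samples (p * q)).card : ENNReal)⁻¹ * g (sampleOf (p * q) u) := by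
        refine Finset.sum_le_sum fun u hu => ?_
        rw [hU, if_pos hu]
        exact mul_le_mul_right (sample_fail_le hp hq hpq (by omega) (by omega) A hs
          (Finset.mem_Ico.mp hu).1 (hsample u hu)) _
    _ = ((samples (p * q)).card : ENNReal)⁻¹ * ∑ a ∈ samples (p * q), g a := by
        rw [← Finset.mul_sum]
        congr 1
        refine Finset.sum_bij (fun u _ => sampleOf (p * q) u) hsample ?_ ?_ (fun _ _ => rfl)
        · intro u hu v hv huv
          rw [Finset.mem_Ico] at hu hv
          simp only [sampleOf] at huv
          omega
        · intro a ha
          rw [samples, Finset.mem_Ioo, ← hn] at ha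
          refine ⟨(a : ℤ) - n - 1, ?_, ?_⟩
          · rw [Finset.mem_Ico]
            omega
          · rw [sampleOf, ← hn]
            omega
    _ = ((samples (p * q)).card : ENNReal)⁻¹ * ENNReal.ofReal
          (∑ a ∈ goodSamples (p * q), (1 - linProb A (p * q) (a * a % (p * q)) a)) := by
        rw [ENNReal.ofReal_sum_of_nonneg fun a _ => sub_nonneg.mpr
          (linProb_le_one A (p * q) _ a), hg, ← Finset.sum_filter]
        congr 2
        ext a
        rw [Finset.mem_filter]
        exact ⟨fun h => h.2, fun h => ⟨(mem_goodSamples_iff.mp h).1, h⟩⟩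
    _ ≤ ((samples (p * q)).card : ENNReal)⁻¹ * ENNReal.ofReal
          ((samples (p * q)).card * (1 - ω)) :=
        mul_le_mul_right (ENNReal.ofReal_le_ofReal (by linarith)) _
    _ = ENNReal.ofReal (1 - ω) := by
        rw [ENNReal.ofReal_mul (Nat.cast_nonneg _), ENNReal.ofReal_natCast, ← mul_assoc,
          ENNReal.inv_mul_cancel (by exact_mod_cast hpos.ne') (ENNReal.natCast_ne_top _), one_mul]

theorem output_spec {p q : ℕ} (hp : p.Prime) (hq : q.Prime) {s : State} (h0 : s.reg 0 = (p * q : ℕ))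
    (h : IsFactor p q (s.reg 2)) : (output.step s).Outputs p q := by
  have hp0 : (p : ℤ) ≠ 0 := by exact_mod_cast hp.ne_zero
  have hq0 : (q : ℤ) ≠ 0 := by exact_mod_cast hq.ne_zero
  have hpos : 0 < s.reg 2 := by
    rcases h with h | h <;> rw [h]
    · exact_mod_cast hp.pos
    · exact_mod_cast hq.pos
  have e0 : (output.step s).reg 0 = s.reg 2 := by
    simp [Prog.step, output, Prog.ev, Op.eval, hpos]
  have e1 : (output.step s).reg 1 = (p * q : ℕ) / s.reg 2 := by
    simp [Prog.step, output, Prog.ev, Op.eval, hpos, h0]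
  rw [State.Outputs, e0, e1]
  rcases h with h | h
  · left
    rw [h]
    push_cast
    exact ⟨rfl, Int.mul_ediv_cancel_left _ hp0⟩
  · right
    rw [h]
    push_cast
    exact ⟨rfl, Int.mul_ediv_cancel _ hq0⟩

theorem mainProg_success {p q : ℕ} (hp : p.Prime) (hq : q.Prime) (hpq : p ≠ q)
    {pres : (δ : ℕ) → Ideal (𝓞 (QuadField δ)) → IdealCode} (hpres : IsPresentation p q pres)
    (A : IdealFactorer) {ω : ℝ} (hω : 0 < ω) (h : ω ≤ successProb p q pres A) (k : ℕ) :
    1 - (1 - ω) ^ k ≤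
      ((mainProg.result A (p * q) k).toOuterMeasure {s | s.Outputs p q}).toReal := by
  have hN : 0 < p * q := mul_pos hp.pos hq.pos
  -- Makes 1 - ω non-negative, so that `ENNReal.ofReal` does not truncate the failure bound.
  have hω1 : ω ≤ 1 := by
    refine h.trans ?_
    rw [successProb]
    rcases (radicands p q).eq_empty_or_nonempty with h0 | h0
    · rw [h0]; simp
    · refine Finset.expect_le h0 fun δ _ => ?_
      rcases (products δ p q).eq_empty_or_nonempty with h1 | h1
      · rw [h1]; simp
      · exact Finset.expect_le h1 fun n _ => toReal_toOuterMeasure_le_one _ _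
  rw [run_mainProg A hN, PMF.toOuterMeasure_map_apply]
  set s₀ := ((initState (p * q) k).tick 1).tick (1 + Nat.size k) with hs₀
  have hs : Inv (p * q) s₀ := inv_tick (inv_tick (inv_initState _ _) _) _
  set μ := iterate (fun s => trial.run A (s.tick 1)) k s₀ with hμ
  have hinv : ∀ s, Inv (p * q) s → ∀ t ∈ (trial.run A (s.tick 1)).support, Inv (p * q) t := by
    intro s hs t ht
    obtain ⟨u, hu, ans, rfl⟩ := mem_support_trial ht
    exact inv_afterTrial hN (inv_tick hs 1) (mem_support_uniformBelow hu).1 ans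
  have hfail := (iterate_fail_le (bad := failed p q) (c := ENNReal.ofReal (1 - ω)) hinv
    (by
      intro s hs hbad t ht
      obtain ⟨u, hu, ans, rfl⟩ := mem_support_trial ht
      rw [failed, Set.mem_ofPred_eq, not_not] at hbad ⊢
      exact trial_preserves hN (holdsForDivisors_isFactor hp hq) (inv_tick hs 1) hbad
        (mem_support_uniformBelow hu).1 ans)
    (fun s hs => trial_fail_le hp hq hpq hpres A hω h (inv_tick hs 1)) k hs).1
  have hμinv : ∀ t ∈ μ.support, Inv (p * q) t := by
    obtain ⟨K, hK⟩ := exists_trial_bound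
    exact fun t ht => (iterate_trial_bound (hK A _ hN) k hs ht).1
  set G := output.step ⁻¹' {s | s.Outputs p q} with hG
  have hGc : μ.toOuterMeasure Gᶜ ≤ ENNReal.ofReal (1 - ω) ^ k := by
    refine le_trans (PMF.toOuterMeasure_mono μ ?_) hfail
    rintro t ⟨htG, ht⟩ hfac
    exact htG (output_spec hp hq (hμinv t ht).reg_zero hfac)
  have hadd := toOuterMeasure_compl μ G
  have hne : μ.toOuterMeasure G ≠ ⊤ := ne_top_of_le_ne_top ENNReal.one_ne_top
    (toOuterMeasure_le_one μ G)
  have hne' : μ.toOuterMeasure Gᶜ ≠ ⊤ := ne_top_of_le_ne_top ENNReal.one_ne_top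
    (toOuterMeasure_le_one μ Gᶜ)
  have h1 : (μ.toOuterMeasure G).toReal + (μ.toOuterMeasure Gᶜ).toReal = 1 := by
    rw [← ENNReal.toReal_add hne hne', hadd, ENNReal.toReal_one]
  have h2 : (μ.toOuterMeasure Gᶜ).toReal ≤ (1 - ω) ^ k := by
    refine ENNReal.toReal_le_of_le_ofReal (pow_nonneg (by linarith) k) ?_
    rwa [ENNReal.ofReal_pow (by linarith)]
  linarith

end RabinQuadratic

end

theorem mainTheorem2 :
    ∃ (R : RabinQuadratic.Prog) (C : ℕ),
      -- `k` trials: at most `k` calls, and polynomial bit cost for each trial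
      (∀ (A : RabinQuadratic.IdealFactorer) (N k : ℕ),
        ∀ s ∈ (R.result A N k).support,
          s.queries ≤ k ∧
          s.time ≤ C * (k + 1) * (1 + Nat.size N + s.maxAnswer) ^ C) ∧
      -- the success probability
      ∀ (p q : ℕ), p.Prime → q.Prime → p ≠ q →
      ∀ (A : RabinQuadratic.IdealFactorer)
        (pres : (δ : ℕ) → Ideal (NumberField.RingOfIntegers (RabinQuadratic.QuadField δ)) →
          RabinQuadratic.IdealCode),
        RabinQuadratic.IsPresentation p q pres →
      ∀ ω : ℝ, 0 < ω → ω ≤ RabinQuadratic.successProb p q pres A →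
      ∀ k : ℕ,
        1 - (1 - ω) ^ k ≤
          ((R.result A (p * q) k).toOuterMeasure {s | s.Outputs p q}).toReal := by
  obtain ⟨C, hC⟩ := RabinQuadratic.exists_time_bound
  exact ⟨RabinQuadratic.mainProg, C, hC, fun p q hp hq hpq A pres hpres ω hω h k =>
    RabinQuadratic.mainProg_success hp hq hpq hpres A hω h k⟩
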